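/- **Setting.** Let $n,m\in\mathbb N$, $n\ge 1$, let $a_1,\dots,a_n$ be a basis of $\mathbb R^n$, let $Q=\{t_1a_1+\dots+t_na_n \mid 0\le t_j\le 1\}$ with faces $\partial Q_j^s=\{t_1a_1+\dots+t_na_n\in Q\mid t_j=s\}$ ($s\in\{0,1\}$) and outward unit normal $\vec\nu$, and let $\vec\theta\in\mathbb R^n$ (for instance $\vec\theta\in[0,1)^n$). Let $V\in C^1(Q;\mathbb R^{m\times m})$ (up to the boundary) have symmetric values a.e., and put $V_{t,\mathbb R}(x)=t^2V(tx)\otimes I_2$ for $t\in[0,1]$, $x\in Q$. In $L^2(Q;\mathbb R^{2m})$ let $-\Delta_{\min}$ be the closure of $-\Delta$ on $C_0^\infty(\operatorname{int}Q;\mathbb R^{2m})$, and let $-\Delta_{\max}$ be $-\Delta$ (in the sense of distributions) on $\operatorname{dom}(-\Delta_{\max})=\{u\in L^2\mid\Delta u\in L^2\}$. Let $\mathcal H_A=\operatorname{dom}(-\Delta_{\max})/\operatorname{dom}(-\Delta_{\min})$ be the Hilbert space of abstract boundary values with the quotient of the graph norm, $\gamma(u)=[u]$ the natural projection onto it, and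 $$\omega([u],[v])=(-\Delta_{\max}u,v)_{L^2}-(u,-\Delta_{\max}v)_{L^2}.$$ Let $M_j=I_m\otimes\begin{bmatrix}\cos2\pi\theta_j&-\sin2\pi\theta_j\\ \sin2\pi\theta_j&\cos2\pi\theta_j\end{bmatrix}$, and let $-\Delta_{\vec\theta,\mathbb R}$ be the restriction of $-\Delta_{\max}$ to the functions $u\in H^2(Q;\mathbb R^{2m})$ with, in the sense of traces, $u(x)=M_ju(x-a_j)$ and $\partial_{\vec\nu}u(x)=-M_j(\partial_{\vec\nu}u)(x-a_j)$ for a.e. $x\in\partial Q_j^1$, $1\le j\le n$. Put $\mathcal X_{\vec\theta}=\gamma(\operatorname{dom}(-\Delta_{\vec\theta,\mathbb R}))$ and $\Upsilon(t)=\gamma(\ker(-\Delta_{\max}+V_{t,\mathbb R}))$. Fix $\tau\in(0,1)$ and $t_*\in[\tau,1]$. The crossing form of the path $\Upsilon:[\tau,1]\ni t\mapsto\Upsilon(t)$ at $t_*$ is the form $$\mathcal Q_{t_*,\mathcal X_{\vec\theta}}(\xi,\eta)=\frac{d}{dt}\,\omega(\xi,R_t\eta)\Big|_{t=t_*},\qquad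 \xi,\eta\in\Upsilon(t_*)\cap\mathcal X_{\vec\theta},$$ where $R_t$, for $t\in[\tau,1]$ near $t_*$, is a $C^1$ family of bounded operators $\Upsilon(t_*)\to\Upsilon(t_*)^\perp$ such that $\Upsilon(t)=\{\xi+R_t\xi\mid\xi\in\Upsilon(t_*)\}$ (all derivatives in $t$ are one-sided at endpoints). **Theorem.** The crossing form $\mathcal Q_{t_*,\mathcal X_{\vec\theta}}$ exists, that is, there is such a family $R_t$, and it is unique. For every $u_{\mathbb R}=(u_1,\dots,u_{2m})\in\ker(-\Delta_{\vec\theta,\mathbb R}+V_{t_*,\mathbb R})$ one has, with $\mathbf u=(u_1+\mathrm iu_2,\dots,u_{2m-1}+\mathrm iu_{2m})$, $$\begin{aligned} \mathcal Q_{t_*,\mathcal X_{\vec\theta}}([u_{\mathbb R}],[u_{\mathbb R}]) &=\int_Q\Big(u_{\mathbb R}(x),\frac{\partial V_{t,\mathbb R}}{\partial t}\Big|_{t=t_*}(x)\,u_{\mathbb R}(x)\Big)_{\mathbb R^{2m}}d^nx\\ &=t_*\,\mathrm{Re}\int_{\partial Q}(x,\vec\nu)_{\mathbb R^n}\big(\mathbf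 u(x),V(t_*x)\mathbf u(x)\big)_{\mathbb C^m}d^{n-1}x +t_*^{-1}\int_{\partial Q}(x,\vec\nu)_{\mathbb R^n}\sum_{i=1}^m\|\nabla\mathbf u_i(x)\|_{\mathbb C^n}^2\,d^{n-1}x\\ &\quad-2t_*^{-1}\,\mathrm{Re}\int_{\partial Q}\big(\nabla\mathbf u(x)\,x,\nabla\mathbf u(x)\,\vec\nu\big)_{\mathbb C^m}d^{n-1}x, \end{aligned}$$ where $\mathbf u$ and $\nabla\mathbf u$ on $\partial Q$ are boundary traces and $d^{n-1}x$ is surface measure. -/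

import Mathlib

open MeasureTheory Set Filter Topology
open scoped ENNReal Kronecker InnerProductSpace ContDiff

noncomputable section

namespace PeriodicMaslov

/-! ### The unit cell, its faces, normals, and surface measure -/

/-- The space `ℝⁿ` with its Euclidean structure. -/
abbrev Pos (n : ℕ) : Type := EuclideanSpace ℝ (Fin n)

/-- The space `ℝ²ᵐ`. The coordinate `(k, 0)` is the `(2k-1)`-st one (the real part of the `k`-th
complex component), the coordinate `(k, 1)` is the `2k`-th one (the imaginary part). -/
abbrev Val (m : ℕ) : Type := EuclideanSpace ℝ (Fin m × Fin 2)

/-- The closed unit cell `Q = {t₁ a₁ + ⋯ + tₙ aₙ | 0 ≤ tⱼ ≤ 1}` of the lattice spanned by `a`. -/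
def cell {n : ℕ} (a : Module.Basis (Fin n) ℝ (Pos n)) : Set (Pos n) := parallelepiped a

/-- The face `∂Q_j^s`: the points of the cell whose `j`-th lattice coordinate is `s ∈ {0, 1}`. -/
def face {n : ℕ} (a : Module.Basis (Fin n) ℝ (Pos n)) (j : Fin n) (s : Fin 2) : Set (Pos n) :=
  {x ∈ cell a | a.repr x j = ((s : ℕ) : ℝ)}

/-- The dual vector `b_j`, normalized by `⟪b_j, a_i⟫ = δ_{ij}`. -/
def dualVec {n : ℕ} (a : Module.Basis (Fin n) ℝ (Pos n)) (j : Fin n) : Pos n :=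
  (InnerProductSpace.toDual ℝ (Pos n)).symm (LinearMap.toContinuousLinearMap (a.coord j))

/-- The outward unit normal of the face `∂Q_j^s`. -/
def faceNormal {n : ℕ} (a : Module.Basis (Fin n) ℝ (Pos n)) (j : Fin n) (s : Fin 2) : Pos n :=
  ((if s = 1 then 1 else -1) * ‖dualVec a j‖⁻¹ : ℝ) • dualVec a j

/-- The surface measure on `∂Q = ⋃ ∂Q_j^s`. -/
def surf {n : ℕ} (a : Module.Basis (Fin n) ℝ (Pos n)) : Measure (Pos n) :=
  (μHE[n - 1] : Measure (Pos n)).restrict (⋃ j, ⋃ s, face a j s)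

/-- The surface integral `∫_{∂Q} F(x, ν(x)) d^{n-1}x`, where `ν` is the outward unit normal, as the
sum of the integrals over the faces (which overlap in null sets). -/
def boundaryIntegral {n : ℕ} (a : Module.Basis (Fin n) ℝ (Pos n)) {E : Type*}
    [NormedAddCommGroup E] [NormedSpace ℝ E] (F : Pos n → Pos n → E) : E :=
  ∑ j, ∑ s, ∫ x in face a j s, F x (faceNormal a j s) ∂(μHE[n - 1] : Measure (Pos n))

/-! ### Test functions, weak derivatives, traces -/

/-- `φ ∈ C_0^∞(int Q; F)`. -/
structure IsTest {n : ℕ} (a : Module.Basis (Fin n) ℝ (Pos n)) {F : Type*}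
    [NormedAddCommGroup F] [NormedSpace ℝ F] (φ : Pos n → F) : Prop where
  smooth : ContDiff ℝ ∞ φ
  compact : HasCompactSupport φ
  supp : tsupport φ ⊆ interior (cell a)

/-- `w ∈ H¹(Q; F)` with weak (Fréchet) derivative `Dw`. -/
structure HasWeakFDeriv {n : ℕ} (a : Module.Basis (Fin n) ℝ (Pos n)) {F : Type*}
    [NormedAddCommGroup F] [NormedSpace ℝ F] (w : Pos n → F) (Dw : Pos n → Pos n →L[ℝ] F) :
    Prop where
  memLp : MemLp w 2 (volume.restrict (cell a))
  memLp_deriv : MemLp Dw 2 (volume.restrict (cell a))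
  parts : ∀ φ : Pos n → ℝ, IsTest a φ → ∀ v : Pos n,
    ∫ x in cell a, (fderiv ℝ φ x v) • w x = - ∫ x in cell a, φ x • Dw x v

/-- `u ∈ H²(Q; F)`: there are a weak derivative and a second weak derivative, all in `L²`. -/
def MemH2 {n : ℕ} (a : Module.Basis (Fin n) ℝ (Pos n)) {F : Type*}
    [NormedAddCommGroup F] [NormedSpace ℝ F] (u : Pos n → F) : Prop :=
  ∃ Du D2u, HasWeakFDeriv a u Du ∧ HasWeakFDeriv a Du D2u

/-- `g ∈ L²(∂Q; F)` is the Dirichlet trace `γ_D w` of `w ∈ H¹(Q; F)`, the trace operator being the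
extension by continuity of the restriction `ψ ↦ ψ|_{∂Q}` from smooth functions. -/
def IsTrace {n : ℕ} (a : Module.Basis (Fin n) ℝ (Pos n)) {F : Type*}
    [NormedAddCommGroup F] [NormedSpace ℝ F] (w g : Pos n → F) : Prop :=
  MemLp g 2 (surf a) ∧ ∃ Dw, HasWeakFDeriv a w Dw ∧ ∃ ψ : ℕ → Pos n → F,
    (∀ k, ContDiff ℝ ∞ (ψ k)) ∧
    Tendsto (fun k => eLpNorm (ψ k - w) 2 (volume.restrict (cell a))) atTop (𝓝 0) ∧
    Tendsto (fun k => eLpNorm (fderiv ℝ (ψ k) - Dw) 2 (volume.restrict (cell a))) atTop (𝓝 0) ∧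
    Tendsto (fun k => eLpNorm (ψ k - g) 2 (surf a)) atTop (𝓝 0)

/-- `G` is the boundary trace `γ_D (∇ u)` of the weak gradient of `u`; the Neumann trace of `u` is
then `x ↦ G x (ν x)`. -/
def IsGradTrace {n : ℕ} (a : Module.Basis (Fin n) ℝ (Pos n)) {F : Type*}
    [NormedAddCommGroup F] [NormedSpace ℝ F] (u : Pos n → F) (G : Pos n → Pos n →L[ℝ] F) : Prop :=
  ∃ Du, HasWeakFDeriv a u Du ∧ IsTrace a Du G

/-! ### Linearity of these notions -/

section Linear

variable {n : ℕ} {a : Module.Basis (Fin n) ℝ (Pos n)} {F : Type*}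
  [NormedAddCommGroup F] [NormedSpace ℝ F]

lemma memLp_zero_two {F' : Type*} [NormedAddCommGroup F'] {μ : Measure (Pos n)} :
    MemLp (0 : Pos n → F') 2 μ := MemLp.zero

lemma memLp_add_two {F' : Type*} [NormedAddCommGroup F'] {μ : Measure (Pos n)}
    {f g : Pos n → F'} (hf : MemLp f 2 μ) (hg : MemLp g 2 μ) : MemLp (f + g) 2 μ := hf.add hg

lemma two_le_infty : (2 : WithTop ℕ∞) ≤ ((⊤ : ℕ∞) : WithTop ℕ∞) := by
  exact WithTop.coe_le_coe.mpr (le_top : (2 : ℕ∞) ≤ ⊤)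

lemma IsTest.add {φ ψ : Pos n → F} (h : IsTest a φ) (h' : IsTest a ψ) : IsTest a (φ + ψ) :=
  ⟨h.smooth.add h'.smooth, h.compact.add h'.compact,
    (tsupport_add φ ψ).trans (union_subset h.supp h'.supp)⟩

lemma IsTest.zero (a : Module.Basis (Fin n) ℝ (Pos n)) : IsTest a (0 : Pos n → F) :=
  ⟨contDiff_const, HasCompactSupport.zero, by simp [tsupport]⟩

lemma IsTest.smul {φ : Pos n → F} (h : IsTest a φ) (c : ℝ) : IsTest a (c • φ) :=
  ⟨contDiff_const.smul h.smooth, h.compact.smul_left (f := fun _ => c),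
    (closure_mono (Function.support_const_smul_subset c φ)).trans h.supp⟩

lemma IsTest.integrable_smul {φ : Pos n → ℝ} (h : IsTest a φ) {w : Pos n → F}
    (hw : MemLp w 2 (volume.restrict (cell a))) :
    IntegrableOn (fun x => φ x • w x) (cell a) := by
  have h1 : MemLp φ 2 (volume.restrict (cell a)) :=
    h.smooth.continuous.memLp_of_hasCompactSupport h.compact
  exact memLp_one_iff_integrable.mp (hw.smul h1)

lemma IsTest.integrable_fderiv_smul {φ : Pos n → ℝ} (h : IsTest a φ) (v : Pos n) {w : Pos n → F}
    (hw : MemLp w 2 (volume.restrict (cell a))) :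
    IntegrableOn (fun x => fderiv ℝ φ x v • w x) (cell a) := by
  have h1 : MemLp (fun x => fderiv ℝ φ x v) 2 (volume.restrict (cell a)) := by
    refine Continuous.memLp_of_hasCompactSupport ?_ ?_
    · exact (h.smooth.continuous_fderiv (by simp)).clm_apply continuous_const
    · exact h.compact.fderiv_apply ℝ v
  exact memLp_one_iff_integrable.mp (hw.smul h1)

lemma HasWeakFDeriv.add {w w' : Pos n → F} {D D' : Pos n → Pos n →L[ℝ] F}
    (h : HasWeakFDeriv a w D) (h' : HasWeakFDeriv a w' D') :
    HasWeakFDeriv a (w + w') (D + D') := by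
  refine ⟨memLp_add_two h.memLp h'.memLp, memLp_add_two h.memLp_deriv h'.memLp_deriv,
    fun φ hφ v => ?_⟩
  have hD : MemLp (fun x => D x v) 2 (volume.restrict (cell a)) :=
    (ContinuousLinearMap.apply ℝ F v).comp_memLp' h.memLp_deriv
  have hD' : MemLp (fun x => D' x v) 2 (volume.restrict (cell a)) :=
    (ContinuousLinearMap.apply ℝ F v).comp_memLp' h'.memLp_deriv
  simp only [Pi.add_apply, smul_add, _root_.add_apply]
  rw [integral_add (hφ.integrable_fderiv_smul v h.memLp) (hφ.integrable_fderiv_smul v h'.memLp),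
    integral_add (hφ.integrable_smul hD) (hφ.integrable_smul hD'), h.parts φ hφ v,
    h'.parts φ hφ v, neg_add]

lemma HasWeakFDeriv.zero (a : Module.Basis (Fin n) ℝ (Pos n)) :
    HasWeakFDeriv a (0 : Pos n → F) 0 :=
  ⟨memLp_zero_two, memLp_zero_two, fun φ _ v => by simp⟩

lemma HasWeakFDeriv.smul {w : Pos n → F} {D : Pos n → Pos n →L[ℝ] F}
    (h : HasWeakFDeriv a w D) (c : ℝ) : HasWeakFDeriv a (c • w) (c • D) := by
  refine ⟨h.memLp.const_smul c, h.memLp_deriv.const_smul c, fun φ hφ v => ?_⟩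
  simp only [Pi.smul_apply, _root_.smul_apply]
  simp_rw [smul_comm _ c]
  rw [integral_smul, integral_smul, h.parts φ hφ v, smul_neg]

lemma HasWeakFDeriv.congr {w w' : Pos n → F} {D : Pos n → Pos n →L[ℝ] F}
    (h : HasWeakFDeriv a w D) (e : w =ᵐ[volume.restrict (cell a)] w') :
    HasWeakFDeriv a w' D := by
  refine ⟨h.memLp.ae_eq e, h.memLp_deriv, fun φ hφ v => ?_⟩
  rw [← h.parts φ hφ v]
  refine integral_congr_ae ?_
  filter_upwards [e] with x hx
  rw [hx]

lemma MemH2.add {u u' : Pos n → F} (h : MemH2 a u) (h' : MemH2 a u') : MemH2 a (u + u') := by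
  obtain ⟨D, E, h1, h2⟩ := h
  obtain ⟨D', E', h1', h2'⟩ := h'
  exact ⟨_, _, h1.add h1', h2.add h2'⟩

lemma MemH2.zero (a : Module.Basis (Fin n) ℝ (Pos n)) : MemH2 a (0 : Pos n → F) :=
  ⟨_, _, HasWeakFDeriv.zero a, HasWeakFDeriv.zero a⟩

lemma MemH2.smul {u : Pos n → F} (h : MemH2 a u) (c : ℝ) : MemH2 a (c • u) := by
  obtain ⟨D, E, h1, h2⟩ := h
  exact ⟨_, _, h1.smul c, h2.smul c⟩

lemma MemH2.congr {u u' : Pos n → F} (h : MemH2 a u)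
    (e : u =ᵐ[volume.restrict (cell a)] u') : MemH2 a u' := by
  obtain ⟨D, E, h1, h2⟩ := h
  exact ⟨_, _, h1.congr e, h2⟩

lemma tendsto_eLpNorm_add {F' : Type*} [NormedAddCommGroup F'] {μ : Measure (Pos n)}
    {f f' : ℕ → Pos n → F'} {g g' : Pos n → F'}
    (hf : ∀ k, AEStronglyMeasurable (f k) μ) (hf' : ∀ k, AEStronglyMeasurable (f' k) μ)
    (hg : AEStronglyMeasurable g μ) (hg' : AEStronglyMeasurable g' μ)
    (h : Tendsto (fun k => eLpNorm (f k - g) 2 μ) atTop (𝓝 0))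
    (h' : Tendsto (fun k => eLpNorm (f' k - g') 2 μ) atTop (𝓝 0)) :
    Tendsto (fun k => eLpNorm (f k + f' k - (g + g')) 2 μ) atTop (𝓝 0) := by
  have hs : Tendsto (fun k => eLpNorm (f k - g) 2 μ + eLpNorm (f' k - g') 2 μ) atTop (𝓝 0) := by
    simpa using h.add h'
  refine tendsto_of_tendsto_of_tendsto_of_le_of_le tendsto_const_nhds hs (fun _ => zero_le) ?_
  intro k
  have : f k + f' k - (g + g') = (f k - g) + (f' k - g') := by abel
  simp only [this]
  exact eLpNorm_add_le ((hf k).sub hg) ((hf' k).sub hg') (by norm_num)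

lemma tendsto_eLpNorm_zero {F' : Type*} [NormedAddCommGroup F'] {μ : Measure (Pos n)} :
    Tendsto (fun _ : ℕ => eLpNorm ((0 : Pos n → F') - 0) 2 μ) atTop (𝓝 0) := by
  have : eLpNorm ((0 : Pos n → F') - 0) 2 μ = 0 := by
    rw [sub_zero]
    exact eLpNorm_zero
  rw [this]
  exact tendsto_const_nhds

lemma tendsto_eLpNorm_smul {F' : Type*} [NormedAddCommGroup F'] [NormedSpace ℝ F']
    {μ : Measure (Pos n)} {f : ℕ → Pos n → F'} {g : Pos n → F'} (c : ℝ)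
    (h : Tendsto (fun k => eLpNorm (f k - g) 2 μ) atTop (𝓝 0)) :
    Tendsto (fun k => eLpNorm (c • f k - c • g) 2 μ) atTop (𝓝 0) := by
  have e : ∀ k, eLpNorm (c • f k - c • g) 2 μ = ‖c‖ₑ * eLpNorm (f k - g) 2 μ := by
    intro k
    rw [← smul_sub, eLpNorm_const_smul]
  simp_rw [e]
  simpa using ENNReal.Tendsto.const_mul h (Or.inr enorm_ne_top)

lemma IsTrace.add {w w' g g' : Pos n → F} (h : IsTrace a w g) (h' : IsTrace a w' g') :
    IsTrace a (w + w') (g + g') := by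
  obtain ⟨hg, D, hD, ψ, h1, h2, h3, h4⟩ := h
  obtain ⟨hg', D', hD', ψ', h1', h2', h3', h4'⟩ := h'
  have hd : ∀ k, fderiv ℝ (ψ k + ψ' k) = fderiv ℝ (ψ k) + fderiv ℝ (ψ' k) := by
    intro k
    ext1 x
    exact fderiv_add ((h1 k).differentiable (by simp) x) ((h1' k).differentiable (by simp) x)
  refine ⟨hg.add hg', _, hD.add hD', fun k => ψ k + ψ' k, fun k => (h1 k).add (h1' k),
    ?_, ?_, ?_⟩
  · exact tendsto_eLpNorm_add (fun k => (h1 k).continuous.aestronglyMeasurable)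
      (fun k => (h1' k).continuous.aestronglyMeasurable) hD.memLp.1 hD'.memLp.1 h2 h2'
  · simp_rw [hd]
    exact tendsto_eLpNorm_add
      (fun k => ((h1 k).continuous_fderiv (by simp)).aestronglyMeasurable)
      (fun k => ((h1' k).continuous_fderiv (by simp)).aestronglyMeasurable)
      hD.memLp_deriv.1 hD'.memLp_deriv.1 h3 h3'
  · exact tendsto_eLpNorm_add (fun k => (h1 k).continuous.aestronglyMeasurable)
      (fun k => (h1' k).continuous.aestronglyMeasurable) hg.1 hg'.1 h4 h4'

lemma IsTrace.zero (a : Module.Basis (Fin n) ℝ (Pos n)) : IsTrace a (0 : Pos n → F) 0 := by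
  refine ⟨memLp_zero_two, 0, HasWeakFDeriv.zero a, fun _ => 0, fun _ => contDiff_const, ?_, ?_, ?_⟩
  · exact tendsto_eLpNorm_zero (F' := F)
  · have e : fderiv ℝ (fun _ : Pos n => (0 : F)) = 0 := funext fun x => by simp
    have e' := tendsto_eLpNorm_zero (F' := Pos n →L[ℝ] F) (μ := volume.restrict (cell a))
    rw [← e] at e'
    rw [← e]
    exact e'
  · exact tendsto_eLpNorm_zero (F' := F)

lemma IsTrace.smul {w g : Pos n → F} (h : IsTrace a w g) (c : ℝ) :
    IsTrace a (c • w) (c • g) := by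
  obtain ⟨hg, D, hD, ψ, h1, h2, h3, h4⟩ := h
  have hd : ∀ k, fderiv ℝ (c • ψ k) = c • fderiv ℝ (ψ k) := by
    intro k
    ext1 x
    exact fderiv_const_smul ((h1 k).differentiable (by simp) x) c
  refine ⟨hg.const_smul c, _, hD.smul c, fun k => c • ψ k, fun k => contDiff_const.smul (h1 k),
    tendsto_eLpNorm_smul c h2, ?_, tendsto_eLpNorm_smul c h4⟩
  simp_rw [hd]
  exact tendsto_eLpNorm_smul c h3

lemma IsTrace.congr {w w' g : Pos n → F} (h : IsTrace a w g)
    (e : w =ᵐ[volume.restrict (cell a)] w') : IsTrace a w' g := by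
  obtain ⟨hg, D, hD, ψ, h1, h2, h3, h4⟩ := h
  refine ⟨hg, D, hD.congr e, ψ, h1, ?_, h3, h4⟩
  have : ∀ k, eLpNorm (ψ k - w') 2 (volume.restrict (cell a)) =
      eLpNorm (ψ k - w) 2 (volume.restrict (cell a)) := by
    intro k
    refine eLpNorm_congr_ae ?_
    filter_upwards [e] with x hx
    simp [hx]
  simpa only [this] using h2

lemma IsGradTrace.add {u u' : Pos n → F} {G G' : Pos n → Pos n →L[ℝ] F}
    (h : IsGradTrace a u G) (h' : IsGradTrace a u' G') : IsGradTrace a (u + u') (G + G') := by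
  obtain ⟨D, h1, h2⟩ := h
  obtain ⟨D', h1', h2'⟩ := h'
  exact ⟨_, h1.add h1', h2.add h2'⟩

lemma IsGradTrace.zero (a : Module.Basis (Fin n) ℝ (Pos n)) :
    IsGradTrace a (0 : Pos n → F) 0 :=
  ⟨_, HasWeakFDeriv.zero a, IsTrace.zero a⟩

lemma IsGradTrace.smul {u : Pos n → F} {G : Pos n → Pos n →L[ℝ] F}
    (h : IsGradTrace a u G) (c : ℝ) : IsGradTrace a (c • u) (c • G) := by
  obtain ⟨D, h1, h2⟩ := h
  exact ⟨_, h1.smul c, h2.smul c⟩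

lemma IsGradTrace.congr {u u' : Pos n → F} {G : Pos n → Pos n →L[ℝ] F}
    (h : IsGradTrace a u G) (e : u =ᵐ[volume.restrict (cell a)] u') : IsGradTrace a u' G := by
  obtain ⟨D, h1, h2⟩ := h
  exact ⟨_, h1.congr e, h2⟩

end Linear

/-! ### The minimal and maximal Laplacians and the space of abstract boundary values -/

/-- The real Hilbert space `L²(Q; ℝ²ᵐ)`. -/
abbrev L2Q {n : ℕ} (a : Module.Basis (Fin n) ℝ (Pos n)) (m : ℕ) : Type :=
  Lp (Val m) 2 (volume.restrict (cell a))

/-- The graph of `-Δ` on `C_0^∞(int Q; ℝ²ᵐ)`. -/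
def testGraph {n : ℕ} (a : Module.Basis (Fin n) ℝ (Pos n)) (m : ℕ) :
    Submodule ℝ (WithLp 2 (L2Q a m × L2Q a m)) where
  carrier := {p | ∃ φ : Pos n → Val m, IsTest a φ ∧
    p.fst =ᵐ[volume.restrict (cell a)] φ ∧
    p.snd =ᵐ[volume.restrict (cell a)] fun x => - Laplacian.laplacian φ x}
  add_mem' := by
    rintro p q ⟨φ, hφ, h1, h2⟩ ⟨ψ, hψ, h3, h4⟩
    refine ⟨φ + ψ, hφ.add hψ, ?_, ?_⟩
    · rw [WithLp.add_fst]
      exact (Lp.coeFn_add _ _).trans (h1.add h3)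
    · rw [WithLp.add_snd]
      refine (Lp.coeFn_add _ _).trans ((h2.add h4).trans (Eventually.of_forall fun x => ?_))
      have e := ContDiffAt.laplacian_add (f₁ := φ) (f₂ := ψ) (x := x)
        (hφ.smooth.contDiffAt.of_le two_le_infty)
        (hψ.smooth.contDiffAt.of_le two_le_infty)
      simp only [Pi.add_apply]
      rw [e]
      abel
  zero_mem' := by
    refine ⟨0, IsTest.zero a, ?_, ?_⟩
    · rw [WithLp.zero_fst]
      exact Lp.coeFn_zero _ _ _
    · rw [WithLp.zero_snd]
      refine (Lp.coeFn_zero _ _ _).trans (Eventually.of_forall fun x => ?_)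
      have e : Laplacian.laplacian (0 : Pos n → Val m) = 0 :=
        InnerProductSpace.laplacian_const (E := Pos n) (c := (0 : Val m))
      simp [e]
  smul_mem' := by
    rintro c p ⟨φ, hφ, h1, h2⟩
    refine ⟨c • φ, hφ.smul c, ?_, ?_⟩
    · rw [WithLp.smul_fst]
      exact (Lp.coeFn_smul _ _).trans (h1.const_smul c)
    · rw [WithLp.smul_snd]
      refine (Lp.coeFn_smul _ _).trans ((h2.const_smul c).trans (Eventually.of_forall fun x => ?_))
      have e := InnerProductSpace.laplacian_smul (f := φ) (x := x) c
        (hφ.smooth.contDiffAt.of_le two_le_infty)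
      simp only [Pi.smul_apply]
      rw [e, smul_neg]

/-- The space `D_max = dom(-Δ_max) = {u ∈ L² | Δu ∈ L²}` with the graph inner product: it is
realized as the graph of `-Δ_max`, that is, as the set of the pairs `(u, f)` in `L² × L²` such that
`f = -Δu` in the sense of distributions: `(f, φ) = (u, -Δφ)` for all `φ ∈ C_0^∞(int Q; ℝ²ᵐ)`. -/
def Dmax {n : ℕ} (a : Module.Basis (Fin n) ℝ (Pos n)) (m : ℕ) :
    Submodule ℝ (WithLp 2 (L2Q a m × L2Q a m)) where
  carrier := {p | ∀ q ∈ testGraph a m, ⟪p.snd, q.fst⟫_ℝ = ⟪p.fst, q.snd⟫_ℝ}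
  add_mem' := by
    intro p p' hp hp' q hq
    simp only [WithLp.add_fst, WithLp.add_snd, inner_add_left, hp q hq, hp' q hq]
  zero_mem' := by
    intro q _
    simp
  smul_mem' := by
    intro c p hp q hq
    simp only [WithLp.smul_fst, WithLp.smul_snd, inner_smul_left, hp q hq]

/-- The space `D_min = dom(-Δ_min)`, as a subspace of `D_max`: the closure of `C_0^∞(int Q; ℝ²ᵐ)`
in the graph norm of `-Δ`. -/
def Dmin {n : ℕ} (a : Module.Basis (Fin n) ℝ (Pos n)) (m : ℕ) : Submodule ℝ (Dmax a m) :=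
  (testGraph a m).topologicalClosure.submoduleOf (Dmax a m)

lemma isClosed_Dmax {n : ℕ} (a : Module.Basis (Fin n) ℝ (Pos n)) (m : ℕ) :
    IsClosed (Dmax a m : Set (WithLp 2 (L2Q a m × L2Q a m))) := by
  have : (Dmax a m : Set (WithLp 2 (L2Q a m × L2Q a m))) =
      ⋂ q ∈ testGraph a m, {p | ⟪p.snd, q.fst⟫_ℝ = ⟪p.fst, q.snd⟫_ℝ} := by
    ext p
    simp [Dmax]
  rw [this]
  refine isClosed_biInter fun q _ => isClosed_eq ?_ ?_
  · exact (WithLp.sndL 2 ℝ _ _).continuous.inner continuous_const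
  · exact (WithLp.fstL 2 ℝ _ _).continuous.inner continuous_const

instance {n : ℕ} (a : Module.Basis (Fin n) ℝ (Pos n)) (m : ℕ) : CompleteSpace (Dmax a m) :=
  (isClosed_Dmax a m).completeSpace_coe

instance isClosed_Dmin {n : ℕ} (a : Module.Basis (Fin n) ℝ (Pos n)) (m : ℕ) :
    IsClosed (Dmin a m : Set (Dmax a m)) :=
  (Submodule.isClosed_topologicalClosure (testGraph a m)).preimage continuous_subtype_val

instance {n : ℕ} (a : Module.Basis (Fin n) ℝ (Pos n)) (m : ℕ) : CompleteSpace (Dmin a m) :=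
  (isClosed_Dmin a m).completeSpace_coe

/-- The Hilbert space of abstract boundary values `ℋ_A = D_max / D_min`, `A = -Δ_min`, with the
quotient norm of the graph norm and the corresponding inner product. -/
def HA {n : ℕ} (a : Module.Basis (Fin n) ℝ (Pos n)) (m : ℕ) : Type := Dmax a m ⧸ Dmin a m

instance {n : ℕ} (a : Module.Basis (Fin n) ℝ (Pos n)) (m : ℕ) : NormedAddCommGroup (HA a m) :=
  inferInstanceAs (NormedAddCommGroup (Dmax a m ⧸ Dmin a m))

instance {n : ℕ} (a : Module.Basis (Fin n) ℝ (Pos n)) (m : ℕ) : InnerProductSpace ℝ (HA a m) :=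
  inferInstanceAs (InnerProductSpace ℝ (Dmax a m ⧸ Dmin a m))

/-- The natural projection `γ : D_max → D_max / D_min`. -/
def bvProj {n : ℕ} (a : Module.Basis (Fin n) ℝ (Pos n)) (m : ℕ) : Dmax a m →ₗ[ℝ] HA a m :=
  (Dmin a m).mkQ

/-- The form `(A* x, y) - (x, A* y)` on `D_max`. -/
def preForm {n : ℕ} (a : Module.Basis (Fin n) ℝ (Pos n)) (m : ℕ) :
    Dmax a m →ₗ[ℝ] Dmax a m →ₗ[ℝ] ℝ :=
  LinearMap.mk₂ ℝ
    (fun x y => ⟪x.1.snd, y.1.fst⟫_ℝ - ⟪x.1.fst, y.1.snd⟫_ℝ)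
    (by intro x x' y; simp [inner_add_left]; ring)
    (by intro c x y; simp [inner_smul_left]; ring)
    (by intro x y y'; simp [inner_add_right]; ring)
    (by intro c x y; simp [inner_smul_right]; ring)

lemma preForm_right_zero {n : ℕ} (a : Module.Basis (Fin n) ℝ (Pos n)) (m : ℕ) (x y : Dmax a m)
    (hy : y ∈ Dmin a m) : preForm a m x y = 0 := by
  have hcl : IsClosed {q : WithLp 2 (L2Q a m × L2Q a m) |
      ⟪x.1.snd, q.fst⟫_ℝ = ⟪x.1.fst, q.snd⟫_ℝ} := by
    refine isClosed_eq ?_ ?_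
    · exact continuous_const.inner (WithLp.fstL 2 ℝ _ _).continuous
    · exact continuous_const.inner (WithLp.sndL 2 ℝ _ _).continuous
  have hsub : (testGraph a m : Set (WithLp 2 (L2Q a m × L2Q a m))) ⊆ {q |
      ⟪x.1.snd, q.fst⟫_ℝ = ⟪x.1.fst, q.snd⟫_ℝ} := fun q hq => x.2 q hq
  have hmem : (y : WithLp 2 (L2Q a m × L2Q a m)) ∈
      closure (testGraph a m : Set (WithLp 2 (L2Q a m × L2Q a m))) := hy
  have := closure_minimal hsub hcl hmem
  exact sub_eq_zero.mpr this

lemma preForm_swap {n : ℕ} (a : Module.Basis (Fin n) ℝ (Pos n)) (m : ℕ) (x y : Dmax a m) :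
    preForm a m x y = - preForm a m y x := by
  simp only [preForm, LinearMap.mk₂_apply]
  rw [real_inner_comm, real_inner_comm y.1.snd]
  ring

/-- The symplectic form `ω(γ x, γ y) = (A* x, y) - (x, A* y)` on the space of abstract boundary
values, where `A* = -Δ_max`. -/
def sympl {n : ℕ} (a : Module.Basis (Fin n) ℝ (Pos n)) (m : ℕ) :
    HA a m →ₗ[ℝ] HA a m →ₗ[ℝ] ℝ :=
  (Dmin a m).liftQ
    { toFun := fun x => (Dmin a m).liftQ (preForm a m x)
        (fun y hy => preForm_right_zero a m x y hy)
      map_add' := fun x x' => Submodule.linearMap_qext _ (map_add (preForm a m) x x')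
      map_smul' := fun c x => Submodule.linearMap_qext _ (map_smul (preForm a m) c x) }
    (by
      intro x hx
      refine Submodule.linearMap_qext _ (LinearMap.ext fun y => ?_)
      change preForm a m x y = 0
      rw [preForm_swap, preForm_right_zero a m y x hx, neg_zero])

lemma sympl_mk {n : ℕ} (a : Module.Basis (Fin n) ℝ (Pos n)) (m : ℕ) (x y : Dmax a m) :
    sympl a m (bvProj a m x) (bvProj a m y) =
      ⟪x.1.snd, y.1.fst⟫_ℝ - ⟪x.1.fst, y.1.snd⟫_ℝ := by
  rfl

/-! ### The Maslov crossing form -/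

/-- Given a symplectic form `σ`, `q` is the crossing form `𝒬_{t₀, 𝒳}` on `Υ(t₀) ∩ 𝒳` of the path `Υ` on `[c, d]`: near `t₀`, the
subspaces `Υ(t)` are the graphs `{u + R_t u | u ∈ Υ(t₀)}` of a `C¹` family of bounded operators
`R_t : Υ(t₀) → Υ(t₀)^⊥`, and `q(u, v) = d/dt σ(u, R_t v) |_{t = t₀}`. -/
def IsCrossingForm {𝓗 : Type*} [NormedAddCommGroup 𝓗] [InnerProductSpace ℝ 𝓗]
    (σ : 𝓗 →ₗ[ℝ] 𝓗 →ₗ[ℝ] ℝ) (𝒳 : Submodule ℝ 𝓗) (Υ : ℝ → Submodule ℝ 𝓗) (c d t₀ : ℝ)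
    (q : LinearMap.BilinForm ℝ ↥(Υ t₀ ⊓ 𝒳)) : Prop :=
  ∃ ε > 0, ∃ R : ℝ → (Υ t₀ →L[ℝ] (Υ t₀)ᗮ),
    ContDiffOn ℝ 1 R (Icc c d ∩ Metric.ball t₀ ε) ∧
    (∀ t ∈ Icc c d ∩ Metric.ball t₀ ε,
      (Υ t : Set 𝓗) = {w | ∃ u : Υ t₀, w = (u : 𝓗) + (R t u : 𝓗)}) ∧
    ∀ u v : ↥(Υ t₀ ⊓ 𝒳),
      HasDerivWithinAt (fun t => σ (u : 𝓗) (R t ⟨(v : 𝓗), v.2.1⟩ : 𝓗)) (q u v) (Icc c d) t₀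

/-! ### The potentials and the path of Lagrangian subspaces -/

/-- `V_{t,ℝ}(x) = t² V(t x) ⊗ I₂`. -/
def potR {n m : ℕ} (V : Pos n → Matrix (Fin m) (Fin m) ℝ) (t : ℝ) (x : Pos n) :
    Matrix (Fin m × Fin 2) (Fin m × Fin 2) ℝ :=
  (t ^ 2 • V (t • x)) ⊗ₖ (1 : Matrix (Fin 2) (Fin 2) ℝ)

/-- The `t`-derivative `∂V_{t,ℝ}(x)/∂t`, entry by entry, for `t ∈ [0, 1]` (one-sided at the
endpoints, since `V` is only given on `Q`). -/
def potRDeriv {n m : ℕ} (V : Pos n → Matrix (Fin m) (Fin m) ℝ) (t : ℝ) (x : Pos n) :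
    Matrix (Fin m × Fin 2) (Fin m × Fin 2) ℝ :=
  Matrix.of fun i j => derivWithin (fun s => potR V s x i j) (Icc 0 1) t

/-- A real matrix acting on the Euclidean space of column vectors. -/
abbrev act {ι : Type*} [Fintype ι] [DecidableEq ι] (M : Matrix ι ι ℝ) (v : EuclideanSpace ℝ ι) :
    EuclideanSpace ℝ ι :=
  Matrix.toLpLin 2 2 M v

/-- `ker(-Δ_max + V_{t,ℝ})` as a subspace of `D_max`. -/
def kerMax {n m : ℕ} (a : Module.Basis (Fin n) ℝ (Pos n))
    (V : Pos n → Matrix (Fin m) (Fin m) ℝ) (t : ℝ) : Submodule ℝ (Dmax a m) where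
  carrier := {p | ∀ᵐ x ∂(volume.restrict (cell a)),
    p.1.snd x + act (potR V t x) (p.1.fst x) = 0}
  add_mem' := by
    intro p p' hp hp'
    have h1 : ∀ᵐ x ∂(volume.restrict (cell a)), (p + p').1.fst x = p.1.fst x + p'.1.fst x :=
      Lp.coeFn_add p.1.fst p'.1.fst
    have h2 : ∀ᵐ x ∂(volume.restrict (cell a)), (p + p').1.snd x = p.1.snd x + p'.1.snd x :=
      Lp.coeFn_add p.1.snd p'.1.snd
    filter_upwards [hp, hp', h1, h2] with x e1 e2 e3 e4
    rw [e3, e4, act, map_add]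
    calc _ = (p.1.snd x + act (potR V t x) (p.1.fst x)) +
          (p'.1.snd x + act (potR V t x) (p'.1.fst x)) := by rw [act, act]; abel
      _ = 0 := by rw [e1, e2, add_zero]
  zero_mem' := by
    have h1 : ∀ᵐ x ∂(volume.restrict (cell a)), (0 : Dmax a m).1.fst x = 0 :=
      Lp.coeFn_zero _ _ _
    have h2 : ∀ᵐ x ∂(volume.restrict (cell a)), (0 : Dmax a m).1.snd x = 0 :=
      Lp.coeFn_zero _ _ _
    filter_upwards [h1, h2] with x e1 e2
    rw [e1, e2, act, map_zero, add_zero]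
  smul_mem' := by
    intro c p hp
    have h1 : ∀ᵐ x ∂(volume.restrict (cell a)), (c • p).1.fst x = c • p.1.fst x :=
      Lp.coeFn_smul c p.1.fst
    have h2 : ∀ᵐ x ∂(volume.restrict (cell a)), (c • p).1.snd x = c • p.1.snd x :=
      Lp.coeFn_smul c p.1.snd
    filter_upwards [hp, h1, h2] with x e1 e2 e3
    rw [e2, e3, act, map_smul, ← smul_add]
    change c • (p.1.snd x + act (potR V t x) (p.1.fst x)) = 0
    rw [e1, smul_zero]

/-- The path `Υ(t) = γ(ker(-Δ_max + V_{t,ℝ}))`. -/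
def bvPath {n m : ℕ} (a : Module.Basis (Fin n) ℝ (Pos n))
    (V : Pos n → Matrix (Fin m) (Fin m) ℝ) (t : ℝ) : Submodule ℝ (HA a m) :=
  (kerMax a V t).map (bvProj a m)

/-! ### The quasi-periodic Laplacian -/

/-- The matrix `M_j = I_m ⊗ (rotation by the angle 2πθ_j)`, given `ϑ = θ_j`. -/
def rotMat (m : ℕ) (ϑ : ℝ) : Matrix (Fin m × Fin 2) (Fin m × Fin 2) ℝ :=
  (1 : Matrix (Fin m) (Fin m) ℝ) ⊗ₖ
    !![Real.cos (2 * Real.pi * ϑ), -Real.sin (2 * Real.pi * ϑ);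
       Real.sin (2 * Real.pi * ϑ), Real.cos (2 * Real.pi * ϑ)]

/-- The `θ`-periodic boundary conditions for the trace `g` of `u` and the trace `G` of `∇u`:
`u_j¹ = ℳ_j u_j⁰` and `∂_j u¹ = -ℳ_j ∂_j u⁰`, where `(ℳ_j w)(x) = M_j w(x - a_j)` and the Neumann
traces `∂_j u^s` are taken with respect to the outward normals. -/
def ThetaBC {n m : ℕ} (a : Module.Basis (Fin n) ℝ (Pos n)) (θ : Fin n → ℝ)
    (g : Pos n → Val m) (G : Pos n → Pos n →L[ℝ] Val m) : Prop :=
  ∀ j, ∀ᵐ x ∂((μHE[n - 1] : Measure (Pos n)).restrict (face a j 1)),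
    g x = act (rotMat m (θ j)) (g (x - a j)) ∧
    G x (faceNormal a j 1) = - act (rotMat m (θ j)) (G (x - a j) (faceNormal a j 0))

/-- `dom(-Δ_{θ,ℝ})` as a subspace of `D_max`: the functions `u ∈ H²(Q; ℝ²ᵐ)` whose traces satisfy
the `θ`-periodic boundary conditions. -/
def thetaDom {n : ℕ} (a : Module.Basis (Fin n) ℝ (Pos n)) (m : ℕ) (θ : Fin n → ℝ) :
    Submodule ℝ (Dmax a m) where
  carrier := {p | MemH2 a p.1.fst ∧ ∃ g G, IsTrace a p.1.fst g ∧ IsGradTrace a p.1.fst G ∧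
    ThetaBC a θ g G}
  add_mem' := by
    rintro p p' ⟨h2, g, G, hg, hG, hb⟩ ⟨h2', g', G', hg', hG', hb'⟩
    have e : (p.1.fst : Pos n → Val m) + (p'.1.fst : Pos n → Val m) =ᵐ[volume.restrict (cell a)] (p + p').1.fst :=
      (Lp.coeFn_add p.1.fst p'.1.fst).symm
    refine ⟨(h2.add h2').congr e, g + g', G + G', (hg.add hg').congr e, (hG.add hG').congr e, ?_⟩
    intro j
    filter_upwards [hb j, hb' j] with x hx hx'
    constructor
    · simp only [Pi.add_apply, hx.1, hx'.1, act, map_add]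
    · simp only [Pi.add_apply, _root_.add_apply, hx.2, hx'.2, act, map_add]
      abel
  zero_mem' := by
    have e : (0 : Pos n → Val m) =ᵐ[volume.restrict (cell a)] (0 : Dmax a m).1.fst :=
      (Lp.coeFn_zero _ _ _).symm
    refine ⟨(MemH2.zero a).congr e, 0, 0, (IsTrace.zero a).congr e,
      (IsGradTrace.zero a).congr e, ?_⟩
    intro j
    refine Eventually.of_forall fun x => ?_
    simp [act]
  smul_mem' := by
    rintro c p ⟨h2, g, G, hg, hG, hb⟩
    have e : c • (p.1.fst : Pos n → Val m) =ᵐ[volume.restrict (cell a)] (c • p).1.fst :=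
      (Lp.coeFn_smul c p.1.fst).symm
    refine ⟨(h2.smul c).congr e, c • g, c • G, (hg.smul c).congr e, (hG.smul c).congr e, ?_⟩
    intro j
    filter_upwards [hb j] with x hx
    constructor
    · simp only [Pi.smul_apply, hx.1, act, map_smul]
    · simp only [Pi.smul_apply, _root_.smul_apply, hx.2, act, map_smul, smul_neg]

/-- The subspace `𝒳_θ = γ(dom(-Δ_{θ,ℝ}))`. -/
def thetaBV {n : ℕ} (a : Module.Basis (Fin n) ℝ (Pos n)) (m : ℕ) (θ : Fin n → ℝ) :
    Submodule ℝ (HA a m) :=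
  (thetaDom a m θ).map (bvProj a m)

/-- `ker(-Δ_{θ,ℝ} + V_{t,ℝ})` as a subspace of `D_max`. -/
def thetaKer {n m : ℕ} (a : Module.Basis (Fin n) ℝ (Pos n)) (θ : Fin n → ℝ)
    (V : Pos n → Matrix (Fin m) (Fin m) ℝ) (t : ℝ) : Submodule ℝ (Dmax a m) :=
  kerMax a V t ⊓ thetaDom a m θ

/-- The class `[u] ∈ Υ(t) ∩ 𝒳_θ` of `u ∈ ker(-Δ_{θ,ℝ} + V_{t,ℝ})`. -/
def kerClass {n m : ℕ} (a : Module.Basis (Fin n) ℝ (Pos n)) (θ : Fin n → ℝ)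
    (V : Pos n → Matrix (Fin m) (Fin m) ℝ) (t : ℝ) (u : thetaKer a θ V t) :
    ↥(bvPath a V t ⊓ thetaBV a m θ) :=
  ⟨bvProj a m u.1, Submodule.mem_map_of_mem u.2.1, Submodule.mem_map_of_mem u.2.2⟩

/-- The function `u : Q → ℝ²ᵐ` underlying an element of `D_max`. -/
def fn {n m : ℕ} {a : Module.Basis (Fin n) ℝ (Pos n)} (p : Dmax a m) : Pos n → Val m := p.1.fst

/-! ### Complex notation -/

/-- The vector `(v₁ + i v₂, …, v_{2m-1} + i v_{2m}) ∈ ℂᵐ`. -/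
def toC {m : ℕ} (v : Val m) : EuclideanSpace ℂ (Fin m) :=
  WithLp.toLp 2 fun k => (v (k, 0) : ℂ) + Complex.I * (v (k, 1) : ℂ)

/-- A real matrix acting on `ℂᵐ`. -/
def actC {m : ℕ} (M : Matrix (Fin m) (Fin m) ℝ) (z : EuclideanSpace ℂ (Fin m)) :
    EuclideanSpace ℂ (Fin m) :=
  Matrix.toLpLin 2 2 (M.map (fun r : ℝ => (r : ℂ))) z

/-- The squared Hilbert-Schmidt norm `∑ᵢ |∇𝐮ᵢ|²` of the complex gradient `v ↦ toC (L v)`. -/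
def gradNormSq {n m : ℕ} (L : Pos n →L[ℝ] Val m) : ℝ :=
  ∑ j : Fin n, ‖toC (L (EuclideanSpace.single j 1))‖ ^ 2

end PeriodicMaslov

end

open PeriodicMaslov

/-!
The crossing form is computed on lifts of boundary values to solutions. Write `V_t` for the operator
of multiplication by the potential and `A = -Δ_min`. A Carleman estimate with the linear weight
`exp (s xᵢ)` (`carleman`) bounds `A + V_t` from below (`exists_lower_bound_Dmin`). Hence `γ` is
bounded below on `ker (A* + V_t)` (`exists_le_norm_bvProjL`), and by the Lax-Milgram theorem
`A* + V_t` has a bounded right inverse (`exists_right_inverse_adjoint`). As `t ↦ V_t` is `C¹` in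
operator norm (`hasDerivWithinAt_mulOp`), a perturbation argument writes the subspaces `Υ(t)` near
`t₀` as graphs of a `C¹` family `R_t`, and gives `C¹` lifts of `v + R_t v` to solutions
`v_t ∈ ker (A* + V_t)` (`exists_graph_family`). Since `ω(u, R_t v) = (u, (V_t - V_{t₀}) v_t)`, the
derivative at `t₀` is `(u, V'_{t₀} v)` (`exists_crossingForm`). The graph of `R_t` determines `R_t`,
so the form is unique (`IsCrossingForm.unique`).

The boundary formula is a Pohozaev identity. Because `V_t(x) = t² V(t x)`, one has
`t ∂_t V_t = 2 V_t + x · ∇ V_t` (`smul_actL_potRDeriv`). For `Δu = V_t u` with `u ∈ H²(Q)`, the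
divergence theorem for the vector fields `(u, V_t u) x`, `(x · ∇u, ∇u)`, `|∇u|² x` and `(u, ∇u)`
expresses `∫ (u, (2 V_t + x · ∇ V_t) u)` by boundary integrals (`setIntegral_pohozaev`); the
second order terms cancel by the symmetry of the weak Hessian (`HasWeakFDeriv.symm_two`). The only
boundary term that is not in the asserted formula is a multiple of `∫ (u, ∂_ν u)`, and it vanishes
because the contributions of opposite faces cancel under the `θ`-periodic boundary conditions
(`ThetaBC.boundaryIntegral_inner_eq_zero`).

The divergence theorem on the cell for the Hausdorff surface measure is obtained by slicing the cell
parallel to its faces (`smul_restrict_cell_eq_map`), and passes to `H¹` functions by the definition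
of the trace (`setIntegral_fderivWithin_bilin`).
-/

namespace PeriodicMaslov

/-! ### Perturbation of kernels -/

section Graph

variable {D H 𝓗 : Type*} [NormedAddCommGroup D] [NormedSpace ℝ D] [CompleteSpace D]
  [NormedAddCommGroup H] [NormedSpace ℝ H]
  [NormedAddCommGroup 𝓗] [InnerProductSpace ℝ 𝓗]

/-- If `γ` is bounded below on the closed subspace `ker A`, then its image is complete and `γ` has
a bounded inverse there. -/
lemma exists_bounded_inverse_on_ker (γ : D →L[ℝ] 𝓗) (A : D →L[ℝ] H) {c : ℝ} (hc : 0 < c)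
    (hγ : ∀ u, A u = 0 → c * ‖u‖ ≤ ‖γ u‖) (Y : Submodule ℝ 𝓗)
    (hY : ∀ w, w ∈ Y ↔ ∃ u, A u = 0 ∧ γ u = w) :
    CompleteSpace Y ∧ ∃ J : Y →L[ℝ] D, (∀ y, A (J y) = 0) ∧ (∀ y, γ (J y) = y) ∧
      ∀ u, A u = 0 → ∀ h : γ u ∈ Y, J ⟨γ u, h⟩ = u := by
  have hbound : ∀ u, A u = 0 → ‖u‖ ≤ c⁻¹ * ‖γ u‖ := by
    intro u hu
    rw [← div_eq_inv_mul, le_div_iff₀ hc, mul_comm]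
    exact hγ u hu
  have hinj : ∀ u v, A u = 0 → A v = 0 → γ u = γ v → u = v := by
    intro u v hu hv h
    have h0 := hbound (u - v) (by rw [map_sub, hu, hv, sub_zero])
    rw [map_sub, h, sub_self, norm_zero, mul_zero] at h0
    exact sub_eq_zero.mp (norm_le_zero_iff.mp h0)
  choose J hJ using fun y : Y => (hY y).mp y.2
  refine ⟨?_, LinearMap.mkContinuous
    { toFun := J, map_add' := ?_, map_smul' := ?_ } c⁻¹ ?_, ?_, ?_, ?_⟩
  · let g : A.ker →L[ℝ] 𝓗 := γ ∘L A.ker.subtypeL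
    have hanti : AntilipschitzWith (Real.toNNReal c⁻¹) g := by
      refine AddMonoidHomClass.antilipschitz_of_bound g fun u => ?_
      rw [Real.coe_toNNReal _ (inv_nonneg.mpr hc.le)]
      exact hbound u u.2
    have : CompleteSpace A.ker := A.isClosed_ker.completeSpace_coe
    have hr : IsComplete (range g) := hanti.isComplete_range g.uniformContinuous
    have e : range g = (Y : Set 𝓗) := by
      ext w
      rw [SetLike.mem_coe, hY]
      constructor
      · rintro ⟨u, rfl⟩
        exact ⟨u, u.2, rfl⟩
      · rintro ⟨u, hu, rfl⟩
        exact ⟨⟨u, hu⟩, rfl⟩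
    rw [e] at hr
    exact hr.completeSpace_coe
  · intro x y
    refine hinj _ _ (hJ _).1 ?_ ?_
    · rw [map_add, (hJ x).1, (hJ y).1, add_zero]
    · rw [(hJ _).2, map_add, (hJ x).2, (hJ y).2]
      rfl
  · intro r x
    refine hinj _ _ (hJ _).1 ?_ ?_
    · rw [map_smul, (hJ x).1, smul_zero]
    · rw [(hJ _).2, map_smul, (hJ x).2]
      rfl
  · intro x
    have := hbound _ (hJ x).1
    rwa [(hJ x).2] at this
  · exact fun y => (hJ y).1
  · exact fun y => (hJ y).2
  · intro u hu h
    exact hinj _ _ (hJ _).1 hu (hJ _).2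

/-- Let `T t` be a `C¹` family of bounded operators such that `T t₀` has a bounded right inverse,
and let `γ` be bounded below on `ker (T t₀)`. Then the images `Υ t = γ (ker (T t))` are, for `t`
near `t₀`, the graphs of a `C¹` family of operators `Υ t₀ → (Υ t₀)ᗮ`, and the points of these graphs
lift to the kernels in a `C¹` way. -/
theorem exists_graph_family (γ : D →L[ℝ] 𝓗) (T : ℝ → D →L[ℝ] H) (S : H →L[ℝ] D)
    {s : Set ℝ} {t₀ : ℝ} (ht₀ : t₀ ∈ s) (hT : ContDiffOn ℝ 1 T s)
    (hS : ∀ f, T t₀ (S f) = f) {c : ℝ} (hc : 0 < c)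
    (hγ : ∀ u, T t₀ u = 0 → c * ‖u‖ ≤ ‖γ u‖) (Υ : ℝ → Submodule ℝ 𝓗)
    (hΥ : ∀ t ∈ s, ∀ w, w ∈ Υ t ↔ ∃ u, T t u = 0 ∧ γ u = w) :
    ∃ ε > 0, ∃ R : ℝ → (Υ t₀ →L[ℝ] (Υ t₀)ᗮ), ∃ L : ℝ → (Υ t₀ →L[ℝ] D),
      ContDiffOn ℝ 1 R (s ∩ Metric.ball t₀ ε) ∧ ContDiffOn ℝ 1 L (s ∩ Metric.ball t₀ ε) ∧
      (∀ t ∈ s ∩ Metric.ball t₀ ε,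
        (Υ t : Set 𝓗) = {w | ∃ u : Υ t₀, w = (u : 𝓗) + (R t u : 𝓗)}) ∧
      (∀ t ∈ s ∩ Metric.ball t₀ ε, ∀ y : Υ t₀,
        T t (L t y) = 0 ∧ γ (L t y) = (y : 𝓗) + (R t y : 𝓗)) ∧
      (∀ u, T t₀ u = 0 → ∀ h : γ u ∈ Υ t₀, L t₀ ⟨γ u, h⟩ = u) := by
  obtain ⟨hcomp, J, hJ0, hJ1, hJ2⟩ :=
    exists_bounded_inverse_on_ker γ (T t₀) hc hγ (Υ t₀) (hΥ t₀ ht₀)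
  -- `T t = T t₀ ∘ Z t`, where `Z t` is invertible for `t` near `t₀`.
  let Z : ℝ → D →L[ℝ] D := fun t => 1 + S ∘L (T t - T t₀)
  have hZ : ContDiffOn ℝ 1 Z s :=
    contDiffOn_const.add ((contDiffOn_const (c := S)).clm_comp (hT.sub contDiffOn_const))
  have hZ0 : Z t₀ = 1 := by simp [Z]
  have hTZ : ∀ t u, T t₀ (Z t u) = T t u := by
    intro t u
    simp [Z, hS]
  let W : ℝ → D →L[ℝ] D := fun t => Ring.inverse (Z t)
  let P : 𝓗 →L[ℝ] Υ t₀ := (Υ t₀).orthogonalProjectionOnto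
  let P' : 𝓗 →L[ℝ] (Υ t₀)ᗮ := (Υ t₀)ᗮ.orthogonalProjectionOnto
  let N : ℝ → Υ t₀ →L[ℝ] Υ t₀ := fun t => P ∘L γ ∘L W t ∘L J
  have hW0 : W t₀ = 1 := by simp [W, hZ0]
  have hN0 : N t₀ = 1 := by
    ext y
    have : P (γ (J y)) = y := by
      rw [hJ1]
      exact Submodule.orthogonalProjectionOnto_mem_subspace_eq_self y
    simp [N, hW0, this]
  have hWt₀ : ContDiffWithinAt ℝ 1 W s t₀ := by
    have h1 : ContDiffAt ℝ 1 Ring.inverse (Z t₀) := by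
      rw [hZ0]
      exact contDiffAt_ringInverse ℝ (1 : (D →L[ℝ] D)ˣ)
    exact h1.comp_contDiffWithinAt t₀ (hZ t₀ ht₀)
  have hNc : ∀ {s'} {t}, ContDiffWithinAt ℝ 1 W s' t → ContDiffWithinAt ℝ 1 N s' t := by
    intro s' t h
    exact contDiffWithinAt_const.clm_comp
      (contDiffWithinAt_const.clm_comp (h.clm_comp contDiffWithinAt_const))
  have hZu : ∀ᶠ t in 𝓝[s] t₀, IsUnit (Z t) := by
    have := (hZ t₀ ht₀).continuousWithinAt
    refine this.eventually ?_
    rw [hZ0]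
    exact Units.isOpen (R := D →L[ℝ] D).mem_nhds isUnit_one
  have hNu : ∀ᶠ t in 𝓝[s] t₀, IsUnit (N t) := by
    have := (hNc hWt₀).continuousWithinAt
    refine this.eventually ?_
    rw [hN0]
    exact Units.isOpen (R := Υ t₀ →L[ℝ] Υ t₀).mem_nhds isUnit_one
  obtain ⟨ε, hε, hball⟩ := Metric.mem_nhdsWithin_iff.mp (hZu.and hNu)
  have hU : ∀ t ∈ s ∩ Metric.ball t₀ ε, IsUnit (Z t) ∧ IsUnit (N t) :=
    fun t ht => hball ⟨ht.2, ht.1⟩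
  have hWd : ∀ t ∈ s ∩ Metric.ball t₀ ε, ContDiffWithinAt ℝ 1 W (s ∩ Metric.ball t₀ ε) t := by
    intro t ht
    obtain ⟨z, hz⟩ := (hU t ht).1
    have h1 : ContDiffAt ℝ 1 Ring.inverse (Z t) := by
      rw [← hz]
      exact contDiffAt_ringInverse ℝ z
    exact h1.comp_contDiffWithinAt t ((hZ t ht.1).mono inter_subset_left)
  have hNid : ∀ t ∈ s ∩ Metric.ball t₀ ε,
      ContDiffWithinAt ℝ 1 (fun t => Ring.inverse (N t)) (s ∩ Metric.ball t₀ ε) t := by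
    intro t ht
    obtain ⟨z, hz⟩ := (hU t ht).2
    have h1 : ContDiffAt ℝ 1 Ring.inverse (N t) := by
      rw [← hz]
      exact contDiffAt_ringInverse ℝ (R := Υ t₀ →L[ℝ] Υ t₀) z
    exact h1.comp_contDiffWithinAt t (hNc (hWd t ht))
  let L : ℝ → (Υ t₀ →L[ℝ] D) := fun t => W t ∘L J ∘L Ring.inverse (N t)
  have hL : ContDiffOn ℝ 1 L (s ∩ Metric.ball t₀ ε) := fun t ht =>
    (hWd t ht).clm_comp (contDiffWithinAt_const.clm_comp (hNid t ht))
  let R : ℝ → (Υ t₀ →L[ℝ] (Υ t₀)ᗮ) := fun t => P' ∘L γ ∘L L t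
  have hR : ContDiffOn ℝ 1 R (s ∩ Metric.ball t₀ ε) :=
    (contDiffOn_const (c := P')).clm_comp ((contDiffOn_const (c := γ)).clm_comp hL)
  have hZW : ∀ t ∈ s ∩ Metric.ball t₀ ε, ∀ u, Z t (W t u) = u := by
    intro t ht u
    have := Ring.mul_inverse_cancel _ (hU t ht).1
    exact DFunLike.congr_fun this u
  have hWZ : ∀ t ∈ s ∩ Metric.ball t₀ ε, ∀ u, W t (Z t u) = u := by
    intro t ht u
    have := Ring.inverse_mul_cancel _ (hU t ht).1
    exact DFunLike.congr_fun this u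
  have hNN : ∀ t ∈ s ∩ Metric.ball t₀ ε, ∀ y, N t (Ring.inverse (N t) y) = y := by
    intro t ht u
    have := Ring.mul_inverse_cancel _ (hU t ht).2
    exact DFunLike.congr_fun this u
  have hNN' : ∀ t ∈ s ∩ Metric.ball t₀ ε, ∀ y, Ring.inverse (N t) (N t y) = y := by
    intro t ht u
    have := Ring.inverse_mul_cancel _ (hU t ht).2
    exact DFunLike.congr_fun this u
  have hlift : ∀ t ∈ s ∩ Metric.ball t₀ ε, ∀ y : Υ t₀,
      T t (L t y) = 0 ∧ γ (L t y) = (y : 𝓗) + (R t y : 𝓗) := by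
    intro t ht y
    constructor
    · rw [← hTZ]
      change T t₀ (Z t (W t (J (Ring.inverse (N t) y)))) = 0
      rw [hZW t ht, hJ0]
    · have h1 : P (γ (L t y)) = y := hNN t ht y
      have h2 := (Υ t₀).starProjection_add_starProjection_orthogonal (γ (L t y))
      rw [← h2]
      congr 1
      exact congrArg Subtype.val h1
  refine ⟨ε, hε, R, L, hR, hL, ?_, hlift, ?_⟩
  · intro t ht
    ext w
    rw [SetLike.mem_coe, hΥ t ht.1]
    constructor
    · rintro ⟨u, hu, rfl⟩
      have hz : T t₀ (Z t u) = 0 := by rw [hTZ, hu]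
      have hm : γ (Z t u) ∈ Υ t₀ := (hΥ t₀ ht₀ _).mpr ⟨_, hz, rfl⟩
      refine ⟨N t ⟨γ (Z t u), hm⟩, ?_⟩
      rw [← (hlift t ht _).2]
      change _ = γ (W t (J (Ring.inverse (N t) (N t ⟨γ (Z t u), hm⟩))))
      rw [hNN' t ht, hJ2 _ hz, hWZ t ht]
    · rintro ⟨y, rfl⟩
      exact ⟨L t y, hlift t ht y⟩
  · intro u hu h
    change W t₀ (J (Ring.inverse (N t₀) ⟨γ u, h⟩)) = u
    rw [hW0, hN0, Ring.inverse_one, one_apply_eq_self, one_apply_eq_self,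
      hJ2 u hu]

end Graph

/-! ### A Carleman estimate with a linear weight -/

section Carleman

variable {n : ℕ} {F : Type*} [NormedAddCommGroup F] [InnerProductSpace ℝ F]

/-- The partial derivative `∂ᵢ f`. -/
noncomputable def pd (i : Fin n) (f : Pos n → F) : Pos n → F :=
  fun x => fderiv ℝ f x (EuclideanSpace.single i 1)

lemma contDiff_pd (i : Fin n) {f : Pos n → F} (hf : ContDiff ℝ ∞ f) : ContDiff ℝ ∞ (pd i f) :=
  (hf.fderiv_right (m := ∞) (by simp)).clm_apply contDiff_const

lemma hasCompactSupport_pd (i : Fin n) {f : Pos n → F} (hf : HasCompactSupport f) :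
    HasCompactSupport (pd i f) := hf.fderiv_apply ℝ _

lemma pd_comm (i j : Fin n) {f : Pos n → F} (hf : ContDiff ℝ ∞ f) :
    pd i (pd j f) = pd j (pd i f) := by
  have hd : Differentiable ℝ (fderiv ℝ f) :=
    (hf.fderiv_right (m := ∞) (by simp)).differentiable (by simp)
  have key : ∀ (i j : Fin n) (x : Pos n), pd i (pd j f) x =
      fderiv ℝ (fderiv ℝ f) x (EuclideanSpace.single i 1) (EuclideanSpace.single j 1) := by
    intro i j x
    have : HasFDerivAt (pd j f) _ x :=
      (hd x).hasFDerivAt.clm_apply (hasFDerivAt_const (EuclideanSpace.single j (1 : ℝ)) x)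
    rw [pd, this.fderiv]
    simp
  ext1 x
  have hs : IsSymmSndFDerivAt ℝ f x := hf.contDiffAt.isSymmSndFDerivAt (by simpa using two_le_infty)
  rw [key, key]
  exact hs _ _

lemma laplacian_eq_sum_pd {f : Pos n → F} (hf : ContDiff ℝ ∞ f) (x : Pos n) :
    Laplacian.laplacian f x = ∑ i, pd i (pd i f) x := by
  rw [InnerProductSpace.laplacian_eq_iteratedFDeriv_orthonormalBasis f
    (EuclideanSpace.basisFun (Fin n) ℝ)]
  refine Finset.sum_congr rfl fun i _ => ?_
  have hd : Differentiable ℝ (fderiv ℝ f) :=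
    (hf.fderiv_right (m := ∞) (by simp)).differentiable (by simp)
  have : HasFDerivAt (pd i f) _ x :=
    (hd x).hasFDerivAt.clm_apply (hasFDerivAt_const (EuclideanSpace.single i (1 : ℝ)) x)
  rw [iteratedFDeriv_two_apply]
  conv_rhs => rw [pd, this.fderiv]
  simp

lemma integrable_inner_of_compactSupport {f g : Pos n → F} (hf : Continuous f) (hg : Continuous g)
    (hc : HasCompactSupport f) : Integrable fun x => ⟪f x, g x⟫_ℝ := by
  refine (hf.inner hg).integrable_of_hasCompactSupport ?_
  refine hc.mono fun x hx => ?_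
  contrapose! hx
  simp only [Function.mem_support, not_not] at hx ⊢
  rw [hx, inner_zero_left]

lemma integral_inner_pd (i : Fin n) {f g : Pos n → F} (hf : ContDiff ℝ ∞ f) (hg : ContDiff ℝ ∞ g)
    (hcf : HasCompactSupport f) :
    ∫ x, ⟪f x, pd i g x⟫_ℝ = - ∫ x, ⟪pd i f x, g x⟫_ℝ :=
  integral_bilinear_fderiv_right_eq_neg_left_of_integrable (B := innerSL ℝ)
    (integrable_inner_of_compactSupport (contDiff_pd i hf).continuous hg.continuous
      (hasCompactSupport_pd i hcf))
    (integrable_inner_of_compactSupport hf.continuous (contDiff_pd i hg).continuous hcf)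
    (integrable_inner_of_compactSupport hf.continuous hg.continuous hcf)
    (fun x _ => hf.differentiable (by simp) x) (fun x _ => hg.differentiable (by simp) x)

lemma integral_inner_self_pd (i : Fin n) {f : Pos n → F} (hf : ContDiff ℝ ∞ f)
    (hcf : HasCompactSupport f) : ∫ x, ⟪f x, pd i f x⟫_ℝ = 0 := by
  have h := integral_inner_pd i hf hf hcf
  have e : ∫ x, ⟪pd i f x, f x⟫_ℝ = ∫ x, ⟪f x, pd i f x⟫_ℝ :=
    integral_congr_ae (Eventually.of_forall fun x => real_inner_comm _ _)
  rw [e] at h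
  linarith

lemma integral_inner_pd_pd_self (i j : Fin n) {f : Pos n → F} (hf : ContDiff ℝ ∞ f)
    (hcf : HasCompactSupport f) : ∫ x, ⟪pd i (pd i f) x, pd j f x⟫_ℝ = 0 := by
  have h := integral_inner_pd i (contDiff_pd i hf) (contDiff_pd j hf)
    (hasCompactSupport_pd i hcf)
  rw [pd_comm i j hf, integral_inner_self_pd j (contDiff_pd i hf) (hasCompactSupport_pd i hcf)] at h
  linarith

/-- Poincaré inequality in a slab. -/
lemma integral_norm_sq_le_of_slab (i : Fin n) {f : Pos n → F} (hf : ContDiff ℝ ∞ f)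
    (hcf : HasCompactSupport f) {r : ℝ} (hr : ∀ x, f x ≠ 0 → |x i| ≤ r) :
    ∫ x, ‖f x‖ ^ 2 ≤ 4 * r ^ 2 * ∫ x, ‖pd i f x‖ ^ 2 := by
  let l : Pos n → ℝ := fun x => x i
  have hl : ContDiff ℝ ∞ l := (EuclideanSpace.proj (𝕜 := ℝ) i).contDiff
  have hlf : ContDiff ℝ ∞ fun x => l x • f x := hl.smul hf
  have hclf : HasCompactSupport fun x => l x • f x := hcf.smul_left (f := l)
  have hpd : ∀ x, pd i (fun x => l x • f x) x = l x • pd i f x + f x := by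
    intro x
    have h1 : HasFDerivAt l (EuclideanSpace.proj (𝕜 := ℝ) i) x :=
      (EuclideanSpace.proj (𝕜 := ℝ) i).hasFDerivAt
    have h2 := h1.smul (hf.differentiable (by simp) x).hasFDerivAt
    have h3 : fderiv ℝ (fun x => l x • f x) x = _ := h2.fderiv
    rw [pd, h3]
    simp [pd]
  have h := integral_inner_pd i hf hlf hcf
  simp_rw [hpd, inner_add_right, inner_smul_right, real_inner_self_eq_norm_sq] at h
  have i1 : Integrable fun x => l x * ⟪f x, pd i f x⟫_ℝ := by
    have := integrable_inner_of_compactSupport hlf.continuous (contDiff_pd i hf).continuous hclf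
    simpa only [real_inner_smul_left] using this
  have i2 : Integrable fun x => ‖f x‖ ^ 2 := by
    simpa only [real_inner_self_eq_norm_sq] using
      integrable_inner_of_compactSupport hf.continuous hf.continuous hcf
  have i3 : Integrable fun x => ‖pd i f x‖ ^ 2 := by
    simpa only [real_inner_self_eq_norm_sq] using
      integrable_inner_of_compactSupport (contDiff_pd i hf).continuous
        (contDiff_pd i hf).continuous (hasCompactSupport_pd i hcf)
  rw [integral_add i1 i2] at h
  have e : ∫ x, l x * ⟪pd i f x, f x⟫_ℝ = ∫ x, l x * ⟪f x, pd i f x⟫_ℝ :=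
    integral_congr_ae (Eventually.of_forall fun x => by simp only [real_inner_comm])
  rw [e] at h
  -- pointwise `-2 l ⟪f, ∂f⟫ ≤ ‖f‖² / 2 + 2 r² ‖∂f‖²`
  have hle : ∫ x, (-2) * (l x * ⟪f x, pd i f x⟫_ℝ) ≤
      ∫ x, (2⁻¹ * ‖f x‖ ^ 2 + 2 * r ^ 2 * ‖pd i f x‖ ^ 2) := by
    refine integral_mono (i1.const_mul _) ((i2.const_mul _).add (i3.const_mul _)) fun x => ?_
    by_cases hx : f x = 0
    · simp only [hx, inner_zero_left, mul_zero, norm_zero]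
      positivity
    · have h1 : |l x| * |⟪f x, pd i f x⟫_ℝ| ≤ r * (‖f x‖ * ‖pd i f x‖) :=
        mul_le_mul (hr x hx) (abs_real_inner_le_norm _ _) (abs_nonneg _)
          ((abs_nonneg _).trans (hr x hx))
      rw [← abs_mul] at h1
      have h2 := neg_abs_le (l x * ⟪f x, pd i f x⟫_ℝ)
      have h3 := sq_nonneg (‖f x‖ - 2 * r * ‖pd i f x‖)
      simp only
      nlinarith
  rw [integral_const_mul, integral_add (i2.const_mul _) (i3.const_mul _), integral_const_mul,
    integral_const_mul] at hle
  linarith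

/-- The weight `exp (s xᵢ)`. -/
noncomputable def expWeight (i : Fin n) (s : ℝ) (x : Pos n) : ℝ := Real.exp (s * x i)

lemma contDiff_expWeight (i : Fin n) (s : ℝ) : ContDiff ℝ ∞ (expWeight i s) :=
  (contDiff_const.mul (EuclideanSpace.proj (𝕜 := ℝ) i).contDiff).exp

lemma pd_expWeight_smul (i j : Fin n) (s : ℝ) {f : Pos n → F} (hf : ContDiff ℝ ∞ f) :
    pd j (fun x => expWeight i s x • f x) = fun x => expWeight i s x • pd j f x +
      (if j = i then s else 0) • (expWeight i s x • f x) := by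
  ext1 x
  have h1 : HasFDerivAt (fun y : Pos n => s * y i) (s • EuclideanSpace.proj (𝕜 := ℝ) i) x :=
    (EuclideanSpace.proj (𝕜 := ℝ) i).hasFDerivAt.const_mul s
  have h2 := h1.exp.smul (hf.differentiable (by simp) x).hasFDerivAt
  have h3 : fderiv ℝ (fun x => expWeight i s x • f x) x = _ := h2.fderiv
  rw [pd, h3]
  unfold expWeight
  by_cases h : j = i
  · subst h
    simp [pd, smul_smul, mul_comm]
  · simp [pd, h, Ne.symm h]

/-- Conjugating the Laplacian with the weight. -/
lemma expWeight_smul_laplacian (i : Fin n) (s : ℝ) {f : Pos n → F} (hf : ContDiff ℝ ∞ f)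
    (x : Pos n) :
    expWeight i s x • Laplacian.laplacian f x =
      (∑ j, pd j (pd j fun y => expWeight i s y • f y) x) + s ^ 2 • (expWeight i s x • f x)
        - (2 * s) • pd i (fun y => expWeight i s y • f y) x := by
  have hw := contDiff_expWeight i s
  have hpd2 : ∀ j, pd j (pd j fun y => expWeight i s y • f y) x =
      expWeight i s x • pd j (pd j f) x + (if j = i then
        (2 * s) • (expWeight i s x • pd i f x) + s ^ 2 • (expWeight i s x • f x) else 0) := by
    intro j
    rw [pd_expWeight_smul i j s hf]
    by_cases h : j = i
    · subst h
      have hA : ContDiff ℝ ∞ fun x => expWeight j s x • pd j f x := hw.smul (contDiff_pd j hf)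
      have hB : ContDiff ℝ ∞ fun x => s • (expWeight j s x • f x) :=
        contDiff_const.smul (hw.smul hf)
      simp only [if_true]
      have hadd : pd j (fun x => expWeight j s x • pd j f x + s • (expWeight j s x • f x)) x =
          pd j (fun x => expWeight j s x • pd j f x) x +
            s • pd j (fun x => expWeight j s x • f x) x := by
        exact DFunLike.congr_fun ((hA.differentiable (by simp) x).hasFDerivAt.add
          (((hw.smul hf).differentiable (by simp) x).hasFDerivAt.const_smul s)).fderiv
          (EuclideanSpace.single j 1)
      rw [hadd, pd_expWeight_smul j j s (contDiff_pd j hf), pd_expWeight_smul j j s hf]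
      simp only [if_true, smul_add]
      module
    · simp only [h, if_false, zero_smul, add_zero]
      rw [pd_expWeight_smul i j s (contDiff_pd j hf)]
      simp [h]
  rw [laplacian_eq_sum_pd hf, pd_expWeight_smul i i s hf]
  simp_rw [hpd2]
  rw [Finset.sum_add_distrib, Finset.sum_ite_eq' Finset.univ i, ← Finset.smul_sum]
  simp only [if_true, Finset.mem_univ]
  module

/-- The Carleman estimate `(s / r) ‖e^{s xᵢ} f‖ ≤ ‖e^{s xᵢ} Δ f‖` for functions supported in the
slab `|xᵢ| ≤ r`: the symmetric and the antisymmetric part of the conjugated Laplacian commute, so the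
cross term vanishes, and the antisymmetric part `-2 s ∂ᵢ` is bounded below by Poincaré's
inequality. -/
theorem carleman (i : Fin n) {s : ℝ} {f : Pos n → F} (hf : ContDiff ℝ ∞ f)
    (hcf : HasCompactSupport f) {r : ℝ} (hr : ∀ x, f x ≠ 0 → |x i| ≤ r) :
    s ^ 2 * ∫ x, ‖expWeight i s x • f x‖ ^ 2 ≤
      r ^ 2 * ∫ x, ‖expWeight i s x • Laplacian.laplacian f x‖ ^ 2 := by
  set v : Pos n → F := fun x => expWeight i s x • f x with hv
  have hvs : ContDiff ℝ ∞ v := (contDiff_expWeight i s).smul hf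
  have hvc : HasCompactSupport v := hcf.smul_left (f := expWeight i s)
  let A : Pos n → F := fun x => (∑ j, pd j (pd j v) x) + s ^ 2 • v x
  have hAs : ContDiff ℝ ∞ A :=
    (ContDiff.sum fun j _ => contDiff_pd j (contDiff_pd j hvs)).add (contDiff_const.smul hvs)
  have hB := contDiff_pd i hvs
  have hBc := hasCompactSupport_pd i hvc
  have cross : ∫ x, ⟪A x, pd i v x⟫_ℝ = 0 := by
    have e : ∀ x, ⟪A x, pd i v x⟫_ℝ =
        (∑ j, ⟪pd j (pd j v) x, pd i v x⟫_ℝ) + s ^ 2 * ⟪v x, pd i v x⟫_ℝ := by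
      intro x
      simp only [A, inner_add_left, sum_inner, real_inner_smul_left]
    have i1 : ∀ j, Integrable fun x => ⟪pd j (pd j v) x, pd i v x⟫_ℝ := fun j =>
      integrable_inner_of_compactSupport (contDiff_pd j (contDiff_pd j hvs)).continuous
        hB.continuous (hasCompactSupport_pd j (hasCompactSupport_pd j hvc))
    have i2 : Integrable fun x => ⟪v x, pd i v x⟫_ℝ :=
      integrable_inner_of_compactSupport hvs.continuous hB.continuous hvc
    simp_rw [e]
    rw [integral_add (integrable_finsetSum _ fun j _ => i1 j) (i2.const_mul _),
      integral_finsetSum _ fun j _ => i1 j, integral_const_mul, integral_inner_self_pd i hvs hvc]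
    simp [integral_inner_pd_pd_self _ i hvs hvc]
  have hAc : HasCompactSupport A := by
    refine HasCompactSupport.add ?_ (hvc.smul_left (f := fun _ => s ^ 2))
    have h0 : ∀ t : Finset (Fin n), HasCompactSupport fun x => ∑ j ∈ t, pd j (pd j v) x := by
      intro t
      induction t using Finset.induction_on with
      | empty =>
        simp_rw [Finset.sum_empty]
        exact HasCompactSupport.zero
      | insert j t hj ih =>
        simp_rw [Finset.sum_insert hj]
        exact (hasCompactSupport_pd j (hasCompactSupport_pd j hvc)).add ih
    exact h0 Finset.univ
  have hlow : 4 * s ^ 2 * ∫ x, ‖pd i v x‖ ^ 2 ≤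
      ∫ x, ‖expWeight i s x • Laplacian.laplacian f x‖ ^ 2 := by
    have e : ∀ x, ‖expWeight i s x • Laplacian.laplacian f x‖ ^ 2 =
        ‖A x‖ ^ 2 + (-(4 * s) * ⟪A x, pd i v x⟫_ℝ + 4 * s ^ 2 * ‖pd i v x‖ ^ 2) := by
      intro x
      rw [expWeight_smul_laplacian i s hf]
      change ‖A x - (2 * s) • pd i v x‖ ^ 2 = _
      rw [norm_sub_sq_real, real_inner_smul_right, norm_smul, mul_pow, Real.norm_eq_abs, sq_abs]
      ring
    have i1 : Integrable fun x => ‖A x‖ ^ 2 := by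
      simpa only [real_inner_self_eq_norm_sq] using
        integrable_inner_of_compactSupport hAs.continuous hAs.continuous hAc
    have i2 : Integrable fun x => ⟪A x, pd i v x⟫_ℝ :=
      integrable_inner_of_compactSupport hAs.continuous hB.continuous hAc
    have i3 : Integrable fun x => ‖pd i v x‖ ^ 2 := by
      simpa only [real_inner_self_eq_norm_sq] using
        integrable_inner_of_compactSupport hB.continuous hB.continuous hBc
    simp_rw [e]
    have i4 : Integrable fun x => -(4 * s) * ⟪A x, pd i v x⟫_ℝ + 4 * s ^ 2 * ‖pd i v x‖ ^ 2 :=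
      (i2.const_mul _).add (i3.const_mul _)
    rw [integral_add i1 i4,
      integral_add (i2.const_mul _) (i3.const_mul _), integral_const_mul, integral_const_mul, cross]
    have : 0 ≤ ∫ x, ‖A x‖ ^ 2 := integral_nonneg fun x => by positivity
    linarith
  have hpo := integral_norm_sq_le_of_slab i hvs hvc (r := r) fun x hx => hr x fun h => hx (by
    simp [hv, h])
  calc s ^ 2 * ∫ x, ‖v x‖ ^ 2 ≤ s ^ 2 * (4 * r ^ 2 * ∫ x, ‖pd i v x‖ ^ 2) :=
        mul_le_mul_of_nonneg_left hpo (sq_nonneg s)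
    _ = r ^ 2 * (4 * s ^ 2 * ∫ x, ‖pd i v x‖ ^ 2) := by ring
    _ ≤ _ := mul_le_mul_of_nonneg_left hlow (sq_nonneg r)

end Carleman

/-! ### Geometry of the unit cell -/

section Cell

variable {n : ℕ} (a : Module.Basis (Fin n) ℝ (Pos n))

lemma mem_cell_iff {x : Pos n} : x ∈ cell a ↔ ∀ i, a.repr x i ∈ Icc (0 : ℝ) 1 := by
  rw [cell, parallelepiped_basis_eq]
  rfl

lemma isCompact_cell : IsCompact (cell a) := a.parallelepiped.isCompact

lemma convex_cell : Convex ℝ (cell a) := convex_parallelepiped a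

lemma nonempty_interior_cell : (interior (cell a)).Nonempty := a.parallelepiped.interior_nonempty

lemma measurableSet_cell : MeasurableSet (cell a) := (isCompact_cell a).isClosed.measurableSet

lemma uniqueDiffOn_cell : UniqueDiffOn ℝ (cell a) :=
  uniqueDiffOn_convex (convex_cell a) (nonempty_interior_cell a)

lemma zero_mem_cell : (0 : Pos n) ∈ cell a := by
  rw [mem_cell_iff]
  simp

lemma smul_mem_cell {x : Pos n} (hx : x ∈ cell a) {t : ℝ} (ht : t ∈ Icc (0 : ℝ) 1) :
    t • x ∈ cell a :=
  (convex_cell a).smul_mem_of_zero_mem (zero_mem_cell a) hx ht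

lemma cell_subset_closure_interior : cell a ⊆ closure (interior (cell a)) := by
  rw [(convex_cell a).closure_interior_eq_closure_of_nonempty_interior (nonempty_interior_cell a)]
  exact subset_closure

lemma restrict_interior_cell :
    (volume : Measure (Pos n)).restrict (interior (cell a)) = volume.restrict (cell a) := by
  refine Measure.restrict_congr_set ?_
  refine (ae_eq_set.mpr ⟨?_, ?_⟩)
  · rw [sdiff_eq_empty.mpr interior_subset, measure_empty]
  · refine measure_mono_null ?_ ((convex_cell a).addHaar_frontier volume)
    exact sdiff_subset_sdiff_left subset_closure

instance isFiniteMeasure_cell : IsFiniteMeasure ((volume : Measure (Pos n)).restrict (cell a)) :=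
  isFiniteMeasure_restrict.mpr (isCompact_cell a).measure_lt_top.ne

end Cell

/-! ### Multiplication operators -/

section MulOp

variable {α : Type*} [MeasurableSpace α] {μ : Measure α} {F : Type*}
  [NormedAddCommGroup F] [InnerProductSpace ℝ F]

open Classical in
/-- The operator of multiplication by the bounded operator-valued function `A` on `L²`
(zero if `A` is not essentially bounded). -/
noncomputable def mulOp (μ : Measure α) (A : α → F →L[ℝ] F) : Lp F 2 μ →L[ℝ] Lp F 2 μ :=
  if h : MemLp A ∞ μ then
    (ContinuousLinearMap.id ℝ (F →L[ℝ] F)).holderL μ ∞ 2 2 h.toLp else 0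

lemma mulOp_coeFn {A : α → F →L[ℝ] F} (hA : MemLp A ∞ μ) (f : Lp F 2 μ) :
    mulOp μ A f =ᵐ[μ] fun x => A x (f x) := by
  rw [mulOp, dif_pos hA, ContinuousLinearMap.holderL_apply_apply]
  refine (ContinuousLinearMap.coeFn_holder _ _ _).trans ?_
  filter_upwards [hA.coeFn_toLp] with x hx
  rw [hx]
  rfl

lemma norm_mulOp_le {A : α → F →L[ℝ] F} (hA : MemLp A ∞ μ) {C : ℝ} (hC : 0 ≤ C)
    (h : ∀ᵐ x ∂μ, ‖A x‖ ≤ C) : ‖mulOp μ A‖ ≤ C := by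
  refine ContinuousLinearMap.opNorm_le_bound _ hC fun f => ?_
  refine Lp.norm_le_mul_norm_of_ae_le_mul ?_
  filter_upwards [mulOp_coeFn hA f, h] with x h1 h2
  rw [h1]
  exact (A x).le_of_opNorm_le h2 _

lemma mulOp_sub {A B : α → F →L[ℝ] F} (hA : MemLp A ∞ μ) (hB : MemLp B ∞ μ) :
    mulOp μ (A - B) = mulOp μ A - mulOp μ B := by
  ext1 f
  refine Lp.ext ?_
  filter_upwards [mulOp_coeFn hA f, mulOp_coeFn hB f, mulOp_coeFn (hA.sub hB) f,
    Lp.coeFn_sub (mulOp μ A f) (mulOp μ B f)] with x h1 h2 h3 h4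
  rw [h3]
  change A x (f x) - B x (f x) = (mulOp μ A f - mulOp μ B f : Lp F 2 μ) x
  rw [h4, Pi.sub_apply, h1, h2]

lemma mulOp_smul {A : α → F →L[ℝ] F} (hA : MemLp A ∞ μ) (c : ℝ) :
    mulOp μ (c • A) = c • mulOp μ A := by
  ext1 f
  refine Lp.ext ?_
  filter_upwards [mulOp_coeFn hA f, mulOp_coeFn (hA.const_smul c) f,
    Lp.coeFn_smul c (mulOp μ A f)] with x h1 h2 h3
  rw [h2]
  change c • A x (f x) = (c • mulOp μ A f : Lp F 2 μ) x
  rw [h3, Pi.smul_apply, h1]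

lemma memLp_top_of_continuousOn {X E : Type*} [TopologicalSpace X] [MeasurableSpace X]
    [OpensMeasurableSpace X] [NormedAddCommGroup E] [SecondCountableTopologyEither X E]
    {ν : Measure X} {K : Set X} (hK : IsCompact K) (hKm : MeasurableSet K) {A : X → E}
    (hA : ContinuousOn A K) : MemLp A ∞ (ν.restrict K) := by
  obtain ⟨C, hC⟩ := hK.exists_bound_of_continuousOn hA
  refine memLp_top_of_bound (hA.aestronglyMeasurable_of_isCompact hK hKm) C ?_
  exact (ae_restrict_iff' hKm).mpr (Eventually.of_forall hC)

lemma hasDerivWithinAt_of_norm_le {E : Type*} [NormedAddCommGroup E] [NormedSpace ℝ E] {f : ℝ → E}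
    {f' : E} {s : Set ℝ} {t : ℝ} (h : ∀ ε > 0, ∃ δ > 0, ∀ r ∈ s, |r - t| < δ →
      ‖f r - f t - (r - t) • f'‖ ≤ ε * ‖r - t‖) : HasDerivWithinAt f f' s t := by
  rw [hasDerivWithinAt_iff_isLittleO, Asymptotics.isLittleO_iff]
  intro ε hε
  obtain ⟨δ, hδ, h⟩ := h ε hε
  filter_upwards [self_mem_nhdsWithin, mem_nhdsWithin_of_mem_nhds (Metric.ball_mem_nhds t hδ)]
    with r hr hrt
  exact h r hr hrt

lemma continuousOn_of_norm_le {E : Type*} [NormedAddCommGroup E] {f : ℝ → E} {s : Set ℝ}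
    (h : ∀ t ∈ s, ∀ ε > 0, ∃ δ > 0, ∀ r ∈ s, |r - t| < δ → ‖f r - f t‖ ≤ ε) :
    ContinuousOn f s := by
  rw [Metric.continuousOn_iff]
  intro t ht ε hε
  obtain ⟨δ, hδ, h⟩ := h t ht (ε / 2) (half_pos hε)
  refine ⟨δ, hδ, fun r hr hrt => ?_⟩
  rw [dist_eq_norm]
  exact (h r hr hrt).trans_lt (half_lt_self hε)

lemma norm_sub_sub_smul_le {E : Type*} [NormedAddCommGroup E] [NormedSpace ℝ E] {A A' : ℝ → E}
    {c d : ℝ} (hd : ∀ t ∈ Icc c d, HasDerivWithinAt A (A' t) (Icc c d) t) {s t ε : ℝ}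
    (hs : s ∈ Icc c d) (ht : t ∈ Icc c d) (hb : ∀ r ∈ uIcc t s, ‖A' r - A' t‖ ≤ ε) :
    ‖A s - A t - (s - t) • A' t‖ ≤ ε * ‖s - t‖ := by
  have hsub : uIcc t s ⊆ Icc c d := uIcc_subset_Icc ht hs
  have hder : ∀ r ∈ uIcc t s, HasDerivWithinAt (fun r => A r - r • A' t)
      (A' r - A' t) (uIcc t s) r := by
    intro r hr
    have h1 := ((hd r (hsub hr)).mono hsub).sub
      ((hasDerivWithinAt_id r (uIcc t s)).smul_const (A' t))
    rwa [one_smul] at h1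
  have := (convex_uIcc t s).norm_image_sub_le_of_norm_hasDerivWithin_le hder hb
    left_mem_uIcc right_mem_uIcc
  refine le_trans (le_of_eq ?_) this
  congr 1
  simp only [sub_smul]
  abel

variable {X : Type*} [PseudoMetricSpace X] [MeasurableSpace X] [OpensMeasurableSpace X]

/-- A family of functions which is jointly continuous on a compact set, together with its
derivative with respect to the parameter, gives a `C¹` family of multiplication operators. -/
theorem hasDerivWithinAt_mulOp {ν : Measure X} {K : Set X}
    [SecondCountableTopologyEither X (F →L[ℝ] F)]
    (hK : IsCompact K) (hKm : MeasurableSet K) {c d : ℝ} {A A' : ℝ → X → F →L[ℝ] F}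
    (hA : ∀ t ∈ Icc c d, ContinuousOn (A t) K)
    (hA' : ContinuousOn (fun p : ℝ × X => A' p.1 p.2) (Icc c d ×ˢ K))
    (hd : ∀ x ∈ K, ∀ t ∈ Icc c d, HasDerivWithinAt (fun s => A s x) (A' t x) (Icc c d) t) :
    (∀ t ∈ Icc c d, HasDerivWithinAt (fun t => mulOp (ν.restrict K) (A t))
      (mulOp (ν.restrict K) (A' t)) (Icc c d) t) ∧
    ContinuousOn (fun t => mulOp (ν.restrict K) (A' t)) (Icc c d) := by
  have hA't : ∀ t ∈ Icc c d, ContinuousOn (A' t) K := fun t ht =>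
    hA'.comp (f := fun x => (t, x)) (by fun_prop) fun x hx => ⟨ht, hx⟩
  have mA : ∀ t ∈ Icc c d, MemLp (A t) ∞ (ν.restrict K) := fun t ht =>
    memLp_top_of_continuousOn hK hKm (hA t ht)
  have mA' : ∀ t ∈ Icc c d, MemLp (A' t) ∞ (ν.restrict K) := fun t ht =>
    memLp_top_of_continuousOn hK hKm (hA't t ht)
  have huc := (isCompact_Icc.prod hK).uniformContinuousOn_of_continuous hA'
  have key : ∀ ε > 0, ∃ δ > 0, ∀ s ∈ Icc c d, ∀ t ∈ Icc c d, |s - t| < δ → ∀ x ∈ K,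
      ‖A' s x - A' t x‖ ≤ ε := by
    intro ε hε
    obtain ⟨δ, hδ, h⟩ := Metric.uniformContinuousOn_iff.mp huc ε hε
    refine ⟨δ, hδ, fun s hs t ht hst x hx => ?_⟩
    have := h (s, x) ⟨hs, hx⟩ (t, x) ⟨ht, hx⟩ (by
      rw [Prod.dist_eq, dist_self, Real.dist_eq, max_eq_left (abs_nonneg _)]
      exact hst)
    rw [dist_eq_norm] at this
    exact this.le
  constructor
  · intro t ht
    refine hasDerivWithinAt_of_norm_le
      (E := Lp F 2 (ν.restrict K) →L[ℝ] Lp F 2 (ν.restrict K)) fun ε hε => ?_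
    obtain ⟨δ, hδ, h⟩ := key ε hε
    refine ⟨δ, hδ, fun s hs hst => ?_⟩
    rw [← mulOp_sub (mA s hs) (mA t ht), ← mulOp_smul (mA' t ht),
      ← mulOp_sub ((mA s hs).sub (mA t ht)) ((mA' t ht).const_smul _)]
    refine norm_mulOp_le (((mA s hs).sub (mA t ht)).sub ((mA' t ht).const_smul _))
      (by positivity) ?_
    refine (ae_restrict_iff' hKm).mpr (Eventually.of_forall fun x hx => ?_)
    have hsub : uIcc t s ⊆ Icc c d := uIcc_subset_Icc ht hs
    refine norm_sub_sub_smul_le (hd x hx) hs ht fun r hr => h r (hsub hr) t ht ?_ x hx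
    exact lt_of_le_of_lt (abs_sub_left_of_mem_uIcc hr) hst
  · refine continuousOn_of_norm_le
      (E := Lp F 2 (ν.restrict K) →L[ℝ] Lp F 2 (ν.restrict K)) fun t ht ε hε => ?_
    obtain ⟨δ, hδ, h⟩ := key ε hε
    refine ⟨δ, hδ, fun s hs hst => ?_⟩
    rw [← mulOp_sub (mA' s hs) (mA' t ht)]
    refine norm_mulOp_le ((mA' s hs).sub (mA' t ht)) hε.le ?_
    refine (ae_restrict_iff' hKm).mpr (Eventually.of_forall fun x hx => ?_)
    exact h s hs t ht hst x hx

end MulOp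

/-! ### The family of potentials -/

section Potential

variable {ι : Type*} [Fintype ι] [DecidableEq ι]

/-- The continuous linear operator `act M`, depending linearly on the matrix `M`. -/
noncomputable def actL :
    Matrix ι ι ℝ →ₗ[ℝ] (EuclideanSpace ℝ ι →L[ℝ] EuclideanSpace ℝ ι) :=
  (LinearMap.toContinuousLinearMap (E := EuclideanSpace ℝ ι)
    (F' := EuclideanSpace ℝ ι)).toLinearMap ∘ₗ (Matrix.toLpLin 2 2).toLinearMap

lemma actL_apply (M : Matrix ι ι ℝ) (v : EuclideanSpace ℝ ι) : actL M v = act M v := rfl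

lemma actL_eq_sum (M : Matrix ι ι ℝ) :
    actL M = ∑ i, ∑ j, M i j • actL (Matrix.single i j (1 : ℝ)) := by
  conv_lhs => rw [Matrix.matrix_eq_sum_single M]
  simp only [map_sum]
  refine Finset.sum_congr rfl fun i _ => Finset.sum_congr rfl fun j _ => ?_
  rw [← map_smul, Matrix.smul_single, smul_eq_mul, mul_one]

lemma inner_act_comm {M : Matrix ι ι ℝ} (hM : M.transpose = M) (v w : EuclideanSpace ℝ ι) :
    ⟪v, act M w⟫_ℝ = ⟪act M v, w⟫_ℝ := by
  simp only [EuclideanSpace.inner_eq_star_dotProduct, act, Matrix.ofLp_toLpLin,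
    Matrix.toLin'_apply, star_trivial]
  rw [dotProduct_comm, Matrix.dotProduct_mulVec, ← Matrix.mulVec_transpose, hM, dotProduct_comm]

lemma continuousOn_actL {X : Type*} [TopologicalSpace X] {M : X → Matrix ι ι ℝ} {s : Set X}
    (h : ∀ i j, ContinuousOn (fun x => M x i j) s) : ContinuousOn (fun x => actL (M x)) s := by
  simp_rw [fun x => actL_eq_sum (M x)]
  exact continuousOn_finsetSum _ fun i _ => continuousOn_finsetSum _ fun j _ =>
    (h i j).smul continuousOn_const

lemma contDiffOn_actL {X : Type*} [NormedAddCommGroup X] [NormedSpace ℝ X]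
    {M : X → Matrix ι ι ℝ} {s : Set X} (h : ∀ i j, ContDiffOn ℝ 1 (fun x => M x i j) s) :
    ContDiffOn ℝ 1 (fun x => actL (M x)) s := by
  simp_rw [fun x => actL_eq_sum (M x)]
  exact ContDiffOn.sum fun i _ => ContDiffOn.sum fun j _ => (h i j).smul contDiffOn_const

lemma hasDerivWithinAt_actL {M : ℝ → Matrix ι ι ℝ} {M' : Matrix ι ι ℝ} {s : Set ℝ} {t : ℝ}
    (h : ∀ i j, HasDerivWithinAt (fun r => M r i j) (M' i j) s t) :
    HasDerivWithinAt (fun r => actL (M r)) (actL M') s t := by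
  simp_rw [fun r => actL_eq_sum (M r), actL_eq_sum M']
  exact HasDerivWithinAt.fun_sum fun i _ => HasDerivWithinAt.fun_sum fun j _ =>
    (h i j).smul_const (actL (Matrix.single i j (1 : ℝ)))

variable {n m : ℕ} {a : Module.Basis (Fin n) ℝ (Pos n)} {V : Pos n → Matrix (Fin m) (Fin m) ℝ}

lemma potR_apply (V : Pos n → Matrix (Fin m) (Fin m) ℝ) (t : ℝ) (x : Pos n)
    (i j : Fin m × Fin 2) :
    potR V t x i j = t ^ 2 * V (t • x) i.1 j.1 * (1 : Matrix (Fin 2) (Fin 2) ℝ) i.2 j.2 := by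
  simp [potR, Matrix.kroneckerMap_apply]

lemma hasDerivWithinAt_potR (hV : ∀ k l, ContDiffOn ℝ 1 (fun x => V x k l) (cell a)) {x : Pos n}
    (hx : x ∈ cell a) {t : ℝ} (ht : t ∈ Icc (0 : ℝ) 1) (i j : Fin m × Fin 2) :
    HasDerivWithinAt (fun s => potR V s x i j)
      ((2 * t * V (t • x) i.1 j.1 +
        t ^ 2 * fderivWithin ℝ (fun y => V y i.1 j.1) (cell a) (t • x) x) *
          (1 : Matrix (Fin 2) (Fin 2) ℝ) i.2 j.2) (Icc 0 1) t := by
  simp_rw [potR_apply]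
  have h1 : HasFDerivWithinAt (fun y => V y i.1 j.1) _ (cell a) (t • x) :=
    ((hV i.1 j.1).differentiableOn (by simp) _ (smul_mem_cell a hx ht)).hasFDerivWithinAt
  have h2 : HasDerivWithinAt (fun s : ℝ => s • x) ((1 : ℝ) • x) (Icc 0 1) t :=
    (hasDerivWithinAt_id t _).smul_const x
  have h3 := h1.comp_hasDerivWithinAt t h2 fun s hs => smul_mem_cell a hx hs
  rw [one_smul] at h3
  have h4 : HasDerivWithinAt (fun s : ℝ => s ^ 2) (2 * t) (Icc 0 1) t := by
    simpa using (hasDerivAt_pow 2 t).hasDerivWithinAt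
  exact (h4.mul h3).mul_const _

lemma potRDeriv_apply (hV : ∀ k l, ContDiffOn ℝ 1 (fun x => V x k l) (cell a)) {x : Pos n}
    (hx : x ∈ cell a) {t : ℝ} (ht : t ∈ Icc (0 : ℝ) 1) (i j : Fin m × Fin 2) :
    potRDeriv V t x i j = (2 * t * V (t • x) i.1 j.1 +
        t ^ 2 * fderivWithin ℝ (fun y => V y i.1 j.1) (cell a) (t • x) x) *
          (1 : Matrix (Fin 2) (Fin 2) ℝ) i.2 j.2 :=
  (hasDerivWithinAt_potR hV hx ht i j).derivWithin (uniqueDiffOn_Icc one_pos t ht)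

lemma continuousOn_smul_cell :
    ContinuousOn (fun p : ℝ × Pos n => p.1 • p.2) (Icc 0 1 ×ˢ cell a) := by fun_prop

lemma continuousOn_potR (hV : ∀ k l, ContDiffOn ℝ 1 (fun x => V x k l) (cell a)) :
    ContinuousOn (fun p : ℝ × Pos n => actL (potR V p.1 p.2)) (Icc 0 1 ×ˢ cell a) := by
  refine continuousOn_actL fun i j => ?_
  simp_rw [potR_apply]
  have h1 : ContinuousOn (fun p : ℝ × Pos n => V (p.1 • p.2) i.1 j.1) (Icc 0 1 ×ˢ cell a) :=
    (hV i.1 j.1).continuousOn.comp continuousOn_smul_cell fun p hp => smul_mem_cell a hp.2 hp.1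
  exact ((by fun_prop : ContinuousOn (fun p : ℝ × Pos n => p.1 ^ 2) _).mul h1).mul
    continuousOn_const

lemma continuousOn_potRDeriv (hV : ∀ k l, ContDiffOn ℝ 1 (fun x => V x k l) (cell a)) :
    ContinuousOn (fun p : ℝ × Pos n => actL (potRDeriv V p.1 p.2)) (Icc 0 1 ×ˢ cell a) := by
  refine continuousOn_actL fun i j => ?_
  have h1 : ContinuousOn (fun p : ℝ × Pos n => V (p.1 • p.2) i.1 j.1) (Icc 0 1 ×ˢ cell a) :=
    (hV i.1 j.1).continuousOn.comp continuousOn_smul_cell fun p hp => smul_mem_cell a hp.2 hp.1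
  have h2 : ContinuousOn (fun p : ℝ × Pos n =>
      fderivWithin ℝ (fun y => V y i.1 j.1) (cell a) (p.1 • p.2)) (Icc 0 1 ×ˢ cell a) :=
    ((hV i.1 j.1).continuousOn_fderivWithin (uniqueDiffOn_cell a) (by simp)).comp
      continuousOn_smul_cell fun p hp => smul_mem_cell a hp.2 hp.1
  have h3 : ContinuousOn (fun p : ℝ × Pos n => (2 * p.1 * V (p.1 • p.2) i.1 j.1 +
        p.1 ^ 2 * fderivWithin ℝ (fun y => V y i.1 j.1) (cell a) (p.1 • p.2) p.2) *
          (1 : Matrix (Fin 2) (Fin 2) ℝ) i.2 j.2) (Icc 0 1 ×ˢ cell a) :=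
    (((by fun_prop : ContinuousOn (fun p : ℝ × Pos n => 2 * p.1) _).mul h1).add
      ((by fun_prop : ContinuousOn (fun p : ℝ × Pos n => p.1 ^ 2) _).mul
        (h2.clm_apply continuousOn_snd))).mul continuousOn_const
  exact h3.congr fun p hp => potRDeriv_apply hV hp.2 hp.1 i j

lemma transpose_eq_of_ae (hVsymm : ∀ᵐ x ∂(volume.restrict (cell a)), (V x).transpose = V x)
    (hV : ∀ k l, ContDiffOn ℝ 1 (fun x => V x k l) (cell a)) {x : Pos n} (hx : x ∈ cell a) :
    (V x).transpose = V x := by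
  ext k l
  have h : (fun x => V x l k) =ᵐ[volume.restrict (cell a)] fun x => V x k l := by
    filter_upwards [hVsymm] with y hy
    exact congrFun (congrFun hy k) l
  exact Measure.eqOn_of_ae_eq h (hV l k).continuousOn (hV k l).continuousOn
    (cell_subset_closure_interior a) hx

lemma transpose_potR (hVsymm : ∀ᵐ x ∂(volume.restrict (cell a)), (V x).transpose = V x)
    (hV : ∀ k l, ContDiffOn ℝ 1 (fun x => V x k l) (cell a)) {x : Pos n} (hx : x ∈ cell a)
    {t : ℝ} (ht : t ∈ Icc (0 : ℝ) 1) : (potR V t x).transpose = potR V t x := by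
  ext i j
  have h := congrFun (congrFun (transpose_eq_of_ae hVsymm hV (smul_mem_cell a hx ht)) i.1) j.1
  rw [Matrix.transpose_apply] at h
  rw [Matrix.transpose_apply, potR_apply, potR_apply, h, Matrix.one_apply, Matrix.one_apply]
  simp only [eq_comm]

/-- The operator of multiplication by `V_{t,ℝ}`. -/
noncomputable def potOp (a : Module.Basis (Fin n) ℝ (Pos n))
    (V : Pos n → Matrix (Fin m) (Fin m) ℝ) (t : ℝ) : L2Q a m →L[ℝ] L2Q a m :=
  mulOp (volume.restrict (cell a)) fun x => actL (potR V t x)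

/-- The operator of multiplication by `∂V_{t,ℝ}/∂t`. -/
noncomputable def potDerivOp (a : Module.Basis (Fin n) ℝ (Pos n))
    (V : Pos n → Matrix (Fin m) (Fin m) ℝ) (t : ℝ) : L2Q a m →L[ℝ] L2Q a m :=
  mulOp (volume.restrict (cell a)) fun x => actL (potRDeriv V t x)

lemma memLp_potR (hV : ∀ k l, ContDiffOn ℝ 1 (fun x => V x k l) (cell a)) {t : ℝ}
    (ht : t ∈ Icc (0 : ℝ) 1) :
    MemLp (fun x => actL (potR V t x)) ∞ (volume.restrict (cell a)) :=
  memLp_top_of_continuousOn (isCompact_cell a) (measurableSet_cell a)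
    ((continuousOn_potR hV).comp (f := fun x => (t, x)) (by fun_prop) fun _ hx => ⟨ht, hx⟩)

lemma memLp_potRDeriv (hV : ∀ k l, ContDiffOn ℝ 1 (fun x => V x k l) (cell a)) {t : ℝ}
    (ht : t ∈ Icc (0 : ℝ) 1) :
    MemLp (fun x => actL (potRDeriv V t x)) ∞ (volume.restrict (cell a)) :=
  memLp_top_of_continuousOn (isCompact_cell a) (measurableSet_cell a)
    ((continuousOn_potRDeriv hV).comp (f := fun x => (t, x)) (by fun_prop) fun _ hx => ⟨ht, hx⟩)

lemma potOp_coeFn (hV : ∀ k l, ContDiffOn ℝ 1 (fun x => V x k l) (cell a)) {t : ℝ}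
    (ht : t ∈ Icc (0 : ℝ) 1) (f : L2Q a m) :
    potOp a V t f =ᵐ[volume.restrict (cell a)] fun x => act (potR V t x) (f x) :=
  mulOp_coeFn (memLp_potR hV ht) f

lemma potDerivOp_coeFn (hV : ∀ k l, ContDiffOn ℝ 1 (fun x => V x k l) (cell a)) {t : ℝ}
    (ht : t ∈ Icc (0 : ℝ) 1) (f : L2Q a m) :
    potDerivOp a V t f =ᵐ[volume.restrict (cell a)] fun x => act (potRDeriv V t x) (f x) :=
  mulOp_coeFn (memLp_potRDeriv hV ht) f

lemma inner_potOp_comm (hVsymm : ∀ᵐ x ∂(volume.restrict (cell a)), (V x).transpose = V x)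
    (hV : ∀ k l, ContDiffOn ℝ 1 (fun x => V x k l) (cell a)) {t : ℝ}
    (ht : t ∈ Icc (0 : ℝ) 1) (f g : L2Q a m) :
    ⟪f, potOp a V t g⟫_ℝ = ⟪potOp a V t f, g⟫_ℝ := by
  rw [L2.inner_def, L2.inner_def]
  refine integral_congr_ae ?_
  filter_upwards [potOp_coeFn hV ht f, potOp_coeFn hV ht g,
    ae_restrict_mem (measurableSet_cell a)] with x h1 h2 hx
  rw [h1, h2, inner_act_comm (transpose_potR hVsymm hV hx ht)]

lemma hasDerivWithinAt_potOp (hV : ∀ k l, ContDiffOn ℝ 1 (fun x => V x k l) (cell a)) :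
    (∀ t ∈ Icc (0 : ℝ) 1, HasDerivWithinAt (potOp a V) (potDerivOp a V t) (Icc 0 1) t) ∧
    ContinuousOn (potDerivOp a V) (Icc 0 1) := by
  refine hasDerivWithinAt_mulOp (A := fun t x => actL (potR V t x))
    (A' := fun t x => actL (potRDeriv V t x)) (isCompact_cell a) (measurableSet_cell a)
    (fun t ht => (continuousOn_potR hV).comp (f := fun x => (t, x)) (by fun_prop)
      fun _ hx => ⟨ht, hx⟩) (continuousOn_potRDeriv hV) fun x hx t ht => ?_
  refine hasDerivWithinAt_actL fun i j => ?_
  rw [potRDeriv_apply hV hx ht]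
  exact hasDerivWithinAt_potR hV hx ht i j

lemma contDiffOn_one_of_hasDerivWithinAt {E : Type*} [NormedAddCommGroup E] [NormedSpace ℝ E]
    {f f' : ℝ → E} {s : Set ℝ} (hs : UniqueDiffOn ℝ s)
    (h : ∀ t ∈ s, HasDerivWithinAt f (f' t) s t) (hc : ContinuousOn f' s) :
    ContDiffOn ℝ 1 f s := by
  have h1 : ContDiffOn ℝ (0 + 1) f s := by
    rw [contDiffOn_succ_iff_derivWithin hs]
    refine ⟨fun t ht => (h t ht).differentiableWithinAt, by simp, ?_⟩
    rw [contDiffOn_zero]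
    exact hc.congr fun t ht => (h t ht).derivWithin (hs t ht)
  simpa using h1

lemma contDiffOn_potOp (hV : ∀ k l, ContDiffOn ℝ 1 (fun x => V x k l) (cell a)) :
    ContDiffOn ℝ 1 (potOp a V) (Icc 0 1) :=
  contDiffOn_one_of_hasDerivWithinAt (E := L2Q a m →L[ℝ] L2Q a m) (uniqueDiffOn_Icc one_pos)
    (hasDerivWithinAt_potOp hV).1 (hasDerivWithinAt_potOp hV).2

end Potential

/-! ### Lower bound for the minimal operator and surjectivity of the maximal one -/

section LowerBound

variable {n m : ℕ} (a : Module.Basis (Fin n) ℝ (Pos n))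

/-- Multiplication by `exp (s xᵢ)` on `L²(Q; ℝ²ᵐ)`. -/
noncomputable def weightOp (m : ℕ) (i : Fin n) (s : ℝ) : L2Q a m →L[ℝ] L2Q a m :=
  mulOp (volume.restrict (cell a)) fun x => expWeight i s x • ContinuousLinearMap.id ℝ (Val m)

lemma expWeight_pos (i : Fin n) (s : ℝ) (x : Pos n) : 0 < expWeight i s x := Real.exp_pos _

lemma weightOp_coeFn (i : Fin n) (s : ℝ) (f : L2Q a m) :
    weightOp a m i s f =ᵐ[volume.restrict (cell a)] fun x => expWeight i s x • f x :=
  mulOp_coeFn (memLp_top_of_continuousOn (isCompact_cell a) (measurableSet_cell a)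
    ((contDiff_expWeight i s).continuous.smul continuous_const).continuousOn) f

lemma norm_sq_weightOp (i : Fin n) (s : ℝ) (f : L2Q a m) {φ : Pos n → Val m}
    (hφ : f =ᵐ[volume.restrict (cell a)] φ) (hs : ∀ x, x ∉ cell a → φ x = 0) :
    ‖weightOp a m i s f‖ ^ 2 = ∫ x, ‖expWeight i s x • φ x‖ ^ 2 := by
  rw [← real_inner_self_eq_norm_sq, L2.inner_def]
  have h1 : ∫ x in cell a, ⟪weightOp a m i s f x, weightOp a m i s f x⟫_ℝ =
      ∫ x in cell a, ‖expWeight i s x • φ x‖ ^ 2 := by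
    refine integral_congr_ae ?_
    filter_upwards [weightOp_coeFn a i s f, hφ] with x h1 h2
    rw [h1, h2, real_inner_self_eq_norm_sq]
  rw [h1]
  exact setIntegral_eq_integral_of_forall_compl_eq_zero fun x hx => by simp [hs x hx]

lemma IsTest.eq_zero {a : Module.Basis (Fin n) ℝ (Pos n)} {F : Type*} [NormedAddCommGroup F]
    [NormedSpace ℝ F] {φ : Pos n → F} (h : IsTest a φ) {x : Pos n} (hx : x ∉ cell a) : φ x = 0 :=
  image_eq_zero_of_notMem_tsupport fun h' => hx (interior_subset (h.supp h'))

lemma carleman_testGraph (i : Fin n) {s r : ℝ} (hs : 0 ≤ s) (hr0 : 0 ≤ r)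
    (hr : ∀ x ∈ cell a, |x i| ≤ r) {p : WithLp 2 (L2Q a m × L2Q a m)} (hp : p ∈ testGraph a m) :
    s * ‖weightOp a m i s p.fst‖ ≤ r * ‖weightOp a m i s p.snd‖ := by
  obtain ⟨φ, hφ, h1, h2⟩ := hp
  have hc := carleman i (s := s) hφ.smooth hφ.compact (r := r) fun x hx =>
    hr x (by by_contra h; exact hx (hφ.eq_zero h))
  have hlap : ∀ x, x ∉ cell a → - Laplacian.laplacian φ x = 0 := by
    intro x hx
    have hx' : x ∉ tsupport φ := fun h => hx (interior_subset (hφ.supp h))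
    have e : φ =ᶠ[𝓝 x] fun _ => 0 := notMem_tsupport_iff_eventuallyEq.mp hx'
    rw [InnerProductSpace.laplacian_congr_nhds e |>.eq_of_nhds, neg_eq_zero]
    exact congrFun (InnerProductSpace.laplacian_const (E := Pos n) (c := (0 : Val m))) x
  have e1 := norm_sq_weightOp a i s p.fst h1 fun x hx => hφ.eq_zero hx
  have e2 := norm_sq_weightOp a i s p.snd h2 hlap
  simp only [smul_neg, norm_neg] at e2
  rw [← e1, ← e2, ← mul_pow, ← mul_pow] at hc
  exact (pow_le_pow_iff_left₀ (by positivity) (by positivity) two_ne_zero).mp hc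

/-- `-Δ_min + A` is bounded below for every bounded potential `A`; this is a quantitative form of
unique continuation from the boundary. -/
theorem exists_lower_bound_Dmin (hn : 0 < n) {A : Pos n → Val m →L[ℝ] Val m}
    (hA : MemLp A ∞ (volume.restrict (cell a))) :
    ∃ c > 0, ∀ p ∈ (testGraph a m).topologicalClosure,
      c * ‖p.fst‖ ≤ ‖p.snd + mulOp (volume.restrict (cell a)) A p.fst‖ := by
  let i : Fin n := ⟨0, hn⟩
  set M := mulOp (volume.restrict (cell a)) A with hM
  obtain ⟨r, hr⟩ : ∃ r > 0, ∀ x ∈ cell a, |x i| ≤ r := by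
    obtain ⟨C, hC⟩ := (isCompact_cell a).exists_bound_of_continuousOn
      (f := fun x : Pos n => x i) (by fun_prop)
    exact ⟨max C 1, by positivity, fun x hx => (hC x hx).trans (le_max_left _ _)⟩
  obtain ⟨hr0, hr⟩ := hr
  -- the weight parameter is chosen large enough to absorb the potential
  set s := r * (‖M‖ + 1) with hs
  have hs0 : 0 ≤ s := by positivity
  set w := weightOp a m i s with hw
  have hcl : ∀ p ∈ (testGraph a m).topologicalClosure, s * ‖w p.fst‖ ≤ r * ‖w p.snd‖ := by
    have hclosed : IsClosed {p : WithLp 2 (L2Q a m × L2Q a m) |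
        s * ‖w p.fst‖ ≤ r * ‖w p.snd‖} := by
      refine isClosed_le ?_ ?_
      · exact continuous_const.mul (w.continuous.comp (WithLp.fstL 2 ℝ _ _).continuous).norm
      · exact continuous_const.mul (w.continuous.comp (WithLp.sndL 2 ℝ _ _).continuous).norm
    exact fun p hp => closure_minimal (fun q hq => carleman_testGraph a i hs0 hr0.le hr hq)
      hclosed hp
  have hcomm : ∀ f, w (M f) = M (w f) := by
    intro f
    refine Lp.ext ?_
    filter_upwards [weightOp_coeFn a i s (M f), mulOp_coeFn hA f, weightOp_coeFn a i s f,
      mulOp_coeFn hA (w f)] with x h1 h2 h3 h4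
    rw [h1, h2, h4, h3, map_smul]
  have hexp : ∀ x ∈ cell a, Real.exp (-(s * r)) ≤ expWeight i s x ∧
      expWeight i s x ≤ Real.exp (s * r) := by
    intro x hx
    have h1 := abs_le.mp (hr x hx)
    constructor
    · refine Real.exp_le_exp.mpr ?_
      nlinarith
    · refine Real.exp_le_exp.mpr ?_
      nlinarith
  have hlow : ∀ f, Real.exp (-(s * r)) * ‖f‖ ≤ ‖w f‖ := by
    intro f
    have : ‖f‖ ≤ Real.exp (s * r) * ‖w f‖ := by
      refine Lp.norm_le_mul_norm_of_ae_le_mul ?_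
      filter_upwards [weightOp_coeFn a i s f, ae_restrict_mem (measurableSet_cell a)] with x h1 hx
      rw [h1, norm_smul, Real.norm_of_nonneg (expWeight_pos i s x).le, ← mul_assoc]
      refine le_mul_of_one_le_left (norm_nonneg _) ?_
      have := mul_le_mul_of_nonneg_left (hexp x hx).1 (Real.exp_pos (s * r)).le
      rwa [← Real.exp_add, add_neg_cancel, Real.exp_zero] at this
    calc Real.exp (-(s * r)) * ‖f‖ ≤ Real.exp (-(s * r)) * (Real.exp (s * r) * ‖w f‖) := by gcongr
      _ = ‖w f‖ := by rw [← mul_assoc, ← Real.exp_add, neg_add_cancel, Real.exp_zero, one_mul]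
  have hupp : ∀ f, ‖w f‖ ≤ Real.exp (s * r) * ‖f‖ := by
    intro f
    refine Lp.norm_le_mul_norm_of_ae_le_mul ?_
    filter_upwards [weightOp_coeFn a i s f, ae_restrict_mem (measurableSet_cell a)] with x h1 hx
    rw [h1, norm_smul, Real.norm_of_nonneg (expWeight_pos i s x).le]
    exact mul_le_mul_of_nonneg_right (hexp x hx).2 (norm_nonneg _)
  refine ⟨Real.exp (-(s * r)) * Real.exp (-(s * r)), by positivity, fun p hp => ?_⟩
  have h1 : (‖M‖ + 1) * ‖w p.fst‖ ≤ ‖w p.snd‖ := by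
    have := hcl p hp
    rw [hs, mul_assoc] at this
    exact le_of_mul_le_mul_left this hr0
  have h2 : ‖w p.fst‖ ≤ ‖w (p.snd + M p.fst)‖ := by
    rw [map_add, hcomm]
    have h3 : ‖w p.snd‖ ≤ ‖w p.snd + M (w p.fst)‖ + ‖M (w p.fst)‖ := by
      simpa using norm_sub_le (w p.snd + M (w p.fst)) (M (w p.fst))
    have h4 := M.le_opNorm (w p.fst)
    linarith
  calc Real.exp (-(s * r)) * Real.exp (-(s * r)) * ‖p.fst‖
      = Real.exp (-(s * r)) * (Real.exp (-(s * r)) * ‖p.fst‖) := by ring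
    _ ≤ Real.exp (-(s * r)) * (Real.exp (s * r) * ‖p.snd + M p.fst‖) :=
        mul_le_mul_of_nonneg_left (((hlow _).trans h2).trans (hupp _)) (Real.exp_pos _).le
    _ = ‖p.snd + M p.fst‖ := by
        rw [← mul_assoc, ← Real.exp_add, neg_add_cancel, Real.exp_zero, one_mul]

end LowerBound

section Surjective

variable {H : Type*} [NormedAddCommGroup H] [InnerProductSpace ℝ H]

lemma norm_le_of_bounded_below (M : H →L[ℝ] H) {c : ℝ} (hc : 0 < c) {p : WithLp 2 (H × H)}
    (h : c * ‖p.fst‖ ≤ ‖p.snd + M p.fst‖) :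
    ‖p‖ ≤ (c⁻¹ * (1 + ‖M‖) + 1) * ‖p.snd + M p.fst‖ := by
  have h1 : ‖p.fst‖ ≤ c⁻¹ * ‖p.snd + M p.fst‖ := by
    rwa [← div_eq_inv_mul, le_div_iff₀ hc, mul_comm]
  have h2 : ‖p.snd‖ ≤ ‖p.snd + M p.fst‖ + ‖M‖ * ‖p.fst‖ := by
    have h3 : ‖p.snd‖ ≤ ‖p.snd + M p.fst‖ + ‖M p.fst‖ := by
      simpa using norm_sub_le (p.snd + M p.fst) (M p.fst)
    exact h3.trans (by gcongr; exact M.le_opNorm _)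
  have h3 : ‖p‖ ≤ ‖p.fst‖ + ‖p.snd‖ := by
    rw [WithLp.prod_norm_eq_of_L2]
    refine Real.sqrt_le_iff.mpr ⟨by positivity, ?_⟩
    nlinarith [norm_nonneg p.fst, norm_nonneg p.snd]
  have h4 := mul_le_mul_of_nonneg_left h1 (norm_nonneg M)
  calc ‖p‖ ≤ (c⁻¹ * ‖p.snd + M p.fst‖) +
        (‖p.snd + M p.fst‖ + ‖M‖ * (c⁻¹ * ‖p.snd + M p.fst‖)) := by linarith
    _ = _ := by ring

/-- If `A + M` is bounded below on the graph `G` of a symmetric operator `A` and `M` is bounded and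
symmetric, then `A* + M` has a bounded right inverse: by the Lax-Milgram theorem there is `d` in the
closure of `G` with `((A + M) d, (A + M) d') = (f, d')`, and `(A + M) d` solves the equation with
right-hand side `f`. -/
theorem exists_right_inverse_adjoint [CompleteSpace H]
    (G : Submodule ℝ (WithLp 2 (H × H))) (M : H →L[ℝ] H)
    (hM : ∀ f g, ⟪f, M g⟫_ℝ = ⟪M f, g⟫_ℝ) {c : ℝ} (hc : 0 < c)
    (h : ∀ p ∈ G.topologicalClosure, c * ‖p.fst‖ ≤ ‖p.snd + M p.fst‖) :
    ∃ S : H →L[ℝ] WithLp 2 (H × H), ∀ f, (S f).snd + M (S f).fst = f ∧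
      ∀ q ∈ G, ⟪(S f).snd, q.fst⟫_ℝ = ⟪(S f).fst, q.snd⟫_ℝ := by
  let C := G.topologicalClosure
  have : CompleteSpace C := G.isClosed_topologicalClosure.completeSpace_coe
  let π : C →L[ℝ] H := WithLp.fstL 2 ℝ H H ∘L C.subtypeL
  let N : C →L[ℝ] H := WithLp.sndL 2 ℝ H H ∘L C.subtypeL + M ∘L π
  let B : C →L[ℝ] C →L[ℝ] ℝ := (innerSL ℝ).bilinearComp N N
  set K := c⁻¹ * (1 + ‖M‖) + 1 with hK
  have hKpos : 0 < K := by positivity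
  have hB : IsCoercive B := by
    refine ⟨(K ^ 2)⁻¹, by positivity, fun d => ?_⟩
    have h1 : ‖d‖ ≤ K * ‖N d‖ := norm_le_of_bounded_below M hc (h d d.2)
    have h2 : B d d = ‖N d‖ ^ 2 := real_inner_self_eq_norm_sq (N d)
    rw [h2, mul_assoc, ← div_eq_inv_mul, div_le_iff₀ (by positivity)]
    calc ‖d‖ * ‖d‖ ≤ (K * ‖N d‖) * (K * ‖N d‖) := by gcongr
      _ = ‖N d‖ ^ 2 * K ^ 2 := by ring
  let U : H →L[ℝ] H := N ∘L hB.continuousLinearEquivOfBilin.symm.toContinuousLinearMap ∘L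
    ContinuousLinearMap.adjoint π
  have hU : ∀ f, ∀ q ∈ G, ⟪U f, q.snd + M q.fst⟫_ℝ = ⟪f, q.fst⟫_ℝ := by
    intro f q hq
    let d' : C := ⟨q, G.le_topologicalClosure hq⟩
    have h1 := hB.continuousLinearEquivOfBilin_apply
      (hB.continuousLinearEquivOfBilin.symm (ContinuousLinearMap.adjoint π f)) d'
    rw [ContinuousLinearEquiv.apply_symm_apply, ContinuousLinearMap.adjoint_inner_left] at h1
    exact h1.symm
  let S : H →L[ℝ] WithLp 2 (H × H) :=
    (WithLp.prodContinuousLinearEquiv 2 ℝ H H).symm.toContinuousLinearMap ∘L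
      (U.prod (ContinuousLinearMap.id ℝ H - M ∘L U))
  have hS1 : ∀ f, (S f).fst = U f := fun f => rfl
  have hS2 : ∀ f, (S f).snd = f - M (U f) := fun f => rfl
  refine ⟨S, fun f => ⟨?_, fun q hq => ?_⟩⟩
  · rw [hS1, hS2, sub_add_cancel]
  · have h1 := hU f q hq
    rw [inner_add_right, hM] at h1
    rw [hS1, hS2, inner_sub_left]
    linarith

end Surjective

/-! ### Existence and uniqueness of the crossing form -/

section Crossing

/-- The graph family `R` in the definition of the crossing form is determined by the path, hence so
is the crossing form. -/
theorem IsCrossingForm.unique {𝓗 : Type*} [NormedAddCommGroup 𝓗] [InnerProductSpace ℝ 𝓗]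
    {σ : 𝓗 →ₗ[ℝ] 𝓗 →ₗ[ℝ] ℝ} {𝒳 : Submodule ℝ 𝓗} {Υ : ℝ → Submodule ℝ 𝓗} {c d t₀ : ℝ}
    (hcd : c < d) (ht₀ : t₀ ∈ Icc c d) {q q' : LinearMap.BilinForm ℝ ↥(Υ t₀ ⊓ 𝒳)}
    (h : IsCrossingForm σ 𝒳 Υ c d t₀ q) (h' : IsCrossingForm σ 𝒳 Υ c d t₀ q') : q' = q := by
  obtain ⟨ε, hε, R, -, hR, hq⟩ := h
  obtain ⟨ε', hε', R', -, hR', hq'⟩ := h'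
  have key : ∀ t ∈ Icc c d ∩ Metric.ball t₀ ε, t ∈ Icc c d ∩ Metric.ball t₀ ε' →
      ∀ v, R' t v = R t v := by
    intro t ht ht' v
    have h1 : (v : 𝓗) + (R' t v : 𝓗) ∈ (Υ t : Set 𝓗) := by
      rw [hR' t ht']
      exact ⟨v, rfl⟩
    rw [hR t ht] at h1
    obtain ⟨w, hw⟩ := h1
    have h2 : ((v - w : Υ t₀) : 𝓗) = ((R t w - R' t v : (Υ t₀)ᗮ) : 𝓗) := by
      simp only [Submodule.coe_sub]
      rw [sub_eq_sub_iff_add_eq_add, hw, add_comm]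
    have h3 : ((v - w : Υ t₀) : 𝓗) = 0 :=
      (Υ t₀).orthogonal_disjoint.le_bot ⟨(v - w).2, h2 ▸ (R t w - R' t v).2⟩
    have h4 : v = w := sub_eq_zero.mp (Subtype.ext h3)
    subst h4
    exact Subtype.ext (add_left_cancel hw)
  ext u v
  have hev : (fun t => σ (u : 𝓗) (R t ⟨(v : 𝓗), v.2.1⟩ : 𝓗)) =ᶠ[𝓝[Icc c d] t₀]
      fun t => σ (u : 𝓗) (R' t ⟨(v : 𝓗), v.2.1⟩ : 𝓗) := by
    filter_upwards [self_mem_nhdsWithin,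
      mem_nhdsWithin_of_mem_nhds (Metric.ball_mem_nhds t₀ hε),
      mem_nhdsWithin_of_mem_nhds (Metric.ball_mem_nhds t₀ hε')] with t h1 h2 h3
    rw [key t ⟨h1, h2⟩ ⟨h1, h3⟩]
  have h1 := (hq' u v).congr_of_eventuallyEq_of_mem hev ht₀
  exact (uniqueDiffOn_Icc hcd t₀ ht₀).eq_deriv _ h1 (hq u v)

variable {n m : ℕ} {a : Module.Basis (Fin n) ℝ (Pos n)} {V : Pos n → Matrix (Fin m) (Fin m) ℝ}

/-- The projection `γ` as a bounded operator. -/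
noncomputable def bvProjL (a : Module.Basis (Fin n) ℝ (Pos n)) (m : ℕ) : Dmax a m →L[ℝ] HA a m :=
  (bvProj a m).mkContinuous 1 fun x => by
    rw [one_mul]
    exact Submodule.Quotient.norm_mk_le (Dmin a m) x

lemma bvProjL_apply (x : Dmax a m) : bvProjL a m x = bvProj a m x := rfl

/-- The bounded operator `-Δ_max + M` on `D_max`. -/
noncomputable def maxOp (a : Module.Basis (Fin n) ℝ (Pos n)) (m : ℕ) (M : L2Q a m →L[ℝ] L2Q a m) :
    Dmax a m →L[ℝ] L2Q a m :=
  WithLp.sndL 2 ℝ _ _ ∘L (Dmax a m).subtypeL + M ∘L (WithLp.fstL 2 ℝ _ _ ∘L (Dmax a m).subtypeL)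

lemma maxOp_apply (M : L2Q a m →L[ℝ] L2Q a m) (x : Dmax a m) :
    maxOp a m M x = x.1.snd + M x.1.fst := rfl

lemma mem_kerMax_iff (hV : ∀ k l, ContDiffOn ℝ 1 (fun x => V x k l) (cell a)) {t : ℝ}
    (ht : t ∈ Icc (0 : ℝ) 1) (p : Dmax a m) :
    p ∈ kerMax a V t ↔ maxOp a m (potOp a V t) p = 0 := by
  rw [maxOp_apply, Lp.eq_zero_iff_ae_eq_zero]
  have h1 : ∀ᵐ x ∂(volume.restrict (cell a)),
      (p.1.snd + potOp a V t p.1.fst : L2Q a m) x = p.1.snd x + act (potR V t x) (p.1.fst x) := by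
    filter_upwards [Lp.coeFn_add p.1.snd (potOp a V t p.1.fst), potOp_coeFn hV ht p.1.fst]
      with x h1 h2
    rw [h1, Pi.add_apply, h2]
  constructor
  · intro h
    filter_upwards [h, h1] with x e1 e2
    rw [e2, e1]
    rfl
  · intro h
    change ∀ᵐ x ∂(volume.restrict (cell a)), p.1.snd x + act (potR V t x) (p.1.fst x) = 0
    filter_upwards [h, h1] with x e1 e2
    rw [← e2, e1]
    rfl

/-- If `-Δ_min + M` is bounded below, then `γ` is bounded below on the kernel of `-Δ_max + M`. -/
lemma exists_le_norm_bvProjL (M : L2Q a m →L[ℝ] L2Q a m) {c : ℝ} (hc : 0 < c)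
    (h : ∀ p ∈ (testGraph a m).topologicalClosure, c * ‖p.fst‖ ≤ ‖p.snd + M p.fst‖) :
    ∃ c' > 0, ∀ u, maxOp a m M u = 0 → c' * ‖u‖ ≤ ‖bvProjL a m u‖ := by
  set T := maxOp a m M with hT
  set K := c⁻¹ * (1 + ‖M‖) + 1 with hK
  have hKpos : 0 < K := by positivity
  refine ⟨(1 + K * ‖T‖)⁻¹, by positivity, fun u hu => ?_⟩
  rw [← div_eq_inv_mul, div_le_iff₀ (by positivity)]
  have key : ∀ v : Dmax a m, bvProj a m v = bvProj a m u → ‖u‖ ≤ (1 + K * ‖T‖) * ‖v‖ := by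
    intro v hv
    have hd : v - u ∈ Dmin a m := (Submodule.Quotient.eq _).mp hv
    have h1 : ‖v - u‖ ≤ K * ‖T (v - u)‖ :=
      norm_le_of_bounded_below M hc (h _ hd)
    rw [map_sub, hu, sub_zero] at h1
    have h2 : ‖u‖ ≤ ‖v‖ + ‖v - u‖ := by
      have := norm_sub_le v (v - u)
      rwa [sub_sub_cancel] at this
    have h3 := mul_le_mul_of_nonneg_left (T.le_opNorm v) hKpos.le
    calc ‖u‖ ≤ ‖v‖ + K * (‖T‖ * ‖v‖) := h2.trans (by linarith)
      _ = _ := by ring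
  have hpos : 0 < 1 + K * ‖T‖ := by positivity
  refine le_of_forall_pos_le_add fun ε hε => ?_
  obtain ⟨v, hv, hvn⟩ := QuotientAddGroup.exists_norm_mk_lt
    (S := (Dmin a m).toAddSubgroup) (bvProj a m u) (ε := ε / (1 + K * ‖T‖)) (div_pos hε hpos)
  calc ‖u‖ ≤ (1 + K * ‖T‖) * ‖v‖ := key v hv
    _ ≤ (1 + K * ‖T‖) * (‖bvProjL a m u‖ + ε / (1 + K * ‖T‖)) :=
        mul_le_mul_of_nonneg_left hvn.le hpos.le
    _ = ‖bvProjL a m u‖ * (1 + K * ‖T‖) + ε := by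
        rw [mul_add, mul_div_cancel₀ _ hpos.ne', mul_comm]

lemma hasDerivWithinAt_inner_sub_apply {Y D H : Type*} [NormedAddCommGroup Y] [NormedSpace ℝ Y]
    [NormedAddCommGroup D] [NormedSpace ℝ D] [NormedAddCommGroup H] [InnerProductSpace ℝ H]
    (π : D →L[ℝ] H) (f : H) (y : Y) {M : ℝ → H →L[ℝ] H} {M' : H →L[ℝ] H} {L : ℝ → Y →L[ℝ] D}
    {s : Set ℝ} {t₀ : ℝ} (hM : HasDerivWithinAt M M' s t₀) (hL : DifferentiableWithinAt ℝ L s t₀) :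
    HasDerivWithinAt (fun t => ⟪f, (M t - M t₀) (π (L t y))⟫_ℝ) ⟪f, M' (π (L t₀ y))⟫_ℝ s t₀ := by
  have h1 := hL.hasDerivWithinAt.clm_apply (hasDerivWithinAt_const t₀ s y)
  have h2 := π.hasFDerivAt.comp_hasDerivWithinAt t₀ h1
  have h3 := (hM.sub_const (M t₀)).clm_apply h2
  have h4 := (hasDerivWithinAt_const t₀ s f).inner ℝ h3
  refine h4.congr_deriv ?_
  rw [sub_self, zero_apply, add_zero, inner_zero_left, add_zero]
  rfl

/-- The crossing form exists and is given by the quadratic form of `∂V_{t,ℝ}/∂t`. -/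
theorem exists_crossingForm (hn : 0 < n) (θ : Fin n → ℝ)
    (hVsymm : ∀ᵐ x ∂(volume.restrict (cell a)), (V x).transpose = V x)
    (hV : ∀ k l, ContDiffOn ℝ 1 (fun x => V x k l) (cell a))
    {τ t₀ : ℝ} (hτ : τ ∈ Ioo (0 : ℝ) 1) (ht₀ : t₀ ∈ Icc τ 1) :
    ∃ q : LinearMap.BilinForm ℝ ↥(bvPath a V t₀ ⊓ thetaBV a m θ),
      IsCrossingForm (sympl a m) (thetaBV a m θ) (bvPath a V) τ 1 t₀ q ∧
      ∀ u : thetaKer a θ V t₀, q (kerClass a θ V t₀ u) (kerClass a θ V t₀ u) =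
        ⟪u.1.1.fst, potDerivOp a V t₀ u.1.1.fst⟫_ℝ := by
  have hsub : Icc τ 1 ⊆ Icc (0 : ℝ) 1 := Icc_subset_Icc_left hτ.1.le
  have ht₀' := hsub ht₀
  let T : ℝ → Dmax a m →L[ℝ] L2Q a m := fun t => maxOp a m (potOp a V t)
  have hT : ContDiffOn ℝ 1 T (Icc τ 1) :=
    contDiffOn_const.add (((contDiffOn_potOp hV).mono hsub).clm_comp contDiffOn_const)
  obtain ⟨c, hc, hlow⟩ := exists_lower_bound_Dmin a (m := m) hn (memLp_potR hV ht₀')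
  obtain ⟨S₀, hS₀⟩ := exists_right_inverse_adjoint (testGraph a m) (potOp a V t₀)
    (inner_potOp_comm hVsymm hV ht₀') hc hlow
  let S : L2Q a m →L[ℝ] Dmax a m := S₀.codRestrict (Dmax a m) fun f q hq => (hS₀ f).2 q hq
  obtain ⟨c', hc', hγ⟩ := exists_le_norm_bvProjL (potOp a V t₀) hc hlow
  have hΥ : ∀ t ∈ Icc τ 1, ∀ w, w ∈ bvPath a V t ↔ ∃ u, T t u = 0 ∧ bvProjL a m u = w := by
    intro t ht w
    rw [bvPath, Submodule.mem_map]
    simp_rw [mem_kerMax_iff hV (hsub ht)]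
    rfl
  obtain ⟨ε, hε, R, L, hR, hL, hgraph, hlift, hL0⟩ := exists_graph_family (bvProjL a m) T S ht₀ hT
    (fun f => (hS₀ f).1) hc' hγ (bvPath a V) hΥ
  have hmem : t₀ ∈ Icc τ 1 ∩ Metric.ball t₀ ε := ⟨ht₀, Metric.mem_ball_self hε⟩
  let J : ↥(bvPath a V t₀ ⊓ thetaBV a m θ) →ₗ[ℝ] L2Q a m :=
    (WithLp.fstL 2 ℝ _ _ ∘L (Dmax a m).subtypeL ∘L L t₀).toLinearMap ∘ₗ
      Submodule.inclusion inf_le_left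
  let q : LinearMap.BilinForm ℝ ↥(bvPath a V t₀ ⊓ thetaBV a m θ) :=
    ((innerₗ (L2Q a m)).compl₂ (potDerivOp a V t₀).toLinearMap).compl₁₂ J J
  have hJ : ∀ v : ↥(bvPath a V t₀ ⊓ thetaBV a m θ), ∀ h, bvProjL a m (L t₀ ⟨v, h⟩) = v := by
    intro v h
    obtain ⟨x, hx, hxv⟩ := (hΥ t₀ ht₀ v).mp v.2.1
    have e := hL0 x hx (hxv ▸ h)
    have e' : L t₀ ⟨v, h⟩ = x := by
      rw [← e]
      congr 1
      exact Subtype.ext hxv.symm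
    rw [e', hxv]
  refine ⟨q, ⟨ε, hε, R, hR, hgraph, fun u v => ?_⟩, fun u => ?_⟩
  · let y : bvPath a V t₀ := ⟨v, v.2.1⟩
    let x : bvPath a V t₀ := ⟨u, u.2.1⟩
    -- along the path `ω(u, R_t v) = (u, (V_t - V_{t₀}) v_t)` with `v_t` the lift of `v + R_t v`
    have hform : ∀ t ∈ Icc τ 1 ∩ Metric.ball t₀ ε, sympl a m u (R t y) =
        ⟪(L t₀ x).1.fst, (potOp a V t - potOp a V t₀) ((L t y).1.fst)⟫_ℝ := by
      intro t ht
      have h0 : ∀ t ∈ Icc τ 1 ∩ Metric.ball t₀ ε,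
          sympl a m (bvProj a m (L t₀ x)) (bvProj a m (L t y)) =
          ⟪(L t₀ x).1.fst, (potOp a V t - potOp a V t₀) ((L t y).1.fst)⟫_ℝ := by
        intro t ht
        have e1 : (L t₀ x).1.snd = - potOp a V t₀ (L t₀ x).1.fst :=
          eq_neg_of_add_eq_zero_left (hlift t₀ hmem x).1
        have e2 : (L t y).1.snd = - potOp a V t (L t y).1.fst :=
          eq_neg_of_add_eq_zero_left (hlift t ht y).1
        rw [sympl_mk, e1, e2, inner_neg_left, inner_neg_right, sub_apply, inner_sub_right,
          inner_potOp_comm hVsymm hV ht₀']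
        ring
      have h1 := h0 t ht
      have h2 := h0 t₀ hmem
      rw [← bvProjL_apply, ← bvProjL_apply, hJ u x.2] at h1 h2
      rw [hJ v y.2, sub_self, zero_apply, inner_zero_right] at h2
      rw [(hlift t ht y).2, map_add, h2, zero_add] at h1
      exact h1
    have hder : HasDerivWithinAt (fun t => ⟪(L t₀ x).1.fst,
        (potOp a V t - potOp a V t₀) ((L t y).1.fst)⟫_ℝ) (q u v) (Icc τ 1) t₀ := by
      have hLd : DifferentiableWithinAt ℝ L (Icc τ 1) t₀ :=
        (hL.differentiableOn (by simp) t₀ hmem).mono_of_mem_nhdsWithin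
          (inter_mem_nhdsWithin _ (Metric.ball_mem_nhds t₀ hε))
      exact hasDerivWithinAt_inner_sub_apply (WithLp.fstL 2 ℝ _ _ ∘L (Dmax a m).subtypeL)
        (L t₀ x).1.fst y (((hasDerivWithinAt_potOp hV).1 t₀ ht₀').mono hsub) hLd
    refine hder.congr_of_eventuallyEq_of_mem ?_ ht₀
    filter_upwards [self_mem_nhdsWithin,
      mem_nhdsWithin_of_mem_nhds (Metric.ball_mem_nhds t₀ hε)] with t h1 h2
    exact hform t ⟨h1, h2⟩
  · have hu : T t₀ u.1 = 0 := (mem_kerMax_iff hV ht₀' u.1).mp u.2.1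
    have e : J (kerClass a θ V t₀ u) = u.1.1.fst := by
      have := hL0 u.1 hu ((hΥ t₀ ht₀ _).mpr ⟨u.1, hu, rfl⟩)
      exact congrArg (fun x : Dmax a m => x.1.fst) this
    change ⟪J _, potDerivOp a V t₀ (J _)⟫_ℝ = _
    rw [e]

end Crossing

/-! ### The divergence theorem on the unit cell -/

section Divergence

variable {n : ℕ} (a : Module.Basis (Fin n) ℝ (Pos n))

lemma inner_dualVec (j : Fin n) (x : Pos n) : ⟪dualVec a j, x⟫_ℝ = a.repr x j := by
  rw [dualVec, InnerProductSpace.toDual_symm_apply]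
  rfl

lemma dualVec_ne_zero (j : Fin n) : dualVec a j ≠ 0 := by
  intro h
  have := inner_dualVec a j (a j)
  simp [h] at this

lemma repr_add_smul (j : Fin n) (y : Pos n) (s : ℝ) (i : Fin n) :
    a.repr (y + s • a j) i = a.repr y i + if i = j then s else 0 := by
  rw [map_add, map_smul, Finsupp.add_apply, Finsupp.smul_apply, a.repr_self, Finsupp.single_apply]
  simp [eq_comm]

lemma add_smul_mem_cell_iff (j : Fin n) {y : Pos n} {s : ℝ} (hy : a.repr y j = 0) :
    y + s • a j ∈ cell a ↔ y ∈ face a j 0 ∧ s ∈ Icc (0 : ℝ) 1 := by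
  simp only [face, mem_ofPred_eq, mem_cell_iff, repr_add_smul]
  constructor
  · intro h
    refine ⟨⟨fun i => ?_, by simpa using hy⟩, by simpa [hy] using h j⟩
    by_cases hi : i = j
    · subst hi
      simp [hy]
    · simpa [hi] using h i
  · rintro ⟨⟨h, -⟩, hs⟩ i
    by_cases hi : i = j
    · subst hi
      simpa [hy] using hs
    · simpa [hi] using h i

lemma repr_of_mem_face_zero {j : Fin n} {y : Pos n} (hy : y ∈ face a j 0) : a.repr y j = 0 := by
  simpa using hy.2

lemma continuous_repr (j : Fin n) : Continuous fun x : Pos n => a.repr x j := by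
  simp_rw [← inner_dualVec]
  fun_prop

lemma isClosed_face (j : Fin n) (s : Fin 2) : IsClosed (face a j s) :=
  (isCompact_cell a).isClosed.inter (isClosed_eq (continuous_repr a j) continuous_const)

lemma isCompact_face (j : Fin n) (s : Fin 2) : IsCompact (face a j s) :=
  (isCompact_cell a).of_isClosed_subset (isClosed_face a j s) fun _ hx => hx.1

lemma face_subset_cell (j : Fin n) (s : Fin 2) : face a j s ⊆ cell a := fun _ hx => hx.1

lemma face_one_eq_preimage (j : Fin n) :
    face a j 1 = (fun x => x - a j) ⁻¹' face a j 0 := by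
  ext x
  have hx : x = (x - a j) + (1 : ℝ) • a j := by rw [one_smul, sub_add_cancel]
  have hr : a.repr x j = a.repr (x - a j) j + 1 := by
    conv_lhs => rw [hx, repr_add_smul]
    simp
  constructor
  · rintro ⟨h1, h2⟩
    have h0 : a.repr (x - a j) j = 0 := by
      have h3 : a.repr x j = 1 := by simpa using h2
      linarith
    rw [hx] at h1
    exact ((add_smul_mem_cell_iff a j h0).mp h1).1
  · intro h
    have h0 := repr_of_mem_face_zero a h
    refine ⟨?_, by rw [hr, h0]; simp⟩
    rw [hx]
    exact (add_smul_mem_cell_iff a j h0).mpr ⟨h, by simp⟩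

lemma measurePreserving_face (j : Fin n) :
    MeasurePreserving (fun x => x - a j)
      ((μHE[n - 1] : Measure (Pos n)).restrict (face a j 1))
      ((μHE[n - 1] : Measure (Pos n)).restrict (face a j 0)) := by
  have h : MeasurePreserving (fun x : Pos n => x - a j) (μHE[n - 1] : Measure (Pos n)) μHE[n - 1] :=
    measurePreserving_sub_right _ _
  rw [face_one_eq_preimage]
  exact h.restrict_preimage (isClosed_face a j 0).measurableSet

lemma integral_face_one (j : Fin n) {E : Type*} [NormedAddCommGroup E] [NormedSpace ℝ E]
    (f : Pos n → E) :
    ∫ x in face a j 1, f (x - a j) ∂(μHE[n - 1] : Measure (Pos n)) =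
      ∫ x in face a j 0, f x ∂(μHE[n - 1] : Measure (Pos n)) :=
  (measurePreserving_face a j).integral_comp (MeasurableEquiv.subRight (a j)).measurableEmbedding f

/-- The surface measure on the face `∂Q_j^0` is the Lebesgue measure of the hyperplane spanned by
it, so it is finite. -/
instance isFiniteMeasure_face_zero (j : Fin n) :
    IsFiniteMeasure ((μHE[n - 1] : Measure (Pos n)).restrict (face a j 0)) := by
  let W : Submodule ℝ (Pos n) := (ℝ ∙ dualVec a j)ᗮ
  have hW : Module.finrank ℝ W = n - 1 := by
    have h1 := (ℝ ∙ dualVec a j).finrank_add_finrank_orthogonal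
    rw [finrank_span_singleton (dualVec_ne_zero a j), finrank_euclideanSpace_fin] at h1
    change Module.finrank ℝ (ℝ ∙ dualVec a j)ᗮ = n - 1
    omega
  have hsub : face a j 0 ⊆ range (Subtype.val : W → Pos n) := by
    intro y hy
    have : y ∈ W := by
      rw [Submodule.mem_orthogonal_singleton_iff_inner_right, inner_dualVec]
      exact repr_of_mem_face_zero a hy
    exact ⟨⟨y, this⟩, rfl⟩
  have hval : μHE[n - 1] ((Subtype.val : W → Pos n) ⁻¹' face a j 0) =
      μHE[n - 1] (face a j 0 ∩ range (Subtype.val : W → Pos n)) :=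
    isometry_subtype_coe.euclideanHausdorffMeasure_preimage _
  rw [inter_eq_self_of_subset_left hsub] at hval
  refine isFiniteMeasure_restrict.mpr ?_
  rw [← hval, ← hW, InnerProductSpace.euclideanHausdorffMeasure_eq_volume]
  have hcl : Topology.IsClosedEmbedding (Subtype.val : W → Pos n) :=
    W.closed_of_finiteDimensional.isClosedEmbedding_subtypeVal
  exact (hcl.isCompact_preimage (isCompact_face a j 0)).measure_lt_top.ne

instance isFiniteMeasure_face (j : Fin n) (s : Fin 2) :
    IsFiniteMeasure ((μHE[n - 1] : Measure (Pos n)).restrict (face a j s)) := by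
  fin_cases s
  · exact isFiniteMeasure_face_zero a j
  · have h := (measurePreserving_face a j).measure_preimage
      (s := univ) MeasurableSet.univ.nullMeasurableSet
    refine ⟨?_⟩
    rw [preimage_univ] at h
    exact h ▸ measure_lt_top _ _

/-- Slicing the cell by translates of the face `∂Q_j^0`: the distance of the slices with `j`-th
coordinates `s` and `s + ds` is `ds / ‖b_j‖`. -/
theorem smul_restrict_cell_eq_map (j : Fin n) :
    ‖dualVec a j‖ₑ • (volume : Measure (Pos n)).restrict (cell a) =
      Measure.map (fun p : ℝ × Pos n => p.2 + p.1 • a j)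
        (((volume : Measure ℝ).restrict (Icc 0 1)).prod
          ((μHE[n - 1] : Measure (Pos n)).restrict (face a j 0))) := by
  set b := dualVec a j with hb
  have hb0 : b ≠ 0 := dualVec_ne_zero a j
  have hbn : ‖b‖ ≠ 0 := norm_ne_zero_iff.mpr hb0
  have hΦ : Measurable fun p : ℝ × Pos n => p.2 + p.1 • a j := by fun_prop
  ext t ht
  rw [Measure.smul_apply, smul_eq_mul, Measure.restrict_apply ht, Measure.map_apply hΦ ht,
    Measure.prod_apply (hΦ ht)]
  have htc : MeasurableSet (t ∩ cell a) := ht.inter (measurableSet_cell a)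
  have hvol := EuclideanGeometry.euclideanHausdorffMeasure_eq_lintegral (0 : Pos n) hb0 htc
  rw [finrank_euclideanSpace_fin, EuclideanSpace.euclideanHausdorffMeasure_eq_volume] at hvol
  -- the measure of the slice with `j`-th coordinate `s`
  let F : ℝ → ℝ≥0∞ := fun s => (Icc (0 : ℝ) 1).indicator
    (fun s => ((μHE[n - 1] : Measure (Pos n)).restrict (face a j 0))
      (Prod.mk s ⁻¹' ((fun p : ℝ × Pos n => p.2 + p.1 • a j) ⁻¹' t))) s
  have hF : Measurable F :=
    (measurable_measure_prodMk_left (hΦ ht)).indicator measurableSet_Icc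
  have hslice : ∀ r : ℝ, μHE[n - 1] (t ∩ cell a ∩
      (AffineSubspace.mk' (r • b +ᵥ (0 : Pos n)) (ℝ ∙ b)ᗮ : Set (Pos n))) = F (‖b‖ ^ 2 * r) := by
    intro r
    set s := ‖b‖ ^ 2 * r with hs
    have hmem : ∀ y : Pos n,
        y ∈ (AffineSubspace.mk' (r • b +ᵥ (0 : Pos n)) (ℝ ∙ b)ᗮ : Set (Pos n)) ↔
        a.repr y j = s := by
      intro y
      rw [SetLike.mem_coe, AffineSubspace.mem_mk', vadd_eq_add, add_zero, vsub_eq_sub,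
        Submodule.mem_orthogonal_singleton_iff_inner_right, inner_sub_right, inner_dualVec,
        inner_smul_right, real_inner_self_eq_norm_sq, sub_eq_zero, mul_comm]
    have htr : μHE[n - 1] (t ∩ cell a ∩
        (AffineSubspace.mk' (r • b +ᵥ (0 : Pos n)) (ℝ ∙ b)ᗮ : Set (Pos n))) =
        μHE[n - 1] ((fun y => y + s • a j) ⁻¹' (t ∩ cell a ∩
        (AffineSubspace.mk' (r • b +ᵥ (0 : Pos n)) (ℝ ∙ b)ᗮ : Set (Pos n)))) :=
      (measure_preimage_add_right _ _ _).symm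
    rw [htr]
    by_cases hs1 : s ∈ Icc (0 : ℝ) 1
    · simp only [F, indicator_of_mem hs1]
      rw [Measure.restrict_apply (measurable_prodMk_left (hΦ ht))]
      congr 1
      ext y
      simp only [mem_preimage, mem_inter_iff, hmem, repr_add_smul, if_true, add_eq_right]
      constructor
      · rintro ⟨⟨h1, h2⟩, h3⟩
        exact ⟨h1, ((add_smul_mem_cell_iff a j h3).mp h2).1⟩
      · rintro ⟨h1, h2⟩
        have h3 := repr_of_mem_face_zero a h2
        exact ⟨⟨h1, (add_smul_mem_cell_iff a j h3).mpr ⟨h2, hs1⟩⟩, h3⟩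
    · simp only [F, indicator_of_notMem hs1]
      convert! measure_empty (μ := (μHE[n - 1] : Measure (Pos n)))
      ext y
      simp only [mem_preimage, mem_inter_iff, hmem, repr_add_smul, if_true, add_eq_right,
        mem_empty_iff_false, iff_false]
      rintro ⟨⟨-, h2⟩, h3⟩
      exact hs1 ((add_smul_mem_cell_iff a j h3).mp h2).2
  simp_rw [hslice] at hvol
  have hscale : ∫⁻ r : ℝ, F (‖b‖ ^ 2 * r) = ENNReal.ofReal (‖b‖ ^ 2)⁻¹ * ∫⁻ s, F s := by
    have hne : ‖b‖ ^ 2 ≠ 0 := pow_ne_zero 2 hbn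
    have h1 := Real.map_volume_mul_left hne
    rw [← lintegral_map hF (measurable_const_mul _), h1, lintegral_smul_measure, abs_of_pos
      (by positivity), smul_eq_mul]
  rw [hvol, hscale, lintegral_indicator measurableSet_Icc]
  rw [← mul_assoc, ← mul_assoc, ← ofReal_norm, ← ENNReal.ofReal_mul (norm_nonneg _),
    ← ENNReal.ofReal_mul (by positivity)]
  have : ‖b‖ * ‖b‖ * (‖b‖ ^ 2)⁻¹ = 1 := by field_simp
  rw [this, ENNReal.ofReal_one, one_mul]

lemma norm_mul_setIntegral_cell (j : Fin n) {E : Type*} [NormedAddCommGroup E] [NormedSpace ℝ E]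
    {f : Pos n → E} (hf : IntegrableOn f (cell a)) :
    ‖dualVec a j‖ • ∫ x in cell a, f x =
      ∫ y in face a j 0, ∫ s in Icc (0 : ℝ) 1, f (y + s • a j)
        ∂(volume : Measure ℝ) ∂(μHE[n - 1] : Measure (Pos n)) := by
  have hΦ : Measurable fun p : ℝ × Pos n => p.2 + p.1 • a j := by fun_prop
  have hf' : Integrable f (‖dualVec a j‖ₑ • (volume : Measure (Pos n)).restrict (cell a)) :=
    Integrable.smul_measure hf enorm_ne_top
  have h1 : ‖dualVec a j‖ • ∫ x in cell a, f x =
      ∫ x, f x ∂(‖dualVec a j‖ₑ • (volume : Measure (Pos n)).restrict (cell a)) := by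
    rw [integral_smul_measure, toReal_enorm]
  rw [h1]
  rw [smul_restrict_cell_eq_map] at hf' ⊢
  rw [integral_map hΦ.aemeasurable hf'.1]
  exact integral_prod_symm _ ((integrable_map_measure hf'.1 hΦ.aemeasurable).mp hf')

lemma integrableOn_of_continuousOn {X E : Type*} [TopologicalSpace X] [MeasurableSpace X]
    [OpensMeasurableSpace X] [NormedAddCommGroup E] [SecondCountableTopologyEither X E]
    {ν : Measure X} {K : Set X} [IsFiniteMeasure (ν.restrict K)] (hK : IsCompact K)
    (hKm : MeasurableSet K) {f : X → E} (hf : ContinuousOn f K) : IntegrableOn f K ν :=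
  (memLp_top_of_continuousOn hK hKm hf).integrable le_top

/-- The fundamental theorem of calculus along the lattice direction `a_j`. -/
lemma setIntegral_fderivWithin_basis (j : Fin n) {f : Pos n → ℝ}
    (hf : ContDiffOn ℝ 1 f (cell a)) :
    ∫ x in cell a, fderivWithin ℝ f (cell a) x (a j) = ‖dualVec a j‖⁻¹ *
      ((∫ x in face a j 1, f x ∂(μHE[n - 1] : Measure (Pos n))) -
        ∫ x in face a j 0, f x ∂(μHE[n - 1] : Measure (Pos n))) := by
  have hc : ContinuousOn (fun x => fderivWithin ℝ f (cell a) x (a j)) (cell a) :=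
    (hf.continuousOn_fderivWithin (uniqueDiffOn_cell a) (by simp)).clm_apply continuousOn_const
  have hint := integrableOn_of_continuousOn (ν := volume) (isCompact_cell a)
    (measurableSet_cell a) hc
  have h1 := norm_mul_setIntegral_cell a j hint
  have hb : ‖dualVec a j‖ ≠ 0 := norm_ne_zero_iff.mpr (dualVec_ne_zero a j)
  rw [smul_eq_mul] at h1
  rw [eq_inv_mul_iff_mul_eq₀ hb, h1]
  have hline : ∀ y ∈ face a j 0, ∀ s ∈ Icc (0 : ℝ) 1, y + s • a j ∈ cell a := fun y hy s hs =>
    (add_smul_mem_cell_iff a j (repr_of_mem_face_zero a hy)).mpr ⟨hy, hs⟩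
  have h2 : ∀ y ∈ face a j 0, ∫ s in Icc (0 : ℝ) 1,
      fderivWithin ℝ f (cell a) (y + s • a j) (a j) = f (y + a j) - f y := by
    intro y hy
    have hcont : ContinuousOn (fun s : ℝ => y + s • a j) (Icc 0 1) := by fun_prop
    rw [integral_Icc_eq_integral_Ioc, ← intervalIntegral.integral_of_le zero_le_one,
      intervalIntegral.integral_eq_sub_of_hasDerivAt_of_le (f := fun s : ℝ => f (y + s • a j))
        zero_le_one (hf.continuousOn.comp hcont (hline y hy))]
    · simp
    · intro s hs
      have h3 : HasFDerivWithinAt f _ (cell a) (y + s • a j) :=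
        (hf.differentiableOn (by simp) _ (hline y hy s (Ioo_subset_Icc_self hs))).hasFDerivWithinAt
      have h4 : HasDerivWithinAt (fun s : ℝ => y + s • a j) ((1 : ℝ) • a j) (Icc 0 1) s :=
        ((hasDerivWithinAt_id s _).smul_const (a j)).const_add y
      have h5 := h3.comp_hasDerivWithinAt s h4 (hline y hy)
      rw [one_smul] at h5
      exact h5.hasDerivAt (Icc_mem_nhds hs.1 hs.2)
    · refine ContinuousOn.intervalIntegrable ?_
      rw [uIcc_of_le zero_le_one]
      exact hc.comp hcont (hline y hy)
  rw [setIntegral_congr_fun (isClosed_face a j 0).measurableSet h2]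
  have hcf : ContinuousOn (fun y => f (y + a j)) (face a j 0) := by
    refine hf.continuousOn.comp (by fun_prop) fun y hy => ?_
    have := hline y hy 1 (by simp)
    rwa [one_smul] at this
  rw [integral_sub (integrableOn_of_continuousOn (isCompact_face a j 0)
      (isClosed_face a j 0).measurableSet hcf)
    (integrableOn_of_continuousOn (isCompact_face a j 0)
      (isClosed_face a j 0).measurableSet (hf.continuousOn.mono (face_subset_cell a j 0))),
    ← integral_face_one a j fun y => f (y + a j)]
  simp

/-- The divergence theorem for `C¹` functions on the closed cell. -/
theorem setIntegral_fderivWithin (v : Pos n) {f : Pos n → ℝ} (hf : ContDiffOn ℝ 1 f (cell a)) :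
    ∫ x in cell a, fderivWithin ℝ f (cell a) x v =
      boundaryIntegral a fun x ν => ⟪v, ν⟫_ℝ * f x := by
  have hv : ∀ x, fderivWithin ℝ f (cell a) x v =
      ∑ j, a.repr v j * fderivWithin ℝ f (cell a) x (a j) := by
    intro x
    conv_lhs => rw [← a.sum_repr v]
    simp only [map_sum, map_smul, smul_eq_mul]
  simp_rw [hv]
  rw [integral_finsetSum]
  · refine Finset.sum_congr rfl fun j _ => ?_
    rw [integral_const_mul, setIntegral_fderivWithin_basis a j hf, Fin.sum_univ_two,
      integral_const_mul, integral_const_mul]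
    simp only [faceNormal, inner_smul_right, real_inner_comm (dualVec a j) v, inner_dualVec]
    simp
    ring
  · intro j _
    have h : IntegrableOn (fun x => fderivWithin ℝ f (cell a) x (a j)) (cell a) :=
      integrableOn_of_continuousOn (isCompact_cell a) (measurableSet_cell a) ?_
    · exact Integrable.const_mul h _
    exact (hf.continuousOn_fderivWithin (uniqueDiffOn_cell a) (by simp)).clm_apply
      continuousOn_const

end Divergence

/-! ### Weak derivatives -/

section Weak

variable {n : ℕ} {a : Module.Basis (Fin n) ℝ (Pos n)} {F : Type*}
  [NormedAddCommGroup F] [NormedSpace ℝ F]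

/-- The fundamental lemma of the calculus of variations on the cell. -/
lemma ae_eq_of_forall_test [CompleteSpace F] {f g : Pos n → F}
    (hf : MemLp f 2 (volume.restrict (cell a))) (hg : MemLp g 2 (volume.restrict (cell a)))
    (h : ∀ φ : Pos n → ℝ, IsTest a φ → ∫ x in cell a, φ x • f x = ∫ x in cell a, φ x • g x) :
    f =ᵐ[volume.restrict (cell a)] g := by
  have hi : IntegrableOn (f - g) (cell a) := (hf.sub hg).integrable one_le_two
  have h1 := (isOpen_interior (s := cell a)).ae_eq_zero_of_integral_contDiff_smul_eq_zero
    (μ := volume) (hi.mono_set interior_subset).locallyIntegrableOn fun φ h1 h2 h3 => by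
      have hφ : IsTest a φ := ⟨h1, h2, h3⟩
      rw [← setIntegral_eq_integral_of_forall_compl_eq_zero (s := cell a)
        fun x hx => by rw [hφ.eq_zero hx, zero_smul]]
      simp only [Pi.sub_apply, smul_sub]
      rw [integral_sub (hφ.integrable_smul hf) (hφ.integrable_smul hg), h φ hφ, sub_self]
  rw [← restrict_interior_cell]
  refine (ae_restrict_iff' isOpen_interior.measurableSet).mpr ?_
  filter_upwards [h1] with x hx hm
  exact sub_eq_zero.mp (hx hm)

lemma ae_eq_of_forall_apply {D D' : Pos n → Pos n →L[ℝ] F} {μ : Measure (Pos n)}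
    (h : ∀ v, (fun x => D x v) =ᵐ[μ] fun x => D' x v) : D =ᵐ[μ] D' := by
  have h' : ∀ᵐ x ∂μ, ∀ i : Fin n, D x (EuclideanSpace.single i 1) =
      D' x (EuclideanSpace.single i 1) := ae_all_iff.mpr fun i => h _
  filter_upwards [h'] with x hx
  have := (EuclideanSpace.basisFun (Fin n) ℝ).toBasis.ext (f₁ := (D x).toLinearMap)
    (f₂ := (D' x).toLinearMap) (by simpa using hx)
  exact ContinuousLinearMap.ext fun v => LinearMap.congr_fun this v

lemma memLp_apply_const {α E G : Type*} [MeasurableSpace α] {μ : Measure α} {p : ℝ≥0∞}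
    [NormedAddCommGroup E] [NormedSpace ℝ E] [NormedAddCommGroup G] [NormedSpace ℝ G]
    {f : α → E →L[ℝ] G} (hf : MemLp f p μ) (v : E) : MemLp (fun x => f x v) p μ :=
  (ContinuousLinearMap.apply ℝ G v).comp_memLp' hf

lemma HasWeakFDeriv.memLp_apply {w : Pos n → F} {D : Pos n → Pos n →L[ℝ] F}
    (h : HasWeakFDeriv a w D) (v : Pos n) :
    MemLp (fun x => D x v) 2 (volume.restrict (cell a)) :=
  memLp_apply_const h.memLp_deriv v

theorem HasWeakFDeriv.unique [CompleteSpace F] {w : Pos n → F} {D D' : Pos n → Pos n →L[ℝ] F}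
    (h : HasWeakFDeriv a w D) (h' : HasWeakFDeriv a w D') :
    D =ᵐ[volume.restrict (cell a)] D' := by
  refine ae_eq_of_forall_apply fun v => ae_eq_of_forall_test (h.memLp_apply v) (h'.memLp_apply v)
    fun φ hφ => ?_
  have h1 := h.parts φ hφ v
  rw [h'.parts φ hφ v] at h1
  exact (neg_injective h1).symm

lemma IsTest.fderiv_apply {φ : Pos n → ℝ} (h : IsTest a φ) (v : Pos n) :
    IsTest a fun x => fderiv ℝ φ x v :=
  ⟨(h.smooth.fderiv_right (m := ∞) (by simp)).clm_apply contDiff_const,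
    h.compact.fderiv_apply ℝ v, (tsupport_fderiv_apply_subset ℝ v).trans h.supp⟩

lemma HasWeakFDeriv.parts_two [CompleteSpace F] {u : Pos n → F} {D : Pos n → Pos n →L[ℝ] F}
    {D2 : Pos n → Pos n →L[ℝ] Pos n →L[ℝ] F} (h : HasWeakFDeriv a u D) (h2 : HasWeakFDeriv a D D2)
    {φ : Pos n → ℝ} (hφ : IsTest a φ) (v w : Pos n) :
    ∫ x in cell a, φ x • D2 x v w =
      ∫ x in cell a, fderiv ℝ (fun y => fderiv ℝ φ y v) x w • u x := by
  have h1 := DFunLike.congr_fun (h2.parts φ hφ v) w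
  rw [neg_apply, ContinuousLinearMap.integral_apply (hφ.integrable_fderiv_smul v h2.memLp),
    ContinuousLinearMap.integral_apply (hφ.integrable_smul (h2.memLp_apply v))] at h1
  simp only [smul_apply] at h1
  rw [← neg_eq_iff_eq_neg.mpr h1, h.parts _ (hφ.fderiv_apply v) w]

theorem HasWeakFDeriv.symm_two [CompleteSpace F] {u : Pos n → F} {D : Pos n → Pos n →L[ℝ] F}
    {D2 : Pos n → Pos n →L[ℝ] Pos n →L[ℝ] F} (h : HasWeakFDeriv a u D) (h2 : HasWeakFDeriv a D D2)
    (v w : Pos n) :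
    (fun x => D2 x v w) =ᵐ[volume.restrict (cell a)] fun x => D2 x w v := by
  have hm : ∀ v w, MemLp (fun x => D2 x v w) 2 (volume.restrict (cell a)) := fun v w =>
    memLp_apply_const (h2.memLp_apply v) w
  refine ae_eq_of_forall_test (hm v w) (hm w v) fun φ hφ => ?_
  rw [h.parts_two h2 hφ, h.parts_two h2 hφ]
  have hd : Differentiable ℝ (fderiv ℝ φ) :=
    (hφ.smooth.fderiv_right (m := ∞) (by simp)).differentiable (by simp)
  have e : ∀ x v w, fderiv ℝ (fun y => fderiv ℝ φ y v) x w =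
      fderiv ℝ (fderiv ℝ φ) x w v := by
    intro x v w
    rw [((hd x).hasFDerivAt.clm_apply (hasFDerivAt_const v x)).fderiv]
    simp
  simp_rw [e]
  refine integral_congr_ae (Eventually.of_forall fun x => ?_)
  have hs : IsSymmSndFDerivAt ℝ φ x :=
    hφ.smooth.contDiffAt.isSymmSndFDerivAt (by simpa using two_le_infty)
  simp only [hs v w]

/-- For `u ∈ H²(Q)` the distributional Laplacian is the trace of the second weak derivative. -/
theorem snd_eq_neg_trace {m : ℕ} (p : Dmax a m) {D : Pos n → Pos n →L[ℝ] Val m}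
    {D2 : Pos n → Pos n →L[ℝ] Pos n →L[ℝ] Val m} (h : HasWeakFDeriv a p.1.fst D)
    (h2 : HasWeakFDeriv a D D2) :
    p.1.snd =ᵐ[volume.restrict (cell a)]
      fun x => - ∑ i, D2 x (EuclideanSpace.single i 1) (EuclideanSpace.single i 1) := by
  have hm : ∀ i : Fin n,
      MemLp (fun x => D2 x (EuclideanSpace.single i 1) (EuclideanSpace.single i 1)) 2
        (volume.restrict (cell a)) := fun i =>
    memLp_apply_const (h2.memLp_apply _) _
  have hms : MemLp (fun x => - ∑ i, D2 x (EuclideanSpace.single i 1) (EuclideanSpace.single i 1))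
      2 (volume.restrict (cell a)) := (memLp_finsetSum _ fun i _ => hm i).neg
  refine ae_eq_of_forall_test (Lp.memLp _) hms fun φ hφ => ?_
  refine ext_inner_left ℝ fun c => ?_
  have hφc : IsTest a fun x => φ x • c := ⟨hφ.smooth.smul contDiff_const,
    hφ.compact.smul_right, (closure_mono (Function.support_smul_subset_left φ _)).trans hφ.supp⟩
  have hlap : ∀ x, Laplacian.laplacian (fun x => φ x • c) x =
      (∑ i, pd i (pd i φ) x) • c := by
    intro x
    rw [laplacian_eq_sum_pd hφc.smooth, Finset.sum_smul]
    have e : ∀ (i : Fin n) (f : Pos n → ℝ), ContDiff ℝ ∞ f →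
        pd i (fun x => f x • c) = fun x => pd i f x • c := by
      intro i f hf
      ext1 x
      rw [pd, ((hf.differentiable (by simp) x).hasFDerivAt.smul_const c).fderiv]
      rfl
    refine Finset.sum_congr rfl fun i _ => ?_
    rw [e i φ hφ.smooth, e i _ (contDiff_pd i hφ.smooth)]
  have hcl : Continuous fun x => - Laplacian.laplacian (fun x => φ x • c) x := by
    simp_rw [hlap]
    have : Continuous fun x => ∑ i, pd i (pd i φ) x :=
      continuous_finsetSum _ fun i _ => (contDiff_pd i (contDiff_pd i hφ.smooth)).continuous
    fun_prop
  have h1 : MemLp (fun x => φ x • c) 2 (volume.restrict (cell a)) :=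
    hφc.smooth.continuous.memLp_of_hasCompactSupport hφc.compact
  have h3 : MemLp (fun x => - Laplacian.laplacian (fun x => φ x • c) x) 2
      (volume.restrict (cell a)) :=
    (memLp_top_of_continuousOn (isCompact_cell a) (measurableSet_cell a)
      hcl.continuousOn).mono_exponent le_top
  let q₁ : L2Q a m := h1.toLp
  let q₂ : L2Q a m := h3.toLp
  have hq : ⟪p.1.snd, q₁⟫_ℝ = ⟪p.1.fst, q₂⟫_ℝ :=
    p.2 (WithLp.toLp 2 (q₁, q₂)) ⟨_, hφc, h1.coeFn_toLp, h3.coeFn_toLp⟩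
  rw [L2.inner_def, L2.inner_def] at hq
  have e1 : ∫ x in cell a, ⟪p.1.snd x, q₁ x⟫_ℝ = ⟪c, ∫ x in cell a, φ x • p.1.snd x⟫_ℝ := by
    rw [← integral_inner (hφ.integrable_smul (Lp.memLp _))]
    refine integral_congr_ae ?_
    filter_upwards [h1.coeFn_toLp] with x hx
    rw [hx, real_inner_smul_right, real_inner_smul_right, real_inner_comm]
  have hpp : ∀ i : Fin n, IsTest a (pd i (pd i φ)) := fun i =>
    (hφ.fderiv_apply _).fderiv_apply _
  have e2 : ∫ x in cell a, ⟪p.1.fst x, q₂ x⟫_ℝ =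
      ⟪c, ∫ x in cell a, φ x • -∑ i, D2 x (EuclideanSpace.single i 1)
        (EuclideanSpace.single i 1)⟫_ℝ := by
    have e3 : ∫ x in cell a, φ x • -∑ i, D2 x (EuclideanSpace.single i 1)
        (EuclideanSpace.single i 1) = - ∑ i, ∫ x in cell a, pd i (pd i φ) x • p.1.fst x := by
      simp_rw [smul_neg, Finset.smul_sum]
      rw [integral_neg, integral_finsetSum _ fun i _ => hφ.integrable_smul (hm i)]
      congr 1
      exact Finset.sum_congr rfl fun i _ => h.parts_two h2 hφ _ _
    have hi : ∀ i : Fin n, Integrable (fun x => pd i (pd i φ) x • p.1.fst x)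
        (volume.restrict (cell a)) := fun i => (hpp i).integrable_smul (Lp.memLp _)
    rw [e3, ← integral_finsetSum _ fun i _ => hi i, ← integral_neg, ← integral_inner]
    · refine integral_congr_ae ?_
      filter_upwards [h3.coeFn_toLp] with x hx
      rw [hx, hlap, ← Finset.sum_smul, inner_neg_right, inner_neg_right, real_inner_smul_right,
        real_inner_smul_right, real_inner_comm]
    · exact (integrable_finsetSum _ fun i _ => hi i).neg
  rw [← e1, hq, e2]

end Weak

/-! ### Integration by parts for functions in `H¹(Q)` with traces -/

section Parts

section Pairing

variable {α E G : Type*} [MeasurableSpace α] {μ : Measure α} [NormedAddCommGroup E]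
  [NormedSpace ℝ E] [NormedAddCommGroup G] [NormedSpace ℝ G]

lemma memLp_clm_apply {ρ : α → E →L[ℝ] G} (hρ : MemLp ρ ∞ μ) {f : α → E} (hf : MemLp f 2 μ) :
    MemLp (fun x => ρ x (f x)) 2 μ :=
  ContinuousLinearMap.memLp_of_bilin 2 (ContinuousLinearMap.id ℝ (E →L[ℝ] G)) hρ hf

lemma integrable_clm_apply {ρ : α → E →L[ℝ] G} (hρ : MemLp ρ 2 μ) {f : α → E} (hf : MemLp f 2 μ) :
    Integrable (fun x => ρ x (f x)) μ :=
  memLp_one_iff_integrable.mp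
    (ContinuousLinearMap.memLp_of_bilin 1 (ContinuousLinearMap.id ℝ (E →L[ℝ] G)) hρ hf)

lemma tendsto_eLpNorm_clm_apply {ρ : α → E →L[ℝ] G} (hρ : MemLp ρ ∞ μ) {f : ℕ → α → E} {f₀ : α → E}
    (h : Tendsto (fun k => eLpNorm (f k - f₀) 2 μ) atTop (𝓝 0)) :
    Tendsto (fun k => eLpNorm ((fun x => ρ x (f k x)) - fun x => ρ x (f₀ x)) 2 μ) atTop (𝓝 0) := by
  have h1 := ENNReal.Tendsto.const_mul (a := ENNReal.ofReal (eLpNorm ρ ∞ μ).toReal) h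
    (Or.inr ENNReal.ofReal_ne_top)
  rw [mul_zero] at h1
  refine tendsto_of_tendsto_of_tendsto_of_le_of_le tendsto_const_nhds h1 (fun _ => zero_le)
    fun k => eLpNorm_le_mul_eLpNorm_of_ae_le_mul ?_ 2
  filter_upwards [ae_le_eLpNormEssSup (f := ρ) (μ := μ)] with x hx
  rw [← eLpNorm_exponent_top] at hx
  have hx' := ENNReal.toReal_mono hρ.2.ne hx
  rw [toReal_enorm] at hx'
  rw [Pi.sub_apply, Pi.sub_apply, ← map_sub]
  exact (ρ x).le_of_opNorm_le hx' _

lemma tendsto_clm_apply {X Y : Type*} [NormedAddCommGroup X] [NormedSpace ℝ X]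
    [NormedAddCommGroup Y] [NormedSpace ℝ Y] {A : ℕ → X →L[ℝ] Y} {A₀ : X →L[ℝ] Y} {x : ℕ → X}
    {x₀ : X} (hA : Tendsto A atTop (𝓝 A₀)) (hx : Tendsto x atTop (𝓝 x₀)) :
    Tendsto (fun k => A k (x k)) atTop (𝓝 (A₀ x₀)) :=
  (isBoundedBilinearMap_apply.continuous.tendsto (A₀, x₀)).comp (hA.prodMk_nhds hx)

lemma tendsto_integral_clm_apply {f : ℕ → α → E →L[ℝ] ℝ} {f₀ : α → E →L[ℝ] ℝ} {g : ℕ → α → E}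
    {g₀ : α → E} (hf : ∀ k, MemLp (f k) 2 μ) (hf₀ : MemLp f₀ 2 μ) (hg : ∀ k, MemLp (g k) 2 μ)
    (hg₀ : MemLp g₀ 2 μ) (hft : Tendsto (fun k => eLpNorm (f k - f₀) 2 μ) atTop (𝓝 0))
    (hgt : Tendsto (fun k => eLpNorm (g k - g₀) 2 μ) atTop (𝓝 0)) :
    Tendsto (fun k => ∫ x, f k x (g k x) ∂μ) atTop (𝓝 (∫ x, f₀ x (g₀ x) ∂μ)) := by
  let P : Lp (E →L[ℝ] ℝ) 2 μ →L[ℝ] Lp E 2 μ →L[ℝ] ℝ :=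
    (ContinuousLinearMap.id ℝ (E →L[ℝ] ℝ)).lpPairing μ 2 2
  have key : ∀ (u : α → E →L[ℝ] ℝ) (w : α → E) (hu : MemLp u 2 μ) (hw : MemLp w 2 μ),
      ∫ x, u x (w x) ∂μ = P hu.toLp hw.toLp := by
    intro u w hu hw
    rw [ContinuousLinearMap.lpPairing_eq_integral]
    refine integral_congr_ae ?_
    filter_upwards [hu.coeFn_toLp, hw.coeFn_toLp] with x h1 h2
    rw [h1, h2]
    rfl
  rw [key _ _ hf₀ hg₀]
  simp_rw [fun k => key _ _ (hf k) (hg k)]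
  have h1 := (Lp.tendsto_Lp_iff_tendsto_eLpNorm'' f hf f₀ hf₀).mpr hft
  have h2 := (Lp.tendsto_Lp_iff_tendsto_eLpNorm'' g hg g₀ hg₀).mpr hgt
  have h3 : Tendsto (fun k => P (hf k).toLp) atTop (𝓝 (P hf₀.toLp)) :=
    (P.continuous.tendsto _).comp h1
  exact tendsto_clm_apply h3 h2

end Pairing

variable {n : ℕ} {a : Module.Basis (Fin n) ℝ (Pos n)} {F : Type*}
  [NormedAddCommGroup F] [NormedSpace ℝ F]

lemma restrict_face_le_surf (j : Fin n) (s : Fin 2) :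
    (μHE[n - 1] : Measure (Pos n)).restrict (face a j s) ≤ surf a :=
  Measure.restrict_mono (fun _ hx => mem_iUnion.mpr ⟨j, mem_iUnion.mpr ⟨s, hx⟩⟩) le_rfl

lemma IsTrace.memLp_face {w g : Pos n → F} (h : IsTrace a w g) (j : Fin n) (s : Fin 2) :
    MemLp g 2 ((μHE[n - 1] : Measure (Pos n)).restrict (face a j s)) :=
  h.1.mono_measure (restrict_face_le_surf j s)

/-- The approximating sequence in the definition of the trace, for a given weak derivative. -/
lemma IsTrace.exists_approx [CompleteSpace F] {w g : Pos n → F} {Dw : Pos n → Pos n →L[ℝ] F}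
    (h : IsTrace a w g) (hw : HasWeakFDeriv a w Dw) : ∃ ψ : ℕ → Pos n → F,
    (∀ k, ContDiff ℝ ∞ (ψ k)) ∧
    Tendsto (fun k => eLpNorm (ψ k - w) 2 (volume.restrict (cell a))) atTop (𝓝 0) ∧
    Tendsto (fun k => eLpNorm (fderiv ℝ (ψ k) - Dw) 2 (volume.restrict (cell a))) atTop (𝓝 0) ∧
    ∀ j s, Tendsto (fun k => eLpNorm (ψ k - g) 2
      ((μHE[n - 1] : Measure (Pos n)).restrict (face a j s))) atTop (𝓝 0) := by
  obtain ⟨-, D, hD, ψ, h1, h2, h3, h4⟩ := h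
  refine ⟨ψ, h1, h2, h3.congr fun k => eLpNorm_congr_ae ?_, fun j s => ?_⟩
  · filter_upwards [hD.unique hw] with x hx
    rw [Pi.sub_apply, Pi.sub_apply, hx]
  · exact tendsto_of_tendsto_of_tendsto_of_le_of_le tendsto_const_nhds h4 (fun _ => zero_le)
      fun k => eLpNorm_mono_measure _ (restrict_face_le_surf j s)

lemma memLp_two_cell {G : Type*} [NormedAddCommGroup G] {f : Pos n → G} (hf : Continuous f) :
    MemLp f 2 (volume.restrict (cell a)) :=
  (memLp_top_of_continuousOn (isCompact_cell a) (measurableSet_cell a)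
    hf.continuousOn).mono_exponent le_top

lemma memLp_two_face {G : Type*} [NormedAddCommGroup G] (j : Fin n) (s : Fin 2)
    {f : Pos n → G} (hf : Continuous f) :
    MemLp f 2 ((μHE[n - 1] : Measure (Pos n)).restrict (face a j s)) :=
  (memLp_top_of_continuousOn (isCompact_face a j s) (isClosed_face a j s).measurableSet
    hf.continuousOn).mono_exponent le_top

lemma tendsto_eLpNorm_apply {μ : Measure (Pos n)} (v : Pos n) {f : ℕ → Pos n → Pos n →L[ℝ] F}
    {f₀ : Pos n → Pos n →L[ℝ] F} (h : Tendsto (fun k => eLpNorm (f k - f₀) 2 μ) atTop (𝓝 0)) :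
    Tendsto (fun k => eLpNorm ((fun x => f k x v) - fun x => f₀ x v) 2 μ) atTop (𝓝 0) := by
  have h1 := ENNReal.Tendsto.const_mul (a := ENNReal.ofReal ‖v‖) h (Or.inr ENNReal.ofReal_ne_top)
  rw [mul_zero] at h1
  refine tendsto_of_tendsto_of_tendsto_of_le_of_le tendsto_const_nhds h1 (fun _ => zero_le)
    fun k => eLpNorm_le_mul_eLpNorm_of_ae_le_mul (Eventually.of_forall fun x => ?_) 2
  rw [mul_comm]
  exact (f k x - f₀ x).le_opNorm v

variable {F₁ F₂ : Type*} [NormedAddCommGroup F₁] [NormedSpace ℝ F₁] [NormedAddCommGroup F₂]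
  [NormedSpace ℝ F₂]

lemma setIntegral_fderivWithin_bilin_smooth {ρ : Pos n → F₁ →L[ℝ] F₂ →L[ℝ] ℝ}
    (hρ : ContDiffOn ℝ 1 ρ (cell a)) {ψ : Pos n → F₁} {χ : Pos n → F₂} (hψ : ContDiff ℝ ∞ ψ)
    (hχ : ContDiff ℝ ∞ χ) (v : Pos n) :
    ∫ x in cell a, (fderivWithin ℝ ρ (cell a) x v (ψ x) (χ x) + ρ x (fderiv ℝ ψ x v) (χ x) +
      ρ x (ψ x) (fderiv ℝ χ x v)) = boundaryIntegral a fun x ν => ⟪v, ν⟫_ℝ * ρ x (ψ x) (χ x) := by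
  have hc : ContDiffOn ℝ 1 (fun x => ρ x (ψ x) (χ x)) (cell a) :=
    (hρ.clm_apply (hψ.of_le (by exact_mod_cast le_top)).contDiffOn).clm_apply
      (hχ.of_le (by exact_mod_cast le_top)).contDiffOn
  rw [← setIntegral_fderivWithin a v hc]
  refine setIntegral_congr_fun (measurableSet_cell a) fun x hx => ?_
  have h1 : HasFDerivWithinAt ρ _ (cell a) x :=
    (hρ.differentiableOn (by simp) x hx).hasFDerivWithinAt
  have h2 : HasFDerivWithinAt ψ _ (cell a) x :=
    (hψ.differentiable (by simp) x).hasFDerivAt.hasFDerivWithinAt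
  have h3 : HasFDerivWithinAt χ _ (cell a) x :=
    (hχ.differentiable (by simp) x).hasFDerivAt.hasFDerivWithinAt
  have h4 := (h1.clm_apply h2).clm_apply h3
  rw [h4.fderivWithin (uniqueDiffOn_cell a x hx)]
  simp
  ring

/-- Integration by parts in `H¹(Q)`, with the boundary term expressed by the traces. -/
theorem setIntegral_fderivWithin_bilin [CompleteSpace F₁] [CompleteSpace F₂]
    {ρ : Pos n → F₁ →L[ℝ] F₂ →L[ℝ] ℝ}
    (hρ : ContDiffOn ℝ 1 ρ (cell a)) {w g : Pos n → F₁} {Dw : Pos n → Pos n →L[ℝ] F₁}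
    {w' g' : Pos n → F₂} {Dw' : Pos n → Pos n →L[ℝ] F₂} (hw : HasWeakFDeriv a w Dw)
    (hw' : HasWeakFDeriv a w' Dw') (hg : IsTrace a w g) (hg' : IsTrace a w' g') (v : Pos n) :
    ∫ x in cell a, (fderivWithin ℝ ρ (cell a) x v (w x) (w' x) + ρ x (Dw x v) (w' x) +
      ρ x (w x) (Dw' x v)) = boundaryIntegral a fun x ν => ⟪v, ν⟫_ℝ * ρ x (g x) (g' x) := by
  obtain ⟨ψ, hψ, hψ0, hψ1, hψb⟩ := hg.exists_approx hw
  obtain ⟨χ, hχ, hχ0, hχ1, hχb⟩ := hg'.exists_approx hw'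
  have hρm : MemLp ρ ∞ (volume.restrict (cell a)) :=
    memLp_top_of_continuousOn (isCompact_cell a) (measurableSet_cell a) hρ.continuousOn
  have hρb : ∀ j s, MemLp ρ ∞ ((μHE[n - 1] : Measure (Pos n)).restrict (face a j s)) :=
    fun j s => memLp_top_of_continuousOn (isCompact_face a j s) (isClosed_face a j s).measurableSet
      (hρ.continuousOn.mono (face_subset_cell a j s))
  have hρ' : MemLp (fun x => fderivWithin ℝ ρ (cell a) x v) ∞ (volume.restrict (cell a)) :=
    memLp_top_of_continuousOn (isCompact_cell a) (measurableSet_cell a)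
      ((hρ.continuousOn_fderivWithin (uniqueDiffOn_cell a) (by simp)).clm_apply continuousOn_const)
  have split : ∀ {u : Pos n → F₁} {Du : Pos n → Pos n →L[ℝ] F₁} {u' : Pos n → F₂}
      {Du' : Pos n → Pos n →L[ℝ] F₂}, MemLp u 2 (volume.restrict (cell a)) →
      MemLp (fun x => Du x v) 2 (volume.restrict (cell a)) →
      MemLp u' 2 (volume.restrict (cell a)) →
      MemLp (fun x => Du' x v) 2 (volume.restrict (cell a)) →
      ∫ x in cell a, (fderivWithin ℝ ρ (cell a) x v (u x) (u' x) + ρ x (Du x v) (u' x) +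
        ρ x (u x) (Du' x v)) =
      (∫ x in cell a, fderivWithin ℝ ρ (cell a) x v (u x) (u' x)) +
        (∫ x in cell a, ρ x (Du x v) (u' x)) + ∫ x in cell a, ρ x (u x) (Du' x v) := by
    intro u Du u' Du' h1 h2 h3 h4
    have i1 := integrable_clm_apply (memLp_clm_apply hρ' h1) h3
    have i2 := integrable_clm_apply (memLp_clm_apply hρm h2) h3
    have i3 := integrable_clm_apply (memLp_clm_apply hρm h1) h4
    have i12 : Integrable (fun x => fderivWithin ℝ ρ (cell a) x v (u x) (u' x) +
        ρ x (Du x v) (u' x)) (volume.restrict (cell a)) := i1.add i2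
    rw [integral_add i12 i3, integral_add i1 i2]
  have mψ : ∀ k, MemLp (ψ k) 2 (volume.restrict (cell a)) := fun k =>
    memLp_two_cell (hψ k).continuous
  have mχ : ∀ k, MemLp (χ k) 2 (volume.restrict (cell a)) := fun k =>
    memLp_two_cell (hχ k).continuous
  have mψ' : ∀ k, MemLp (fun x => fderiv ℝ (ψ k) x v) 2 (volume.restrict (cell a)) := fun k =>
    memLp_two_cell (((hψ k).continuous_fderiv (by simp)).clm_apply continuous_const)
  have mχ' : ∀ k, MemLp (fun x => fderiv ℝ (χ k) x v) 2 (volume.restrict (cell a)) := fun k =>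
    memLp_two_cell (((hχ k).continuous_fderiv (by simp)).clm_apply continuous_const)
  have hL : Tendsto (fun k => ∫ x in cell a, (fderivWithin ℝ ρ (cell a) x v (ψ k x) (χ k x) +
      ρ x (fderiv ℝ (ψ k) x v) (χ k x) + ρ x (ψ k x) (fderiv ℝ (χ k) x v))) atTop
      (𝓝 (∫ x in cell a, (fderivWithin ℝ ρ (cell a) x v (w x) (w' x) + ρ x (Dw x v) (w' x) +
        ρ x (w x) (Dw' x v)))) := by
    rw [split hw.memLp (hw.memLp_apply v) hw'.memLp (hw'.memLp_apply v)]
    simp_rw [fun k => split (mψ k) (mψ' k) (mχ k) (mχ' k)]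
    refine ((tendsto_integral_clm_apply (fun k => memLp_clm_apply hρ' (mψ k))
        (memLp_clm_apply hρ' hw.memLp) mχ hw'.memLp (tendsto_eLpNorm_clm_apply hρ' hψ0) hχ0).add
      (tendsto_integral_clm_apply (fun k => memLp_clm_apply hρm (mψ' k))
        (memLp_clm_apply hρm (hw.memLp_apply v)) mχ hw'.memLp
        (tendsto_eLpNorm_clm_apply hρm (tendsto_eLpNorm_apply v hψ1)) hχ0)).add
      (tendsto_integral_clm_apply (fun k => memLp_clm_apply hρm (mψ k))
        (memLp_clm_apply hρm hw.memLp) mχ' (hw'.memLp_apply v)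
        (tendsto_eLpNorm_clm_apply hρm hψ0) (tendsto_eLpNorm_apply v hχ1))
  have hR : Tendsto (fun k => boundaryIntegral a fun x ν => ⟪v, ν⟫_ℝ * ρ x (ψ k x) (χ k x)) atTop
      (𝓝 (boundaryIntegral a fun x ν => ⟪v, ν⟫_ℝ * ρ x (g x) (g' x))) := by
    refine tendsto_finsetSum _ fun j _ => tendsto_finsetSum _ fun s _ => ?_
    simp_rw [integral_const_mul]
    refine Tendsto.const_mul _ ?_
    exact tendsto_integral_clm_apply
      (fun k => memLp_clm_apply (hρb j s) (memLp_two_face j s (hψ k).continuous))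
      (memLp_clm_apply (hρb j s) (hg.memLp_face j s))
      (fun k => memLp_two_face j s (hχ k).continuous) (hg'.memLp_face j s)
      (tendsto_eLpNorm_clm_apply (hρb j s) (hψb j s)) (hχb j s)
  refine tendsto_nhds_unique hL (hR.congr fun k => ?_)
  exact (setIntegral_fderivWithin_bilin_smooth hρ (hψ k) (hχ k) v).symm

end Parts

/-! ### The Pohozaev identity -/

section Pohozaev

variable {n : ℕ} {a : Module.Basis (Fin n) ℝ (Pos n)} {F F₁ F₂ : Type*}
  [NormedAddCommGroup F₁] [NormedSpace ℝ F₁] [NormedAddCommGroup F₂] [NormedSpace ℝ F₂]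

lemma boundaryIntegral_congr {E : Type*} [NormedAddCommGroup E] [NormedSpace ℝ E]
    {f f' : Pos n → Pos n → E} (h : ∀ x ∈ cell a, ∀ ν, f x ν = f' x ν) :
    boundaryIntegral a f = boundaryIntegral a f' :=
  Finset.sum_congr rfl fun j _ => Finset.sum_congr rfl fun s _ =>
    setIntegral_congr_fun (isClosed_face a j s).measurableSet fun x hx =>
      h x (face_subset_cell a j s hx) _

lemma integrable_fderivWithin_bilin {ρ : Pos n → F₁ →L[ℝ] F₂ →L[ℝ] ℝ}
    (hρ : ContDiffOn ℝ 1 ρ (cell a)) {w : Pos n → F₁} {Dw : Pos n → Pos n →L[ℝ] F₁}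
    {w' : Pos n → F₂} {Dw' : Pos n → Pos n →L[ℝ] F₂} (hw : HasWeakFDeriv a w Dw)
    (hw' : HasWeakFDeriv a w' Dw') (v : Pos n) :
    IntegrableOn (fun x => fderivWithin ℝ ρ (cell a) x v (w x) (w' x) + ρ x (Dw x v) (w' x) +
      ρ x (w x) (Dw' x v)) (cell a) := by
  have hρm : MemLp ρ ∞ (volume.restrict (cell a)) :=
    memLp_top_of_continuousOn (isCompact_cell a) (measurableSet_cell a) hρ.continuousOn
  have hρ' : MemLp (fun x => fderivWithin ℝ ρ (cell a) x v) ∞ (volume.restrict (cell a)) :=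
    memLp_top_of_continuousOn (isCompact_cell a) (measurableSet_cell a)
      ((hρ.continuousOn_fderivWithin (uniqueDiffOn_cell a) (by simp)).clm_apply continuousOn_const)
  exact ((integrable_clm_apply (memLp_clm_apply hρ' hw.memLp) hw'.memLp).add
    (integrable_clm_apply (memLp_clm_apply hρm (hw.memLp_apply v)) hw'.memLp)).add
    (integrable_clm_apply (memLp_clm_apply hρm hw.memLp) (hw'.memLp_apply v))

/-- Integration by parts in `H¹(Q)` for a vector field given by its components `ρ i` in the
directions `v i`. -/
theorem setIntegral_fderivWithin_bilin_sum [CompleteSpace F₁] [CompleteSpace F₂] {ι : Type*}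
    [Fintype ι] {ρ : ι → Pos n → F₁ →L[ℝ] F₂ →L[ℝ] ℝ}
    (hρ : ∀ i, ContDiffOn ℝ 1 (ρ i) (cell a)) {w g : Pos n → F₁} {Dw : Pos n → Pos n →L[ℝ] F₁}
    {w' g' : Pos n → F₂} {Dw' : Pos n → Pos n →L[ℝ] F₂} (hw : HasWeakFDeriv a w Dw)
    (hw' : HasWeakFDeriv a w' Dw') (hg : IsTrace a w g) (hg' : IsTrace a w' g') (v : ι → Pos n) :
    IntegrableOn (fun x => ∑ i, (fderivWithin ℝ (ρ i) (cell a) x (v i) (w x) (w' x) +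
      ρ i x (Dw x (v i)) (w' x) + ρ i x (w x) (Dw' x (v i)))) (cell a) ∧
    ∫ x in cell a, ∑ i, (fderivWithin ℝ (ρ i) (cell a) x (v i) (w x) (w' x) +
      ρ i x (Dw x (v i)) (w' x) + ρ i x (w x) (Dw' x (v i))) =
      boundaryIntegral a fun x ν => ∑ i, ⟪v i, ν⟫_ℝ * ρ i x (g x) (g' x) := by
  have hi := fun i => integrable_fderivWithin_bilin (hρ i) hw hw' (v i)
  refine ⟨integrable_finsetSum _ fun i _ => hi i, ?_⟩
  rw [integral_finsetSum _ fun i _ => hi i]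
  simp_rw [fun i => setIntegral_fderivWithin_bilin (hρ i) hw hw' hg hg' (v i)]
  simp only [boundaryIntegral]
  rw [Finset.sum_comm]
  refine Finset.sum_congr rfl fun j _ => ?_
  rw [Finset.sum_comm]
  refine Finset.sum_congr rfl fun s _ => ?_
  rw [integral_finsetSum]
  intro i _
  have hρb : MemLp (ρ i) ∞ ((μHE[n - 1] : Measure (Pos n)).restrict (face a j s)) :=
    memLp_top_of_continuousOn (isCompact_face a j s) (isClosed_face a j s).measurableSet
      ((hρ i).continuousOn.mono (face_subset_cell a j s))
  exact (integrable_clm_apply (memLp_clm_apply hρb (hg.memLp_face j s))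
    (hg'.memLp_face j s)).const_mul _

lemma contDiffOn_clm_comp {E E' : Type*} [NormedAddCommGroup E] [NormedSpace ℝ E]
    [NormedAddCommGroup E'] [NormedSpace ℝ E'] (T : E →L[ℝ] E') {A : Pos n → E} {s : Set (Pos n)}
    (hA : ContDiffOn ℝ 1 A s) : ContDiffOn ℝ 1 (fun x => T (A x)) s :=
  T.contDiff.comp_contDiffOn hA

lemma fderivWithin_clm_comp {E E' : Type*} [NormedAddCommGroup E] [NormedSpace ℝ E]
    [NormedAddCommGroup E'] [NormedSpace ℝ E'] (T : E →L[ℝ] E') {A : Pos n → E} {s : Set (Pos n)}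
    (hs : UniqueDiffOn ℝ s) (hA : ContDiffOn ℝ 1 A s) {x : Pos n} (hx : x ∈ s) (v : Pos n) :
    fderivWithin ℝ (fun x => T (A x)) s x v = T (fderivWithin ℝ A s x v) := by
  have d : HasFDerivWithinAt A _ s x := (hA.differentiableOn (by simp) x hx).hasFDerivWithinAt
  have d' : HasFDerivWithinAt (fun x => T (A x)) _ s x := T.hasFDerivAt.comp_hasFDerivWithinAt x d
  rw [d'.fderivWithin (hs x hx)]
  rfl

/-- The case of coefficients depending linearly on the position. -/
lemma setIntegral_fderivWithin_bilin_linear [CompleteSpace F₁] [CompleteSpace F₂] {ι : Type*}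
    [Fintype ι] (T : ι → Pos n →L[ℝ] F₁ →L[ℝ] F₂ →L[ℝ] ℝ) {w g : Pos n → F₁}
    {Dw : Pos n → Pos n →L[ℝ] F₁} {w' g' : Pos n → F₂} {Dw' : Pos n → Pos n →L[ℝ] F₂}
    (hw : HasWeakFDeriv a w Dw) (hw' : HasWeakFDeriv a w' Dw') (hg : IsTrace a w g)
    (hg' : IsTrace a w' g') (v : ι → Pos n) :
    IntegrableOn (fun x => ∑ i, (T i (v i) (w x) (w' x) +
      T i x (Dw x (v i)) (w' x) + T i x (w x) (Dw' x (v i)))) (cell a) ∧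
    ∫ x in cell a, ∑ i, (T i (v i) (w x) (w' x) +
      T i x (Dw x (v i)) (w' x) + T i x (w x) (Dw' x (v i))) =
      boundaryIntegral a fun x ν => ∑ i, ⟪v i, ν⟫_ℝ * T i x (g x) (g' x) := by
  have key := setIntegral_fderivWithin_bilin_sum (ρ := fun i x => T i x)
    (fun i => contDiffOn_clm_comp (E' := F₁ →L[ℝ] F₂ →L[ℝ] ℝ) (T i) contDiffOn_id) hw hw' hg hg' v
  have e : ∀ x ∈ cell a, ∑ i, (fderivWithin ℝ (fun x => T i x) (cell a) x (v i) (w x) (w' x) +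
      T i x (Dw x (v i)) (w' x) + T i x (w x) (Dw' x (v i))) =
      ∑ i, (T i (v i) (w x) (w' x) + T i x (Dw x (v i)) (w' x) + T i x (w x) (Dw' x (v i))) := by
    intro x hx
    refine Finset.sum_congr rfl fun i _ => ?_
    have hd := fderivWithin_clm_comp (E' := F₁ →L[ℝ] F₂ →L[ℝ] ℝ) (T i) (uniqueDiffOn_cell a)
      contDiffOn_id hx (v i)
    rw [fderivWithin_id (uniqueDiffOn_cell a x hx)] at hd
    exact congrArg (fun L : F₁ →L[ℝ] F₂ →L[ℝ] ℝ => L (w x) (w' x) + T i x (Dw x (v i)) (w' x) +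
      T i x (w x) (Dw' x (v i))) hd
  refine ⟨key.1.congr_fun e (measurableSet_cell a), ?_⟩
  rw [← setIntegral_congr_fun (measurableSet_cell a) e, key.2]

lemma sum_coord_smul_single (x : Pos n) :
    ∑ i, x i • (EuclideanSpace.single i (1 : ℝ) : Pos n) = x := by
  simpa using (EuclideanSpace.basisFun (Fin n) ℝ).sum_repr x

lemma sum_inner_single_smul (ν : Pos n) :
    ∑ i, ⟪(EuclideanSpace.single i (1 : ℝ) : Pos n), ν⟫_ℝ •
      (EuclideanSpace.single i (1 : ℝ) : Pos n) = ν := by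
  conv_rhs => rw [← sum_coord_smul_single ν]
  simp [EuclideanSpace.inner_single_left]

lemma sum_inner_single_mul (x ν : Pos n) :
    ∑ i, ⟪(EuclideanSpace.single i (1 : ℝ) : Pos n), ν⟫_ℝ * x i = ⟪x, ν⟫_ℝ := by
  conv_rhs => rw [← sum_coord_smul_single x, sum_inner]
  simp [inner_smul_left, mul_comm]

lemma contDiffOn_coord_smul {E : Type*} [NormedAddCommGroup E] [NormedSpace ℝ E] (i : Fin n)
    {f : Pos n → E} {s : Set (Pos n)} (hf : ContDiffOn ℝ 1 f s) :
    ContDiffOn ℝ 1 (fun x => x i • f x) s :=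
  (EuclideanSpace.proj (𝕜 := ℝ) i).contDiff.contDiffOn.smul hf

lemma fderivWithin_coord_smul {E : Type*} [NormedAddCommGroup E] [NormedSpace ℝ E] (i : Fin n)
    {f : Pos n → E} {s : Set (Pos n)} (hs : UniqueDiffOn ℝ s) (hf : ContDiffOn ℝ 1 f s) {x : Pos n}
    (hx : x ∈ s) : fderivWithin ℝ (fun x => x i • f x) s x (EuclideanSpace.single i 1) =
      x i • fderivWithin ℝ f s x (EuclideanSpace.single i 1) + f x := by
  have d1 : HasFDerivWithinAt f _ s x := (hf.differentiableOn (by simp) x hx).hasFDerivWithinAt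
  have d2 : HasFDerivWithinAt (fun x : Pos n => x i) _ s x :=
    (EuclideanSpace.proj (𝕜 := ℝ) i).hasFDerivWithinAt
  have d3 : HasFDerivWithinAt (fun x => x i • f x) _ s x := d2.smul d1
  rw [d3.fderivWithin (hs x hx)]
  simp

/-- Integration by parts against the radial vector field `x`, whose divergence is `n`. -/
theorem setIntegral_radial_bilin [CompleteSpace F₁] [CompleteSpace F₂]
    {ρ : Pos n → F₁ →L[ℝ] F₂ →L[ℝ] ℝ}
    (hρ : ContDiffOn ℝ 1 ρ (cell a)) {w g : Pos n → F₁} {Dw : Pos n → Pos n →L[ℝ] F₁}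
    {w' g' : Pos n → F₂} {Dw' : Pos n → Pos n →L[ℝ] F₂} (hw : HasWeakFDeriv a w Dw)
    (hw' : HasWeakFDeriv a w' Dw') (hg : IsTrace a w g) (hg' : IsTrace a w' g') :
    IntegrableOn (fun x => n * ρ x (w x) (w' x) + fderivWithin ℝ ρ (cell a) x x (w x) (w' x) +
      ρ x (Dw x x) (w' x) + ρ x (w x) (Dw' x x)) (cell a) ∧
    ∫ x in cell a, (n * ρ x (w x) (w' x) + fderivWithin ℝ ρ (cell a) x x (w x) (w' x) +
      ρ x (Dw x x) (w' x) + ρ x (w x) (Dw' x x)) =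
      boundaryIntegral a fun x ν => ⟪x, ν⟫_ℝ * ρ x (g x) (g' x) := by
  have hc : ∀ i, ContDiffOn ℝ 1 (fun x : Pos n => x i • ρ x) (cell a) := fun i =>
    contDiffOn_coord_smul i hρ
  obtain ⟨h1, h2⟩ := setIntegral_fderivWithin_bilin_sum hc hw hw' hg hg'
    fun i => EuclideanSpace.single i 1
  have e : ∀ x ∈ cell a, ∑ i, (fderivWithin ℝ (fun x : Pos n => x i • ρ x) (cell a) x
      (EuclideanSpace.single i 1) (w x) (w' x) +
      (x i • ρ x) (Dw x (EuclideanSpace.single i 1)) (w' x) +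
      (x i • ρ x) (w x) (Dw' x (EuclideanSpace.single i 1))) =
      n * ρ x (w x) (w' x) + fderivWithin ℝ ρ (cell a) x x (w x) (w' x) +
      ρ x (Dw x x) (w' x) + ρ x (w x) (Dw' x x) := by
    intro x hx
    have hd := fun i => fderivWithin_coord_smul i (uniqueDiffOn_cell a) hρ hx
    have s : ∀ L : Pos n →L[ℝ] ℝ, ∑ i, x i * L (EuclideanSpace.single i 1) = L x := by
      intro L
      conv_rhs => rw [← sum_coord_smul_single x]
      simp
    have s1 := s ((ContinuousLinearMap.apply ℝ ℝ (w' x)) ∘L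
      (ContinuousLinearMap.apply ℝ _ (w x)) ∘L fderivWithin ℝ ρ (cell a) x)
    have s2 := s ((ContinuousLinearMap.apply ℝ ℝ (w' x)) ∘L (ρ x ∘L Dw x))
    have s3 := s (ρ x (w x) ∘L Dw' x)
    simp only [ContinuousLinearMap.coe_comp, Function.comp_apply,
      ContinuousLinearMap.apply_apply] at s1 s2 s3
    simp only [hd, add_apply, smul_apply, smul_eq_mul, Finset.sum_add_distrib, s1, s2, s3]
    simp
    ring
  refine ⟨h1.congr_fun e (measurableSet_cell a), ?_⟩
  rw [← setIntegral_congr_fun (measurableSet_cell a) e, h2]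
  refine boundaryIntegral_congr fun x _ ν => ?_
  rw [← sum_inner_single_mul, Finset.sum_mul]
  simp [mul_assoc]

variable [NormedAddCommGroup F] [InnerProductSpace ℝ F]

/-- The bounded bilinear form `(f, L) ↦ ⟪f, L v⟫`. -/
noncomputable def innerApplyL (F : Type*) [NormedAddCommGroup F] [InnerProductSpace ℝ F]
    (v : Pos n) : F →L[ℝ] (Pos n →L[ℝ] F) →L[ℝ] ℝ :=
  (ContinuousLinearMap.compL ℝ (Pos n →L[ℝ] F) F ℝ).flip (ContinuousLinearMap.apply ℝ F v) ∘L
    innerSL ℝ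

lemma innerApplyL_apply (v : Pos n) (f : F) (L : Pos n →L[ℝ] F) :
    innerApplyL F v f L = ⟪f, L v⟫_ℝ := rfl

/-- The bounded bilinear form `(L, L') ↦ ⟪L x, L' v⟫`, depending linearly on `x`. -/
noncomputable def innerApplyApplyL (F : Type*) [NormedAddCommGroup F] [InnerProductSpace ℝ F]
    (v : Pos n) : Pos n →L[ℝ] (Pos n →L[ℝ] F) →L[ℝ] (Pos n →L[ℝ] F) →L[ℝ] ℝ :=
  ContinuousLinearMap.compL ℝ (Pos n →L[ℝ] F) F ((Pos n →L[ℝ] F) →L[ℝ] ℝ) (innerApplyL F v) ∘L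
    ContinuousLinearMap.apply ℝ F

lemma innerApplyApplyL_apply (v x : Pos n) (L L' : Pos n →L[ℝ] F) :
    innerApplyApplyL F v x L L' = ⟪L x, L' v⟫_ℝ := rfl

/-- The squared Hilbert-Schmidt norm of a linear map, computed in the standard basis of `ℝⁿ`. -/
noncomputable def hsNormSq (L : Pos n →L[ℝ] F) : ℝ :=
  ∑ j, ⟪L (EuclideanSpace.single j 1), L (EuclideanSpace.single j 1)⟫_ℝ

/-- Green's first identity in `H²(Q)`. -/
theorem setIntegral_green [CompleteSpace F] {u g : Pos n → F} {D : Pos n → Pos n →L[ℝ] F}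
    {G : Pos n → Pos n →L[ℝ] F} {D2 : Pos n → Pos n →L[ℝ] Pos n →L[ℝ] F}
    (h : HasWeakFDeriv a u D) (h2 : HasWeakFDeriv a D D2) (hg : IsTrace a u g)
    (hG : IsTrace a D G) :
    IntegrableOn (fun x => hsNormSq (D x) +
      ⟪u x, ∑ i, D2 x (EuclideanSpace.single i 1) (EuclideanSpace.single i 1)⟫_ℝ) (cell a) ∧
    ∫ x in cell a, (hsNormSq (D x) +
      ⟪u x, ∑ i, D2 x (EuclideanSpace.single i 1) (EuclideanSpace.single i 1)⟫_ℝ) =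
      boundaryIntegral a fun x ν => ⟪g x, G x ν⟫_ℝ := by
  have key := setIntegral_fderivWithin_bilin_sum
    (ρ := fun (i : Fin n) _ => innerApplyL F (EuclideanSpace.single i 1))
    (fun i => contDiffOn_const) h h2 hg hG fun i => EuclideanSpace.single i 1
  simp only [fderivWithin_fun_const, Pi.zero_apply, zero_apply, zero_add, innerApplyL_apply,
    Finset.sum_add_distrib] at key
  simp only [hsNormSq, inner_sum]
  refine ⟨key.1, key.2.trans (boundaryIntegral_congr fun x _ ν => ?_)⟩
  conv_rhs => rw [← sum_inner_single_smul ν]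
  simp [inner_sum, inner_smul_right]

/-- The divergence theorem for the vector field `⟪x·∇u, ∇u⟫`. -/
theorem setIntegral_radial_green [CompleteSpace F] {D : Pos n → Pos n →L[ℝ] F}
    {G : Pos n → Pos n →L[ℝ] F} {D2 : Pos n → Pos n →L[ℝ] Pos n →L[ℝ] F}
    (h2 : HasWeakFDeriv a D D2) (hG : IsTrace a D G) :
    IntegrableOn (fun x => hsNormSq (D x) +
      ∑ i, ⟪D2 x (EuclideanSpace.single i 1) x, D x (EuclideanSpace.single i 1)⟫_ℝ +
      ⟪D x x, ∑ i, D2 x (EuclideanSpace.single i 1) (EuclideanSpace.single i 1)⟫_ℝ) (cell a) ∧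
    ∫ x in cell a, (hsNormSq (D x) +
      ∑ i, ⟪D2 x (EuclideanSpace.single i 1) x, D x (EuclideanSpace.single i 1)⟫_ℝ +
      ⟪D x x, ∑ i, D2 x (EuclideanSpace.single i 1) (EuclideanSpace.single i 1)⟫_ℝ) =
      boundaryIntegral a fun x ν => ⟪G x x, G x ν⟫_ℝ := by
  have key := setIntegral_fderivWithin_bilin_linear
    (fun i : Fin n => innerApplyApplyL F (EuclideanSpace.single i 1)) h2 h2 hG hG
    fun i => EuclideanSpace.single i 1
  simp only [innerApplyApplyL_apply, Finset.sum_add_distrib] at key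
  simp only [hsNormSq, inner_sum]
  refine ⟨key.1, key.2.trans (boundaryIntegral_congr fun x _ ν => ?_)⟩
  conv_rhs => enter [3]; rw [← sum_inner_single_smul ν]
  simp [inner_sum, inner_smul_right]

/-- The divergence theorem for the vector field `|∇u|² x`. -/
theorem setIntegral_radial_hsNormSq [CompleteSpace F] {D : Pos n → Pos n →L[ℝ] F}
    {G : Pos n → Pos n →L[ℝ] F} {D2 : Pos n → Pos n →L[ℝ] Pos n →L[ℝ] F}
    (h2 : HasWeakFDeriv a D D2) (hG : IsTrace a D G) :
    IntegrableOn (fun x => n * hsNormSq (D x) +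
      2 * ∑ i, ⟪D2 x x (EuclideanSpace.single i 1), D x (EuclideanSpace.single i 1)⟫_ℝ) (cell a) ∧
    ∫ x in cell a, (n * hsNormSq (D x) +
      2 * ∑ i, ⟪D2 x x (EuclideanSpace.single i 1), D x (EuclideanSpace.single i 1)⟫_ℝ) =
      boundaryIntegral a fun x ν => ⟪x, ν⟫_ℝ * hsNormSq (G x) := by
  let ρ : (Pos n →L[ℝ] F) →L[ℝ] (Pos n →L[ℝ] F) →L[ℝ] ℝ :=
    ∑ i : Fin n, innerApplyApplyL F (EuclideanSpace.single i 1) (EuclideanSpace.single i 1)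
  have hρ : ∀ L L', ρ L L' =
      ∑ i, ⟪L (EuclideanSpace.single i 1), L' (EuclideanSpace.single i 1)⟫_ℝ := by
    intro L L'
    simp [ρ, innerApplyApplyL_apply]
  have key := setIntegral_radial_bilin (ρ := fun _ => ρ) contDiffOn_const h2 h2 hG hG
  have e : ∀ x, n * ρ (D x) (D x) + fderivWithin ℝ (fun _ => ρ) (cell a) x x (D x) (D x) +
      ρ (D2 x x) (D x) + ρ (D x) (D2 x x) = n * hsNormSq (D x) +
      2 * ∑ i, ⟪D2 x x (EuclideanSpace.single i 1), D x (EuclideanSpace.single i 1)⟫_ℝ := by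
    intro x
    have hs : ρ (D x) (D2 x x) = ρ (D2 x x) (D x) := by
      simp only [hρ, real_inner_comm]
    rw [hs]
    simp only [fderivWithin_fun_const, Pi.zero_apply, zero_apply, hρ, hsNormSq]
    ring
  simp_rw [e] at key
  refine ⟨key.1, key.2.trans (boundaryIntegral_congr fun x _ ν => ?_)⟩
  rw [hρ, hsNormSq]

lemma integral_sub_two_mul_add_add {α : Type*} [MeasurableSpace α] {μ : Measure α}
    {f₁ f₂ f₃ f₄ : α → ℝ} (h₁ : Integrable f₁ μ) (h₂ : Integrable f₂ μ) (h₃ : Integrable f₃ μ)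
    (h₄ : Integrable f₄ μ) (c : ℝ) :
    ∫ x, (f₁ x - 2 * f₂ x + f₃ x + c * f₄ x) ∂μ =
      (∫ x, f₁ x ∂μ) - 2 * (∫ x, f₂ x ∂μ) + (∫ x, f₃ x ∂μ) + c * ∫ x, f₄ x ∂μ := by
  have h12 : Integrable (fun x => f₁ x - 2 * f₂ x) μ := h₁.sub (h₂.const_mul 2)
  have h123 : Integrable (fun x => f₁ x - 2 * f₂ x + f₃ x) μ := h12.add h₃
  rw [integral_add h123 (h₄.const_mul c), integral_add h12 h₃, integral_sub h₁ (h₂.const_mul 2),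
    integral_const_mul, integral_const_mul]

/-- The bounded bilinear form `(f, f') ↦ ⟪A f, f'⟫`, depending linearly on the operator `A`. -/
noncomputable def innerOpL (F : Type*) [NormedAddCommGroup F] [InnerProductSpace ℝ F] :
    (F →L[ℝ] F) →L[ℝ] F →L[ℝ] F →L[ℝ] ℝ :=
  ContinuousLinearMap.compL ℝ F F (F →L[ℝ] ℝ) (innerSL ℝ)

lemma innerOpL_apply (A : F →L[ℝ] F) (f f' : F) : innerOpL F A f f' = ⟪A f, f'⟫_ℝ := rfl

/-- The **Pohozaev identity** for `u ∈ H²(Q)` with `Δu = A u`, where `A` has symmetric values. -/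
theorem setIntegral_pohozaev [CompleteSpace F] {A : Pos n → F →L[ℝ] F}
    (hA : ContDiffOn ℝ 1 A (cell a))
    (hAs : ∀ x ∈ cell a, ∀ v w, ⟪A x v, w⟫_ℝ = ⟪v, A x w⟫_ℝ) {u g : Pos n → F}
    {D : Pos n → Pos n →L[ℝ] F}
    {G : Pos n → Pos n →L[ℝ] F} {D2 : Pos n → Pos n →L[ℝ] Pos n →L[ℝ] F}
    (h : HasWeakFDeriv a u D) (h2 : HasWeakFDeriv a D D2) (hg : IsTrace a u g)
    (hG : IsTrace a D G)
    (heq : ∀ᵐ x ∂(volume.restrict (cell a)),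
      ∑ i, D2 x (EuclideanSpace.single i 1) (EuclideanSpace.single i 1) = A x (u x)) :
    ∫ x in cell a, ⟪u x, (2 : ℝ) • A x (u x) + fderivWithin ℝ A (cell a) x x (u x)⟫_ℝ =
      (boundaryIntegral a fun x ν => ⟪x, ν⟫_ℝ * ⟪A x (g x), g x⟫_ℝ) -
      2 * (boundaryIntegral a fun x ν => ⟪G x x, G x ν⟫_ℝ) +
      (boundaryIntegral a fun x ν => ⟪x, ν⟫_ℝ * hsNormSq (G x)) +
      (2 - n) * boundaryIntegral a fun x ν => ⟪g x, G x ν⟫_ℝ := by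
  have hρ : ContDiffOn ℝ 1 (fun x => innerOpL F (A x)) (cell a) :=
    contDiffOn_clm_comp (E := F →L[ℝ] F) (E' := F →L[ℝ] F →L[ℝ] ℝ) (innerOpL F) hA
  obtain ⟨i1, e1⟩ := setIntegral_radial_bilin hρ h h hg hg
  obtain ⟨i2, e2⟩ := setIntegral_radial_green h2 hG
  obtain ⟨i3, e3⟩ := setIntegral_radial_hsNormSq h2 hG
  obtain ⟨i4, e4⟩ := setIntegral_green h h2 hg hG
  have hsymm : D2 =ᵐ[volume.restrict (cell a)] fun x => (D2 x).flip :=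
    ae_eq_of_forall_apply fun v => ae_eq_of_forall_apply fun w => h.symm_two h2 v w
  -- in this combination all terms containing second derivatives of `u`, or `|∇u|²`, cancel
  refine Eq.trans ?_ ((integral_sub_two_mul_add_add i1 i2 i3 i4 (2 - n)).trans ?_)
  · refine integral_congr_ae ?_
    filter_upwards [hsymm, heq, ae_restrict_mem (measurableSet_cell a)] with x hx1 hx2 hx
    have hx1' : ∀ v w, D2 x v w = D2 x w v := fun v w => by
      conv_lhs => rw [hx1]
      rfl
    simp only [hx2, fderivWithin_clm_comp (E := F →L[ℝ] F) (E' := F →L[ℝ] F →L[ℝ] ℝ)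
        (innerOpL F) (uniqueDiffOn_cell a) hA hx,
      innerOpL_apply, inner_add_right,
      inner_smul_right, hAs x hx (D x x), hAs x hx (u x) (u x), hx1' x,
      real_inner_comm (A x (u x)) (D x x)]
    rw [real_inner_comm (u x) (fderivWithin ℝ A (cell a) x x (u x))]
    ring
  · rw [e1, e2, e3, e4]
    rfl

end Pohozaev

/-! ### The boundary conditions and the scaling of the potential -/

section Periodic

variable {n m : ℕ} {a : Module.Basis (Fin n) ℝ (Pos n)} {V : Pos n → Matrix (Fin m) (Fin m) ℝ}

lemma inner_act_left {ι : Type*} [Fintype ι] [DecidableEq ι] (M : Matrix ι ι ℝ)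
    (v w : EuclideanSpace ℝ ι) : ⟪act M v, w⟫_ℝ = ⟪v, act M.transpose w⟫_ℝ := by
  simp only [EuclideanSpace.inner_eq_star_dotProduct, act, Matrix.ofLp_toLpLin,
    Matrix.toLin'_apply, star_trivial]
  rw [dotProduct_comm, ← Matrix.vecMul_transpose, ← Matrix.dotProduct_mulVec, dotProduct_comm]

lemma transpose_rotMat_mul_self (ϑ : ℝ) : (rotMat m ϑ).transpose * rotMat m ϑ = 1 := by
  rw [rotMat, ← Matrix.kroneckerMap_transpose, ← Matrix.mul_kronecker_mul, Matrix.transpose_one,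
    one_mul, ← Matrix.one_kronecker_one]
  congr 1
  ext i j
  fin_cases i <;> fin_cases j <;> simp [Matrix.mul_apply, Fin.sum_univ_two] <;>
    nlinarith [Real.sin_sq_add_cos_sq (2 * Real.pi * ϑ)]

/-- The rotations `M_j` are isometries. -/
lemma inner_act_rotMat (ϑ : ℝ) (v w : Val m) :
    ⟪act (rotMat m ϑ) v, act (rotMat m ϑ) w⟫_ℝ = ⟪v, w⟫_ℝ := by
  rw [inner_act_left, act, act, ← LinearMap.comp_apply, ← Matrix.toLpLin_mul_same,
    transpose_rotMat_mul_self, Matrix.toLpLin_one, LinearMap.id_apply]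

/-- Under the boundary conditions the contributions of opposite faces to `∫ (u, ∂_ν u)` cancel. -/
lemma ThetaBC.boundaryIntegral_inner_eq_zero {θ : Fin n → ℝ} {g : Pos n → Val m}
    {G : Pos n → Pos n →L[ℝ] Val m} (h : ThetaBC a θ g G) :
    (boundaryIntegral a fun x ν => ⟪g x, G x ν⟫_ℝ) = 0 := by
  refine Finset.sum_eq_zero fun j _ => ?_
  rw [Fin.sum_univ_two, ← integral_face_one a j (fun x => ⟪g x, G x (faceNormal a j 0)⟫_ℝ),
    add_eq_zero_iff_eq_neg', ← integral_neg]
  refine integral_congr_ae ?_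
  filter_upwards [h j] with x hx
  rw [hx.1, hx.2, inner_neg_right, inner_act_rotMat]

lemma contDiffOn_potR (hV : ∀ k l, ContDiffOn ℝ 1 (fun x => V x k l) (cell a)) {t : ℝ}
    (ht : t ∈ Icc (0 : ℝ) 1) : ContDiffOn ℝ 1 (fun x => actL (potR V t x)) (cell a) := by
  refine contDiffOn_actL fun i j => ?_
  simp_rw [potR_apply]
  have h : ContDiffOn ℝ 1 (fun x => V (t • x) i.1 j.1) (cell a) :=
    (hV i.1 j.1).comp (contDiff_id.const_smul t).contDiffOn fun x hx => smul_mem_cell a hx ht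
  exact (contDiffOn_const.mul h).mul contDiffOn_const

lemma hasFDerivWithinAt_potR (hV : ∀ k l, ContDiffOn ℝ 1 (fun x => V x k l) (cell a)) {t : ℝ}
    (ht : t ∈ Icc (0 : ℝ) 1) {x : Pos n} (hx : x ∈ cell a) (i j : Fin m × Fin 2) :
    HasFDerivWithinAt (fun x => potR V t x i j)
      ((t ^ 3 * (1 : Matrix (Fin 2) (Fin 2) ℝ) i.2 j.2) •
        fderivWithin ℝ (fun y => V y i.1 j.1) (cell a) (t • x)) (cell a) x := by
  simp_rw [potR_apply]
  have h1 : HasFDerivWithinAt (fun y => V y i.1 j.1) _ (cell a) (t • x) :=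
    ((hV i.1 j.1).differentiableOn (by simp) _ (smul_mem_cell a hx ht)).hasFDerivWithinAt
  have h2 : HasFDerivWithinAt (fun x : Pos n => t • x)
      (t • ContinuousLinearMap.id ℝ (Pos n)) (cell a) x :=
    (hasFDerivWithinAt_id x _).const_smul t
  have h3 := h1.comp x h2 fun y hy => smul_mem_cell a hy ht
  have h4 := (h3.const_mul (t ^ 2)).mul_const ((1 : Matrix (Fin 2) (Fin 2) ℝ) i.2 j.2)
  refine h4.congr_fderiv ?_
  ext v
  simp
  ring

/-- Since `V_t(x) = t² V(t x)`, the derivatives of `V_t(x)` in `t` and in the radial direction are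
related by `t ∂_t V_t = 2 V_t + x · ∇ V_t`. -/
lemma smul_actL_potRDeriv (hV : ∀ k l, ContDiffOn ℝ 1 (fun x => V x k l) (cell a)) {t : ℝ}
    (ht : t ∈ Icc (0 : ℝ) 1) {x : Pos n} (hx : x ∈ cell a) :
    t • actL (potRDeriv V t x) = (2 : ℝ) • actL (potR V t x) +
      fderivWithin ℝ (fun y => actL (potR V t y)) (cell a) x x := by
  have hd : HasFDerivWithinAt (fun y => actL (potR V t y)) _ (cell a) x :=
    (HasFDerivWithinAt.fun_sum fun i _ => HasFDerivWithinAt.fun_sum fun j _ =>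
      (hasFDerivWithinAt_potR hV ht hx i j).smul_const
        (actL (Matrix.single i j (1 : ℝ)))).congr_of_eventuallyEq
      (Eventually.of_forall fun y => actL_eq_sum (potR V t y)) (actL_eq_sum (potR V t x))
  rw [hd.fderivWithin (uniqueDiffOn_cell a x hx), actL_eq_sum (potRDeriv V t x),
    actL_eq_sum (potR V t x)]
  simp only [Finset.smul_sum, sum_apply, ContinuousLinearMap.smulRight_apply,
    smul_apply, ← Finset.sum_add_distrib, smul_smul]
  refine Finset.sum_congr rfl fun i _ => Finset.sum_congr rfl fun j _ => ?_
  rw [potRDeriv_apply hV hx ht, potR_apply]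
  refine Eq.trans ?_ (add_smul _ _ _)
  congr 1
  simp
  ring

/-- The quadratic form of `∂V_{t,ℝ}/∂t` on a quasi-periodic solution as an integral over the
boundary. -/
theorem setIntegral_inner_potRDeriv {θ : Fin n → ℝ}
    (hVsymm : ∀ᵐ x ∂(volume.restrict (cell a)), (V x).transpose = V x)
    (hV : ∀ k l, ContDiffOn ℝ 1 (fun x => V x k l) (cell a)) {t : ℝ}
    (ht : t ∈ Ioc (0 : ℝ) 1) (u : thetaKer a θ V t) {g : Pos n → Val m}
    {G : Pos n → Pos n →L[ℝ] Val m} (hg : IsTrace a (fn u.1) g) (hG : IsGradTrace a (fn u.1) G) :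
    ∫ x in cell a, ⟪fn u.1 x, act (potRDeriv V t x) (fn u.1 x)⟫_ℝ =
      t⁻¹ * ((boundaryIntegral a fun x ν => ⟪x, ν⟫_ℝ * ⟪act (potR V t x) (g x), g x⟫_ℝ) -
      2 * (boundaryIntegral a fun x ν => ⟪G x x, G x ν⟫_ℝ) +
      boundaryIntegral a fun x ν => ⟪x, ν⟫_ℝ * hsNormSq (G x)) := by
  have ht' : t ∈ Icc (0 : ℝ) 1 := ⟨ht.1.le, ht.2⟩
  obtain ⟨D, hD, hGD⟩ := hG
  obtain ⟨D2, hD2, -⟩ := hGD.2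
  have heq : ∀ᵐ x ∂(volume.restrict (cell a)),
      ∑ i, D2 x (EuclideanSpace.single i 1) (EuclideanSpace.single i 1) =
        actL (potR V t x) (fn u.1 x) := by
    filter_upwards [u.2.1, snd_eq_neg_trace u.1 hD hD2] with x h1 h2
    rw [h2] at h1
    exact (neg_add_eq_zero.mp h1)
  have hs : ∀ x ∈ cell a, ∀ v w, ⟪actL (potR V t x) v, w⟫_ℝ = ⟪v, actL (potR V t x) w⟫_ℝ :=
    fun x hx v w => (inner_act_comm (transpose_potR hVsymm hV hx ht') v w).symm
  have key := setIntegral_pohozaev (contDiffOn_potR hV ht') hs hD hD2 hg hGD heq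
  -- the last boundary term does not depend on the choice of the traces, by Green's identity
  have h0 : (boundaryIntegral a fun x ν => ⟪g x, G x ν⟫_ℝ) = 0 := by
    obtain ⟨-, g', G', hg', ⟨D', hD', hG'⟩, hbc⟩ := u.2.2
    have hG'' : IsTrace a D G' := hG'.congr (hD'.unique hD)
    rw [← (setIntegral_green hD hD2 hg hGD).2, (setIntegral_green hD hD2 hg' hG'').2,
      hbc.boundaryIntegral_inner_eq_zero]
  rw [h0, mul_zero, add_zero] at key
  rw [eq_inv_mul_iff_mul_eq₀ ht.1.ne', ← integral_const_mul]
  refine Eq.trans (setIntegral_congr_fun (measurableSet_cell a) fun x hx => ?_) key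
  have h1 := congrArg (fun L : Val m →L[ℝ] Val m => ⟪fn u.1 x, L (fn u.1 x)⟫_ℝ)
    (smul_actL_potRDeriv hV ht' hx)
  simp only [smul_apply, add_apply, inner_smul_right, actL_apply] at h1
  exact h1

end Periodic

/-! ### Quadratic forms in complex notation -/

section ComplexNotation

variable {n m : ℕ} {a : Module.Basis (Fin n) ℝ (Pos n)}

lemma re_inner_toC (v w : Val m) : (⟪toC v, toC w⟫_ℂ).re = ⟪v, w⟫_ℝ := by
  simp [toC, PiLp.inner_apply, Fintype.sum_prod_type, Fin.sum_univ_two]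

lemma gradNormSq_eq (L : Pos n →L[ℝ] Val m) : gradNormSq L = hsNormSq L := by
  refine Finset.sum_congr rfl fun j _ => ?_
  rw [← re_inner_toC, inner_self_eq_norm_sq_to_K]
  norm_cast

lemma actC_toC (M : Matrix (Fin m) (Fin m) ℝ) (v : Val m) :
    actC M (toC v) = toC (act (M ⊗ₖ (1 : Matrix (Fin 2) (Fin 2) ℝ)) v) := by
  ext k
  simp only [actC, toC, act, Matrix.ofLp_toLpLin, Matrix.toLin'_apply, Matrix.mulVec, dotProduct,
    Fintype.sum_prod_type, Matrix.kroneckerMap_apply, Matrix.one_apply, Matrix.map_apply]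
  simp [mul_add, Finset.sum_add_distrib, Finset.mul_sum, mul_left_comm]

/-- A symmetric real matrix has a real quadratic form on `ℂᵐ`. -/
lemma inner_actC {M : Matrix (Fin m) (Fin m) ℝ} (hM : M.transpose = M) (v : Val m) :
    ⟪toC v, actC M (toC v)⟫_ℂ =
      ((⟪v, act (M ⊗ₖ (1 : Matrix (Fin 2) (Fin 2) ℝ)) v⟫_ℝ : ℝ) : ℂ) := by
  have him : (⟪toC v, actC M (toC v)⟫_ℂ).im = 0 := by
    rw [← Complex.conj_eq_iff_im, inner_conj_symm]
    simp only [EuclideanSpace.inner_eq_star_dotProduct, actC, Matrix.ofLp_toLpLin,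
      Matrix.toLin'_apply, Matrix.star_mulVec]
    rw [dotProduct_comm, ← Matrix.dotProduct_mulVec, dotProduct_comm]
    congr 2
    ext i j
    simpa using congrFun (congrFun hM i) j
  refine Complex.ext ?_ (by rw [him, Complex.ofReal_im])
  rw [actC_toC, re_inner_toC, Complex.ofReal_re]

lemma boundaryIntegral_ofReal (f : Pos n → Pos n → ℝ) :
    (boundaryIntegral a fun x ν => (f x ν : ℂ)) = (boundaryIntegral a f : ℝ) := by
  simp only [boundaryIntegral, integral_complex_ofReal]
  push_cast
  rfl

lemma boundaryIntegral_const_mul (c : ℝ) (f : Pos n → Pos n → ℝ) :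
    (boundaryIntegral a fun x ν => c * f x ν) = c * boundaryIntegral a f := by
  simp only [boundaryIntegral, integral_const_mul, Finset.mul_sum]

/-- `toC` as a bounded operator. -/
noncomputable def toCL (m : ℕ) : Val m →L[ℝ] EuclideanSpace ℂ (Fin m) :=
  LinearMap.toContinuousLinearMap
    { toFun := toC
      map_add' := fun v w => by
        ext k
        simp [toC]
        ring
      map_smul' := fun c v => by
        ext k
        simp [toC]
        ring }

lemma re_boundaryIntegral_toC {G : Pos n → Pos n →L[ℝ] Val m}
    (hG : ∀ j s, MemLp G 2 ((μHE[n - 1] : Measure (Pos n)).restrict (face a j s))) :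
    (boundaryIntegral a fun x ν => ⟪toC (G x x), toC (G x ν)⟫_ℂ).re =
      boundaryIntegral a fun x ν => ⟪G x x, G x ν⟫_ℝ := by
  simp only [boundaryIntegral, Complex.re_sum]
  refine Finset.sum_congr rfl fun j _ => Finset.sum_congr rfl fun s _ => ?_
  have hx : MemLp (fun x => G x x) 2 ((μHE[n - 1] : Measure (Pos n)).restrict (face a j s)) :=
    memLp_clm_apply (ρ := fun x => ContinuousLinearMap.apply ℝ (Val m) x)
      (memLp_top_of_continuousOn (isCompact_face a j s) (isClosed_face a j s).measurableSet
        (ContinuousLinearMap.apply ℝ (Val m)).continuous.continuousOn) (hG j s)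
  have h1 := (toCL m).comp_memLp' hx
  have h2 := (toCL m).comp_memLp' (memLp_apply_const (hG j s) (faceNormal a j s))
  have hi : Integrable (fun x => ⟪toC (G x x), toC (G x (faceNormal a j s))⟫_ℂ)
      ((μHE[n - 1] : Measure (Pos n)).restrict (face a j s)) := by
    refine (L2.integrable_inner (𝕜 := ℂ) h1.toLp h2.toLp).congr ?_
    filter_upwards [h1.coeFn_toLp, h2.coeFn_toLp] with x e1 e2
    rw [e1, e2]
    rfl
  refine (Complex.reCLM.integral_comp_comm hi).symm.trans (integral_congr_ae ?_)
  exact Eventually.of_forall fun x => re_inner_toC _ _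

end ComplexNotation

end PeriodicMaslov

theorem theorem3p18 (n m : ℕ) (hn : 0 < n)
    (a : Module.Basis (Fin n) ℝ (Pos n)) (θ : Fin n → ℝ)
    (V : Pos n → Matrix (Fin m) (Fin m) ℝ)
    (hVsymm : ∀ᵐ x ∂(volume.restrict (cell a)), (V x).transpose = V x)
    (hV : ∀ k l, ContDiffOn ℝ 1 (fun x => V x k l) (cell a))
    (τ t₀ : ℝ) (hτ : τ ∈ Ioo (0 : ℝ) 1) (ht₀ : t₀ ∈ Icc τ 1) :
    ∃ q : LinearMap.BilinForm ℝ
        ↥(bvPath a V t₀ ⊓ thetaBV a m θ),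
      IsCrossingForm (sympl a m) (thetaBV a m θ)
        (bvPath a V) τ 1 t₀ q ∧
      (∀ q', IsCrossingForm (sympl a m)
        (thetaBV a m θ) (bvPath a V) τ 1 t₀ q' → q' = q) ∧
      ∀ u : thetaKer a θ V t₀,
        q (kerClass a θ V t₀ u) (kerClass a θ V t₀ u) =
          ∫ x in cell a,
            ⟪fn u.1 x,
              act (potRDeriv V t₀ x)
                (fn u.1 x)⟫_ℝ ∧
        ∀ (g : Pos n → Val m)
          (G : Pos n → Pos n →L[ℝ] Val m),
          IsTrace a (fn u.1) g →
          IsGradTrace a (fn u.1) G →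
          ∫ x in cell a,
            ⟪fn u.1 x,
              act (potRDeriv V t₀ x)
                (fn u.1 x)⟫_ℝ =
            t₀ * (boundaryIntegral a fun x ν =>
                ((⟪x, ν⟫_ℝ : ℝ) : ℂ) *
                  ⟪toC (g x),
                    actC (V (t₀ • x)) (toC (g x))⟫_ℂ).re
            + t₀⁻¹ * (boundaryIntegral a fun x ν =>
                ⟪x, ν⟫_ℝ * gradNormSq (G x))
            - 2 * t₀⁻¹ * (boundaryIntegral a fun x ν =>
                ⟪toC (G x x), toC (G x ν)⟫_ℂ).re := by
  have ht : t₀ ∈ Ioc (0 : ℝ) 1 := ⟨hτ.1.trans_le ht₀.1, ht₀.2⟩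
  have ht' : t₀ ∈ Icc (0 : ℝ) 1 := ⟨ht.1.le, ht.2⟩
  obtain ⟨q, hq, hqu⟩ := exists_crossingForm hn θ hVsymm hV hτ ht₀
  refine ⟨q, hq, fun q' hq' => hq.unique hτ.2 ht₀ hq', fun u => ⟨?_, fun g G hg hG => ?_⟩⟩
  · rw [hqu, L2.inner_def]
    refine integral_congr_ae ?_
    filter_upwards [potDerivOp_coeFn hV ht' u.1.1.fst] with x hx
    rw [hx]
    rfl
  · have hGm : ∀ j s, MemLp G 2 ((μHE[n - 1] : Measure (Pos n)).restrict (face a j s)) := by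
      obtain ⟨D, -, hGD⟩ := hG
      exact fun j s => hGD.memLp_face j s
    have h1 : (boundaryIntegral a fun x ν => ((⟪x, ν⟫_ℝ : ℝ) : ℂ) *
        ⟪toC (g x), actC (V (t₀ • x)) (toC (g x))⟫_ℂ).re =
        (t₀ ^ 2)⁻¹ *
          boundaryIntegral a fun x ν => ⟪x, ν⟫_ℝ * ⟪act (potR V t₀ x) (g x), g x⟫_ℝ := by
      rw [← boundaryIntegral_const_mul, ← Complex.ofReal_re (boundaryIntegral a _),
        ← boundaryIntegral_ofReal]
      congr 1
      refine boundaryIntegral_congr fun x hx ν => ?_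
      rw [inner_actC (transpose_eq_of_ae hVsymm hV (smul_mem_cell a hx ht')),
        real_inner_comm (g x), ← Complex.ofReal_mul, potR, Matrix.smul_kronecker]
      congr 1
      rw [act, act, map_smul, LinearMap.smul_apply, inner_smul_right]
      have := ht.1.ne'
      field_simp
    rw [setIntegral_inner_potRDeriv hVsymm hV ht u hg hG, h1, re_boundaryIntegral_toC hGm]
    simp only [gradNormSq_eq]
    have := ht.1.ne'
    field_simp
    ring
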